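/- **Setting.** Let $\Omega$ be a rectangle $\prod_{n=1}^d(0,L_n)$, $d\in\{1,2,3\}$, with Dirichlet, Neumann or periodic boundary conditions (in the periodic case $\Omega$ is the fundamental cell of the torus), or an open nondegenerate planar triangle ($d=2$) with Dirichlet or Neumann boundary conditions. Let $H=L^2(\Omega)$; let $V=W^{1,2}_0(\Omega)$ (Dirichlet) or $V=W^{1,2}(\Omega)$ (Neumann; periodic: $W^{1,2}$ of the torus), with $(v,w)_V=(\nabla v,\nabla w)_{L^2}+(v,w)_{L^2}$; let $A\colon V\to V'$, $\langle Av,w\rangle=(v,w)_V$, $\mathrm D(A)=\{v\in V: Av\in H\}$ with norm $\|Av\|_H$, and $A_0=A-1=-\Delta$. Put $\langle A^2v,w\rangle=(Av,Aw)_H$ for $v,w\in \mathrm D(A)$, so that $A^2\colon \mathrm D(A)\to \mathrm D(A)'$. **Actuators.** Let $\omega=\prod_n(-l_n,l_n)$, $l_n>0$, be a box with $d+2$ pairwise disjoint translates in $\Omega$, centered at points $c_{1,0},\dots,c_{1,d}$ that lie in no common hyperplane, and at $c_2$. For $M\ge1$ divide $\Omega$ into cells similar to $\Omega$: $M^d$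 translates of $M^{-1}\Omega$ if $\Omega$ is a rectangle; if $\Omega$ is a triangle, the $4^{M-1}$ triangles obtained by $M-1$ successive subdivisions by the midpoints of the edges. For a cell $k$ let $S_k$ be the affine bijection (translation, homothety and rotation by $0$ or $\pi$) of the cell onto $\Omega$. With $\varphi(z)=1_\omega(z)\prod_n\sin\big(\pi\tfrac{z_n+l_n}{2l_n}\big)$, the actuators are $\Phi_{k,j}=1_\omega(S_kx-c_{1,j})$, $0\le j\le d$, and $\Psi_k=1_\omega(S_kx-c_2)$, with spans $\mathcal U_M$ and $\mathcal V_M$; the auxiliary functions are $\widetilde\Phi_{k,j}=\varphi^2(S_kx-c_{1,j})$ and $\widetilde\Psi_k=\varphi(S_kx-c_2)$, with spans $\widetilde{\mathcal U}_M\subset \mathrm D(A)$ and $\widetilde{\mathcal V}_M\subset V$. Let $P_F^G$ denote the oblique projection onto $F$ along $G$; the projections $P_{\mathcal U_M}^{\widetilde{\mathcal U}_M^\perp}$ and $P_{\mathcal V_M}^{\widetilde{\mathcal V}_M^\perp}$ are extended by duality to $\mathrm D(A)'$ and $V'$. Put $$\mathbf F_1=-\lambda_1P_{\mathcal U_M}^{\widetilde{\mathcal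 U}_M^\perp}A^2P_{\widetilde{\mathcal U}_M}^{\mathcal U_M^\perp},\qquad \mathbf F_2=-\lambda_2P_{\mathcal V_M}^{\widetilde{\mathcal V}_M^\perp}AP_{\widetilde{\mathcal V}_M}^{\mathcal V_M^\perp}.$$ **System.** Let $\nu_0,\nu_1\in\mathbb R$, $\nu_2>0$, $f,g\colon\mathbb R\to\mathbb R$, and let $h=(h_1,h_2)$ be a function of time $t>0$ with values in $\mathrm D(A)'\times V'$. With $q=(q_1,q_2)$ consider $$\partial_ty_1+\nu_2\Delta^2y_1-\Delta(f(y_1)-\nu_1y_2)+g(y_1)=h_1+q_1,\qquad \partial_t(y_2+\nu_0y_1)-\Delta y_2=h_2+q_2,$$ with the chosen boundary conditions. A (weak) solution on $[0,\infty)$ is a $y=(y_1,y_2)\in C([0,\infty);H\times H)\cap L^2_{\rm loc}([0,\infty);\mathrm D(A)\times V)$ with $\partial_ty_1\in L^2_{\rm loc}([0,\infty);\mathrm D(A)')$ and $\partial_t(y_2+\nu_0y_1)\in L^2_{\rm loc}([0,\infty);V')$ such that, for almost every $t>0$, $f(y_1(t)),g(y_1(t))\in L^2(\Omega)$ and the equations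 hold in $\mathrm D(A)'\times V'$, where $-\Delta f(y_1)$ stands for the functional $\phi\mapsto(f(y_1)-f(0),A_0\phi)_H$ and $\Delta^2y_1$ for $\phi\mapsto(A_0y_1,A_0\phi)_H$. The target $y_{\tt r}$ is a solution with $q=0$. The controlled trajectory $y_{\tt c}$ is a solution with $q_1=\mathbf F_1y_1$ and $q_2=\mathbf F_2(y_2+\nu_0y_1)$, where $y=(y_1,y_2)=y_{\tt c}-y_{\tt r}$. **Growth assumption**, with an integer $n\ge1$ and constants $C_f,C_g,\zeta_i^f,\eta_i^f,\zeta_i^g,\eta_i^g\ge0$ such that $\eta_i^f,\eta_i^g<2$, $\zeta_i^f+\eta_i^f\ge2$, $\zeta_i^g+\eta_i^g\ge2$ for $1\le i\le n$: for almost all $t>0$ and all $z\in \mathrm D(A)$, $$-\langle A_0N_f(t,z),z\rangle\le C_f\sum_{i=1}^n\|z\|_H^{\zeta_i^f}\|z\|_{\mathrm D(A)}^{\eta_i^f},\qquad -\langle N_g(t,z),z\rangle\le C_g\sum_{i=1}^n\|z\|_H^{\zeta_i^g}\|z\|_{\mathrm D(A)}^{\eta_i^g},$$ where $N_f(t,z)=f(y_{1\tt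 r}(t)+z)-f(y_{1\tt r}(t))$, $N_g(t,z)=g(y_{1\tt r}(t)+z)-g(y_{1\tt r}(t))$ and $\langle A_0N_f,z\rangle=(N_f,A_0z)_H$; each inequality is required only where $N_f(t,z)$, respectively $N_g(t,z)$, is in $L^2(\Omega)$. **Corollary (semiglobal exponential stabilization to trajectories).** Let $\Omega$, the boundary conditions, and the data $\omega,c_{1,j},c_2$ of the actuators be fixed. For every $\mu>0$ there is $\overline\lambda_2\ge0$ such that for all $R>0$, $\nu_0,\nu_1\in\mathbb R$, $\nu_2>0$ and all constants $n,C_f,C_g,\zeta_i^f,\eta_i^f,\zeta_i^g,\eta_i^g$ as above there are $\overline M\ge1$ and $\overline\lambda_1\ge0$ with the following property. For all $f,g,h$ and every target $y_{\tt r}$ that satisfies the growth assumption with these constants, for all $M\ge\overline M$, $\lambda_1\ge\overline\lambda_1$, $\lambda_2\ge\overline\lambda_2$, and every controlled trajectory $y_{\tt c}$ with $$\|(y_1(0),\,y_2(0)+\nu_0y_1(0))\|_{H\times H}\le R,\qquad y=y_{\tt c}-y_{\tt r},$$ one has $$\|y(t)\|_{H\times H}^2\le4(1+\nu_0^2)^2e^{-2\mu(t-s)}\|y(s)\|_{H\times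 H}^2\qquad\text{for all }t\ge s\ge0.$$ -/

import Mathlib

open MeasureTheory Set
open scoped ContDiff

namespace CahnHilliard

/-! ### Spatial domains and boundary conditions -/

/-- The Euclidean space `ℝ^d`. -/
abbrev E (d : ℕ) := EuclideanSpace ℝ (Fin d)

inductive BoundaryCondition
  | dirichlet
  | neumann
  | periodic

/-- The spatial domains for which the actuators are constructed: a rectangle
`(0, L 0) × ⋯ × (0, L (d-1))` (which is also the fundamental cell of the torus in the periodic
case), or the open planar triangle with vertices `p 0`, `p 1`, `p 2`. -/
inductive Domain (d : ℕ)
  | box (L : Fin d → ℝ)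
  | triangle (p : Fin 3 → E d)

namespace Domain

variable {d : ℕ}

def region : Domain d → Set (E d)
  | .box L => {x | ∀ n, 0 < x n ∧ x n < L n}
  | .triangle p => interior (convexHull ℝ (Set.range p))

/-- The admissible pairs of a domain and a boundary condition. Rectangles are taken in dimension
`1`, `2` or `3`, with any of the three boundary conditions; triangles are nondegenerate, planar,
and not combined with periodic boundary conditions. -/
def Admissible : Domain d → BoundaryCondition → Prop
  | .box L, _ => (d = 1 ∨ d = 2 ∨ d = 3) ∧ ∀ n, 0 < L n
  | .triangle p, bc => d = 2 ∧ AffineIndependent ℝ p ∧ bc ≠ .periodic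

/-- The periods of the torus (only meaningful for rectangles). -/
def periods : Domain d → Set (E d)
  | .box L => {v | ∃ n, v = EuclideanSpace.single n (L n)}
  | .triangle _ => ∅

theorem measurableSet_region (D : Domain d) : MeasurableSet D.region := by
  cases D with
  | box L =>
    have : (Domain.box L).region = ⋂ n, {x : E d | 0 < x n ∧ x n < L n} := by
      ext x; simp [region]
    rw [this]
    refine MeasurableSet.iInter fun n => ?_
    have hn : Measurable fun x : E d => x n := by fun_prop
    exact (measurableSet_lt measurable_const hn).inter (measurableSet_lt hn measurable_const)
  | triangle p => exact isOpen_interior.measurableSet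

theorem isBounded_region (D : Domain d) : Bornology.IsBounded D.region := by
  cases D with
  | box L =>
    refine (Metric.isBounded_iff_subset_closedBall (0 : E d)).2 ⟨√(∑ n, (L n) ^ 2), ?_⟩
    intro x hx
    rw [mem_closedBall_zero_iff, EuclideanSpace.norm_eq]
    refine Real.sqrt_le_sqrt (Finset.sum_le_sum fun n _ => ?_)
    have h := hx n
    rw [Real.norm_eq_abs, sq_abs]
    nlinarith [h.1, h.2]
  | triangle p =>
    exact ((isBounded_convexHull).2 (Set.finite_range p).isBounded).subset interior_subset

instance (D : Domain d) : IsFiniteMeasure (volume.restrict D.region) :=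
  ⟨by simpa using D.isBounded_region.measure_lt_top⟩

end Domain

variable {d : ℕ}

/-- A bounded measurable function is square integrable on the domain. -/
theorem memLp_of_bounded (D : Domain d) {φ : E d → ℝ} (hφ : Measurable φ)
    (C : ℝ) (hC : ∀ x, |φ x| ≤ C) : MemLp φ 2 (volume.restrict D.region) :=
  MemLp.of_bound hφ.aestronglyMeasurable C (Filter.Eventually.of_forall hC)

/-- A continuous function is square integrable on the (bounded) domain. -/
theorem memLp_of_continuous (D : Domain d) {φ : E d → ℝ} (hφ : Continuous φ) :
    MemLp φ 2 (volume.restrict D.region) := by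
  obtain ⟨C, hC⟩ := D.isBounded_region.isCompact_closure.exists_bound_of_continuousOn
    hφ.continuousOn
  refine MemLp.of_bound hφ.aestronglyMeasurable C ?_
  filter_upwards [ae_restrict_mem D.measurableSet_region] with x hx
  exact hC x (subset_closure hx)

/-! ### Function spaces -/

/-- The pivot space `H = L²(Ω)`. -/
noncomputable abbrev H (D : Domain d) := Lp ℝ 2 (volume.restrict D.region)

/-- `L²(Ω) × L²(Ω)^d`, with its Hilbert space structure. An element stands for a function together
with its gradient. -/
noncomputable abbrev HGrad (D : Domain d) := WithLp 2 (H D × PiLp 2 fun _ : Fin d => H D)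

/-- The partial derivative of a smooth function. -/
noncomputable def pderiv (φ : E d → ℝ) (i : Fin d) (x : E d) : ℝ :=
  fderiv ℝ φ x (EuclideanSpace.single i 1)

theorem continuous_pderiv {φ : E d → ℝ} (hφ : ContDiff ℝ ∞ φ) (i : Fin d) :
    Continuous (pderiv φ i) :=
  (hφ.continuous_fderiv (by simp)).clm_apply continuous_const

/-- Smooth test functions: compactly supported in `Ω`, or smooth functions on the torus. -/
def IsTestFunction (D : Domain d) : BoundaryCondition → (E d → ℝ) → Prop
  | .periodic, φ => ContDiff ℝ ∞ φ ∧ ∀ v ∈ D.periods, ∀ x, φ (x + v) = φ x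
  | _, φ => ContDiff ℝ ∞ φ ∧ HasCompactSupport φ ∧ tsupport φ ⊆ D.region

theorem IsTestFunction.contDiff {D : Domain d} {bc : BoundaryCondition} {φ : E d → ℝ}
    (h : IsTestFunction D bc φ) : ContDiff ℝ ∞ φ := by
  cases bc <;> exact h.1

/-- The vector field `G` is the weak gradient of `u`. -/
def IsWeakGradient (D : Domain d) (bc : BoundaryCondition) (u : H D) (G : Fin d → H D) : Prop :=
  ∀ φ, IsTestFunction D bc φ → ∀ i,
    ∫ x in D.region, u x * pderiv φ i x = - ∫ x in D.region, G i x * φ x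

/-- The Sobolev space `W^{1,2}` of `Ω` (or of the torus), as the space of the pairs `(u, ∇u)`. -/
noncomputable def W12 (D : Domain d) (bc : BoundaryCondition) : Submodule ℝ (HGrad D) where
  carrier := {p | IsWeakGradient D bc p.fst p.snd}
  zero_mem' := by
    intro φ hφ i
    have h0 : ((0 : H D) : E d → ℝ) =ᵐ[volume.restrict D.region] 0 := Lp.coeFn_zero _ _ _
    rw [integral_eq_zero_of_ae, integral_eq_zero_of_ae, neg_zero]
    · filter_upwards [h0] with x hx
      change (0 : H D) x * _ = 0
      rw [hx, Pi.zero_apply, zero_mul]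
    · filter_upwards [h0] with x hx
      change (0 : H D) x * _ = 0
      rw [hx, Pi.zero_apply, zero_mul]
  add_mem' := by
    intro p q hp hq φ hφ i
    have key : ∀ (a b : H D) (ψ : E d → ℝ), Continuous ψ →
        ∫ x in D.region, (a + b : H D) x * ψ x
          = (∫ x in D.region, a x * ψ x) + ∫ x in D.region, b x * ψ x := by
      intro a b ψ hψ
      have hψ2 := memLp_of_continuous D hψ
      have ha : Integrable (fun x => a x * ψ x) (volume.restrict D.region) :=
        (Lp.memLp a).integrable_mul hψ2
      have hb : Integrable (fun x => b x * ψ x) (volume.restrict D.region) :=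
        (Lp.memLp b).integrable_mul hψ2
      rw [← integral_add ha hb]
      refine integral_congr_ae ?_
      filter_upwards [Lp.coeFn_add a b] with x hx
      rw [hx, Pi.add_apply, add_mul]
    have h1 := hp φ hφ i
    have h2 := hq φ hφ i
    have e1 := key p.fst q.fst (pderiv φ i) (continuous_pderiv hφ.contDiff i)
    have e2 := key (p.snd i) (q.snd i) φ hφ.contDiff.continuous
    change ∫ x in D.region, (p.fst + q.fst : H D) x * pderiv φ i x
      = - ∫ x in D.region, (p.snd i + q.snd i : H D) x * φ x
    rw [e1, e2, h1, h2]
    ring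
  smul_mem' := by
    intro c p hp φ hφ i
    have key : ∀ (a : H D) (ψ : E d → ℝ),
        ∫ x in D.region, (c • a : H D) x * ψ x = c * ∫ x in D.region, a x * ψ x := by
      intro a ψ
      rw [← integral_const_mul]
      refine integral_congr_ae ?_
      filter_upwards [Lp.coeFn_smul c a] with x hx
      rw [hx, Pi.smul_apply, smul_eq_mul, mul_assoc]
    change ∫ x in D.region, (c • p.fst : H D) x * pderiv φ i x
      = - ∫ x in D.region, (c • p.snd i : H D) x * φ x
    rw [key, key, hp φ hφ i]
    ring

/-- `W₀^{1,2}(Ω)`, the closure in `W^{1,2}(Ω)` of the smooth functions compactly supported in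
`Ω`. -/
noncomputable def W012 (D : Domain d) : Submodule ℝ (HGrad D) :=
  (Submodule.span ℝ {p : HGrad D | ∃ φ : E d → ℝ, IsTestFunction D .dirichlet φ ∧
    p.fst =ᵐ[volume.restrict D.region] φ ∧
    ∀ i, p.snd i =ᵐ[volume.restrict D.region] pderiv φ i}).topologicalClosure

/-- The space `V` (as the space of the pairs `(u, ∇u)`). It inherits the inner product
`(u, w)_V = (∇u, ∇w)_{L²} + (u, w)_{L²} = ⟨A u, w⟩_{V',V}`. -/
noncomputable def VSub (D : Domain d) : BoundaryCondition → Submodule ℝ (HGrad D)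
  | .dirichlet => W012 D
  | .neumann => W12 D .neumann
  | .periodic => W12 D .periodic

def V (D : Domain d) (bc : BoundaryCondition) : Type := VSub D bc

noncomputable instance (D : Domain d) (bc : BoundaryCondition) : NormedAddCommGroup (V D bc) :=
  inferInstanceAs (NormedAddCommGroup (VSub D bc))

noncomputable instance (D : Domain d) (bc : BoundaryCondition) : InnerProductSpace ℝ (V D bc) :=
  inferInstanceAs (InnerProductSpace ℝ (VSub D bc))

/-- The inclusion of `V` in `H`. -/
noncomputable def V.toH (D : Domain d) (bc : BoundaryCondition) : V D bc →L[ℝ] H D :=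
  (WithLp.fstL 2 ℝ (H D) (PiLp 2 fun _ : Fin d => H D)).comp (VSub D bc).subtypeL

/-- The gradient of an element of `V`. -/
noncomputable def V.grad (D : Domain d) (bc : BoundaryCondition) :
    V D bc →L[ℝ] PiLp 2 fun _ : Fin d => H D :=
  (WithLp.sndL 2 ℝ (H D) (PiLp 2 fun _ : Fin d => H D)).comp (VSub D bc).subtypeL

theorem V.inner_eq (D : Domain d) (bc : BoundaryCondition) (v w : V D bc) :
    inner ℝ v w = inner ℝ (V.grad D bc v) (V.grad D bc w)
      + inner ℝ (V.toH D bc v) (V.toH D bc w) := by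
  rw [add_comm]
  exact WithLp.prod_inner_apply _ _

/-- The domain `D(A) = {u ∈ V : A u ∈ H}` of the shifted Laplacian, as the space of the pairs
`(u, A u)`. -/
noncomputable def DASub (D : Domain d) (bc : BoundaryCondition) : Submodule ℝ (H D × H D) where
  carrier := {p | ∃ v : V D bc, V.toH D bc v = p.1 ∧
    ∀ w : V D bc, inner ℝ v w = inner ℝ p.2 (V.toH D bc w)}
  zero_mem' := ⟨0, by simp, by simp⟩
  add_mem' := by
    rintro p q ⟨v, hv, hv'⟩ ⟨w, hw, hw'⟩
    exact ⟨v + w, by simp [hv, hw], fun z => by simp [inner_add_left, hv', hw']⟩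
  smul_mem' := by
    rintro c p ⟨v, hv, hv'⟩
    exact ⟨c • v, by simp [hv], fun z => by
      rw [real_inner_smul_left, Prod.smul_snd, hv', real_inner_smul_left]⟩

/-- The space `D(A)`. The norm that it inherits from `H × H` is `‖A u‖_H`, see `DA.norm_eq`. -/
def DA (D : Domain d) (bc : BoundaryCondition) : Type := DASub D bc

noncomputable instance (D : Domain d) (bc : BoundaryCondition) : NormedAddCommGroup (DA D bc) :=
  inferInstanceAs (NormedAddCommGroup (DASub D bc))

noncomputable instance (D : Domain d) (bc : BoundaryCondition) : NormedSpace ℝ (DA D bc) :=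
  inferInstanceAs (NormedSpace ℝ (DASub D bc))

/-- The inclusion of `D(A)` in `H`. -/
noncomputable def DA.toH (D : Domain d) (bc : BoundaryCondition) : DA D bc →L[ℝ] H D :=
  (ContinuousLinearMap.fst ℝ (H D) (H D)).comp (DASub D bc).subtypeL

/-- The shifted Laplacian `A = -Δ + 1` from `D(A)` to `H`. -/
noncomputable def DA.A (D : Domain d) (bc : BoundaryCondition) : DA D bc →L[ℝ] H D :=
  (ContinuousLinearMap.snd ℝ (H D) (H D)).comp (DASub D bc).subtypeL

/-- The Laplacian `A₀ = A - 1 = -Δ` from `D(A)` to `H`. -/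
noncomputable def DA.A₀ (D : Domain d) (bc : BoundaryCondition) : DA D bc →L[ℝ] H D :=
  DA.A D bc - DA.toH D bc

theorem DA.norm_eq (D : Domain d) (bc : BoundaryCondition) (z : DA D bc) :
    ‖z‖ = ‖DA.A D bc z‖ := by
  obtain ⟨v, hv, hv'⟩ := z.2
  have hle : ‖V.toH D bc v‖ ≤ ‖v‖ := WithLp.norm_fst_le (H D) v.1
  have h1 : ‖v‖ ^ 2 ≤ ‖z.1.2‖ * ‖v‖ := by
    rw [← real_inner_self_eq_norm_sq, hv']
    exact (real_inner_le_norm _ _).trans (by gcongr)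
  have h2 : ‖v‖ ≤ ‖z.1.2‖ := by
    by_contra! h
    nlinarith [norm_nonneg v, norm_nonneg z.1.2]
  have h3 : ‖z.1.1‖ ≤ ‖z.1.2‖ := by rw [← hv]; exact hle.trans h2
  exact max_eq_right h3

/-- `A² : D(A) → D(A)'`, `⟨A² z, w⟩ = (A z, A w)_H`. -/
noncomputable def DA.Asq (D : Domain d) (bc : BoundaryCondition) (z : DA D bc) :
    StrongDual ℝ (DA D bc) :=
  (innerSL ℝ (DA.A D bc z)).comp (DA.A D bc)

/-- `A : V → V'`, `⟨A v, w⟩ = (v, w)_V`. -/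
noncomputable def V.A (D : Domain d) (bc : BoundaryCondition) (v : V D bc) :
    StrongDual ℝ (V D bc) :=
  innerSL ℝ v

/-! ### Actuators and auxiliary functions -/

/-- The open box `ω = (-l 0, l 0) × ⋯ × (-l (d-1), l (d-1))`. -/
def omega (l : Fin d → ℝ) : Set (E d) := {z | ∀ n, -l n < z n ∧ z n < l n}

/-- The data of the actuators for `M = 1`: a box `ω` centered at the origin, and `d + 2` disjoint
translates of it in `Ω`, with centers `c₁ 0, …, c₁ d` (in no common hyperplane) and `c₂`. -/
structure ActuatorData (D : Domain d) where
  l : Fin d → ℝ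
  l_pos : ∀ n, 0 < l n
  c₁ : Fin (d + 1) → E d
  c₂ : E d
  subset₁ : ∀ j, {x | x - c₁ j ∈ omega l} ⊆ D.region
  subset₂ : {x | x - c₂ ∈ omega l} ⊆ D.region
  disjoint₁ : ∀ i j, i ≠ j → Disjoint {x | x - c₁ i ∈ omega l} {x | x - c₁ j ∈ omega l}
  disjoint₂ : ∀ j, Disjoint {x | x - c₁ j ∈ omega l} {x | x - c₂ ∈ omega l}
  affineIndependent : AffineIndependent ℝ c₁

/-- The indices of the rescaled copies of `Ω` that `Ω` is divided into: `M^d` copies for a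
rectangle; `4^(M-1)` copies for a triangle, which is divided `M - 1` times by the midpoints of the
edges. -/
abbrev Domain.Cell : Domain d → ℕ → Type
  | .box _, M => Fin d → Fin M
  | .triangle _, M => Fin (M - 1) → Fin 4

instance (D : Domain d) (M : ℕ) : Fintype (D.Cell M) :=
  match D with
  | .box _ => inferInstanceAs (Fintype (Fin d → Fin M))
  | .triangle _ => inferInstanceAs (Fintype (Fin (M - 1) → Fin 4))

/-- The affine bijection of a subtriangle of the midpoint subdivision onto the whole triangle:
`i = 0, 1, 2` is the subtriangle at the vertex `p i`, and `i = 3` is the central one, which is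
rotated by the angle `π`. -/
noncomputable def triangleUnscale (p : Fin 3 → E d) (i : Fin 4) (x : E d) : E d :=
  if h : i.val < 3 then (2 : ℝ) • x - p ⟨i.val, h⟩ else p 0 + p 1 + p 2 - (2 : ℝ) • x

/-- The bijection (a translation, a homothety and a rotation) of the copy with index `k` onto
`Ω`. -/
noncomputable def Domain.unscale : (D : Domain d) → (M : ℕ) → D.Cell M → E d → E d
  | .box L, M, k, x => WithLp.toLp 2 fun n => (M : ℝ) * x n - (k n : ℕ) * L n
  | .triangle p, _, k, x => (List.ofFn k).foldl (fun y i => triangleUnscale p i y) x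

/-- `φ(z) = 1_ω(z) ∏ₙ sin (π (zₙ + lₙ) / (2 lₙ))`. -/
noncomputable def bump (l : Fin d → ℝ) : E d → ℝ :=
  (omega l).indicator fun z => ∏ n, Real.sin (Real.pi * ((z n + l n) / (2 * l n)))

theorem measurableSet_omega (l : Fin d → ℝ) : MeasurableSet (omega l) := by
  have : omega l = ⋂ n, {x : E d | -l n < x n ∧ x n < l n} := by
    ext x; simp [omega]
  rw [this]
  refine MeasurableSet.iInter fun n => ?_
  have hn : Measurable fun x : E d => x n := by fun_prop
  exact (measurableSet_lt measurable_const hn).inter (measurableSet_lt hn measurable_const)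

theorem measurable_bump (l : Fin d → ℝ) : Measurable (bump l) :=
  Measurable.indicator (by fun_prop) (measurableSet_omega l)

theorem abs_bump_le (l : Fin d → ℝ) (z : E d) : |bump l z| ≤ 1 := by
  unfold bump
  by_cases h : z ∈ omega l
  · rw [Set.indicator_of_mem h, Finset.abs_prod]
    exact Finset.prod_le_one (fun _ _ => abs_nonneg _) fun _ _ => Real.abs_sin_le_one _
  · simp [Set.indicator_of_notMem h]

theorem Domain.continuous_unscale (D : Domain d) (M : ℕ) (k : D.Cell M) :
    Continuous (D.unscale M k) := by
  cases D with
  | box L =>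
    change Continuous fun x : E d => (WithLp.toLp 2 fun n => (M : ℝ) * x n - (k n : ℕ) * L n : E d)
    fun_prop
  | triangle p =>
    change Continuous fun x : E d => (List.ofFn k).foldl (fun y i => triangleUnscale p i y) x
    generalize List.ofFn k = s
    induction s with
    | nil => exact continuous_id
    | cons i s ih =>
      simp only [List.foldl_cons]
      refine ih.comp ?_
      unfold triangleUnscale
      split_ifs <;> fun_prop

theorem memLp_actuator (D : Domain d) (l : Fin d → ℝ) (c : E d) (M : ℕ) (k : D.Cell M) :
    MemLp (fun x => (omega l).indicator (fun _ => (1 : ℝ)) (D.unscale M k x - c)) 2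
      (volume.restrict D.region) := by
  refine memLp_of_bounded D ?_ 1 fun x => ?_
  · exact (measurable_const.indicator (measurableSet_omega l)).comp
      ((D.continuous_unscale M k).measurable.sub_const c)
  · by_cases h : D.unscale M k x - c ∈ omega l <;> simp [h]

theorem memLp_bump_pow (D : Domain d) (l : Fin d → ℝ) (c : E d) (M : ℕ) (k : D.Cell M) (m : ℕ) :
    MemLp (fun x => bump l (D.unscale M k x - c) ^ m) 2 (volume.restrict D.region) := by
  refine memLp_of_bounded D ?_ 1 fun x => ?_
  · exact ((measurable_bump l).comp
      ((D.continuous_unscale M k).measurable.sub_const c)).pow_const m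
  · rw [abs_pow]
    exact pow_le_one₀ (abs_nonneg _) (abs_bump_le l _)

namespace ActuatorData

variable {D : Domain d}

/-- The actuators `Φ_j^M` on the order parameter; there are `(d + 1)` of them in each cell. -/
noncomputable def Phi (a : ActuatorData D) (M : ℕ) (j : D.Cell M × Fin (d + 1)) : H D :=
  (memLp_actuator D a.l (a.c₁ j.2) M j.1).toLp _

/-- The actuators `Ψ_j^M` on the temperature; there is one of them in each cell. -/
noncomputable def Psi (a : ActuatorData D) (M : ℕ) (j : D.Cell M) : H D :=
  (memLp_actuator D a.l a.c₂ M j).toLp _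

/-- The auxiliary functions associated with the actuators `Φ_j^M` (rescaled copies of `φ²`). -/
noncomputable def PhiAux (a : ActuatorData D) (M : ℕ) (j : D.Cell M × Fin (d + 1)) : H D :=
  (memLp_bump_pow D a.l (a.c₁ j.2) M j.1 2).toLp _

/-- The auxiliary functions associated with the actuators `Ψ_j^M` (rescaled copies of `φ`). -/
noncomputable def PsiAux (a : ActuatorData D) (M : ℕ) (j : D.Cell M) : H D :=
  (memLp_bump_pow D a.l a.c₂ M j 1).toLp _

end ActuatorData

/-! ### The feedback -/

section Feedback

variable {D : Domain d} {X : Type*} [NormedAddCommGroup X] [NormedSpace ℝ X]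

/-- The oblique projection `P_F^G w`: the element `p` of `F` with `w - p ∈ G`. It is seen as an
element of a space `X` with an inclusion `e` in `H` whose range contains `F`. -/
noncomputable def obliqueProj (e : X →L[ℝ] H D) (F G : Submodule ℝ (H D)) (w : H D) : X :=
  Classical.epsilon fun p : X => e p ∈ F ∧ w - e p ∈ G

/-- The extension to the dual `X'` of the oblique projection `P_F^{G⊥}`, where `G ⊆ X ⊆ H`: the
element `u` of `F` such that `ξ - u` vanishes on `G`. -/
noncomputable def obliqueProjDual (e : X →L[ℝ] H D) (F G : Submodule ℝ (H D))
    (ξ : StrongDual ℝ X) : H D :=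
  Classical.epsilon fun u : H D => u ∈ F ∧ ∀ w : X, e w ∈ G → inner ℝ u (e w) = ξ w

variable {ι : Type*} [Fintype ι]

/-- The operator `u ↦ ∑ j, u j • Φ j` associated with a family of actuators. -/
noncomputable def actuate (Φ : ι → H D) : (ι → ℝ) →ₗ[ℝ] H D := Fintype.linearCombination ℝ Φ

/-- The feedback input `-λ (U^⋄)⁻¹ P_U^{Ũ⊥} B P_Ũ^{U⊥} w`, with `U` the span of the actuators `Φ`,
`Ũ` the span of the auxiliary functions `Φ'`, `U^⋄` the operator `actuate Φ`, and `B : X → X'`. -/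
noncomputable def feedbackInput (e : X →L[ℝ] H D) (B : X → StrongDual ℝ X) (Φ Φ' : ι → H D)
    (lam : ℝ) (w : H D) : ι → ℝ :=
  (-lam) • Function.invFun (actuate Φ)
    (obliqueProjDual e (Submodule.span ℝ (Set.range Φ)) (Submodule.span ℝ (Set.range Φ'))
      (B (obliqueProj e (Submodule.span ℝ (Set.range Φ')) (Submodule.span ℝ (Set.range Φ))ᗮ w)))

/-- The feedback operator `K₁`, as a function of `y₁`. -/
noncomputable def K₁ (bc : BoundaryCondition) (a : ActuatorData D) (M : ℕ) (lam₁ : ℝ) (y₁ : H D) :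
    D.Cell M × Fin (d + 1) → ℝ :=
  feedbackInput (DA.toH D bc) (DA.Asq D bc) (a.Phi M) (a.PhiAux M) lam₁ y₁

/-- The feedback operator `K₂`, as a function of `y₂ + ν₀ y₁`. -/
noncomputable def K₂ (bc : BoundaryCondition) (a : ActuatorData D) (M : ℕ) (lam₂ : ℝ) (w : H D) :
    D.Cell M → ℝ :=
  feedbackInput (V.toH D bc) (V.A D bc) (a.Psi M) (a.PsiAux M) lam₂ w

end Feedback

/-! ### Solutions of the Cahn-Hilliard system -/

/-- `F` belongs to `L²((0, T), X)` for all `T > 0`. -/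
def L2Loc {X : Type*} [NormedAddCommGroup X] (F : ℝ → X) : Prop :=
  ∀ T > 0, MemLp F 2 (volume.restrict (Ioc 0 T))

/-- `ξ` is the derivative of `y : [0, ∞) → H` in the dual of a space `X` with inclusion `e` in
`H`. -/
def IsTimeDeriv {D : Domain d} {X : Type*} [NormedAddCommGroup X] [NormedSpace ℝ X]
    (e : X →L[ℝ] H D) (y : ℝ → H D) (ξ : ℝ → StrongDual ℝ X) : Prop :=
  ∀ φ : X, ∀ s t, 0 ≤ s → s ≤ t →
    inner ℝ (y t) (e φ) - inner ℝ (y s) (e φ) = ∫ τ in s..t, ξ τ φ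

/-- `(y₁, y₂)` is a weak solution, on the time interval `[0, ∞)`, of
`∂ₜ y₁ + ν₂ Δ² y₁ - Δ (f(y₁) - ν₁ y₂) + g(y₁) = h₁ + q₁`,
`∂ₜ (y₂ + ν₀ y₁) - Δ y₂ = h₂ + q₂`,
with the boundary conditions `bc`: `y` is continuous with values in `H × H`,
`y ∈ L²_loc(D(A) × V)`, `∂ₜ y₁ ∈ L²_loc(D(A)')`, `∂ₜ (y₂ + ν₀ y₁) ∈ L²_loc(V')`, and the equations
hold in `D(A)'` and in `V'`, for almost all `t > 0`. The constant `f(0)` is subtracted from `f(y₁)`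
in the duality pairing `⟨A₀ f(y₁), φ⟩ = (f(y₁) - f(0), A₀ φ)`, because `-Δ` annihilates constants;
this makes a difference only under Dirichlet boundary conditions with `f(0) ≠ 0`, where the pairing
`(1, A₀ φ)` is a boundary term. -/
structure IsSolution (D : Domain d) (bc : BoundaryCondition) (ν₀ ν₁ ν₂ : ℝ) (f g : ℝ → ℝ)
    (h₁ : ℝ → StrongDual ℝ (DA D bc)) (h₂ : ℝ → StrongDual ℝ (V D bc)) (q₁ q₂ : ℝ → H D)
    (y₁ y₂ : ℝ → H D) : Prop where
  continuousOn₁ : ContinuousOn y₁ (Ici 0)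
  continuousOn₂ : ContinuousOn y₂ (Ici 0)
  exists_weak : ∃ (Y₁ : ℝ → DA D bc) (Y₂ : ℝ → V D bc)
    (ξ₁ : ℝ → StrongDual ℝ (DA D bc)) (ξ₂ : ℝ → StrongDual ℝ (V D bc)),
    L2Loc Y₁ ∧ L2Loc Y₂ ∧ L2Loc ξ₁ ∧ L2Loc ξ₂ ∧
    IsTimeDeriv (DA.toH D bc) y₁ ξ₁ ∧
    IsTimeDeriv (V.toH D bc) (fun t => y₂ t + ν₀ • y₁ t) ξ₂ ∧
    ∀ᵐ t ∂volume.restrict (Ioi (0 : ℝ)),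
      DA.toH D bc (Y₁ t) = y₁ t ∧ V.toH D bc (Y₂ t) = y₂ t ∧
      MemLp (fun x => f (y₁ t x)) 2 (volume.restrict D.region) ∧
      MemLp (fun x => g (y₁ t x)) 2 (volume.restrict D.region) ∧
      (∀ φ : DA D bc,
        ξ₁ t φ + ν₂ * inner ℝ (DA.A₀ D bc (Y₁ t)) (DA.A₀ D bc φ)
          + (∫ x in D.region, (f (y₁ t x) - f 0) * DA.A₀ D bc φ x)
          - ν₁ * inner ℝ (y₂ t) (DA.A₀ D bc φ)
          + (∫ x in D.region, g (y₁ t x) * DA.toH D bc φ x)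
        = h₁ t φ + inner ℝ (q₁ t) (DA.toH D bc φ)) ∧
      (∀ ψ : V D bc,
        ξ₂ t ψ + inner ℝ (V.grad D bc (Y₂ t)) (V.grad D bc ψ)
        = h₂ t ψ + inner ℝ (q₂ t) (V.toH D bc ψ))

/-- The trajectory `(y₁, y₂)` of the uncontrolled system. -/
def IsTrajectory (D : Domain d) (bc : BoundaryCondition) (ν₀ ν₁ ν₂ : ℝ) (f g : ℝ → ℝ)
    (h₁ : ℝ → StrongDual ℝ (DA D bc)) (h₂ : ℝ → StrongDual ℝ (V D bc))
    (y₁ y₂ : ℝ → H D) : Prop :=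
  IsSolution D bc ν₀ ν₁ ν₂ f g h₁ h₂ (fun _ => 0) (fun _ => 0) y₁ y₂

/-- The trajectory `(c₁, c₂)` of the system controlled by the feedback input
`(K₁ (c₁ - r₁), K₂ ((c₂ - r₂) + ν₀ (c₁ - r₁)))`, where `(r₁, r₂)` is the targeted trajectory. -/
def IsControlledTrajectory (D : Domain d) (bc : BoundaryCondition) (a : ActuatorData D)
    (M : ℕ) (lam₁ lam₂ : ℝ) (ν₀ ν₁ ν₂ : ℝ) (f g : ℝ → ℝ)
    (h₁ : ℝ → StrongDual ℝ (DA D bc)) (h₂ : ℝ → StrongDual ℝ (V D bc))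
    (r₁ r₂ c₁ c₂ : ℝ → H D) : Prop :=
  IsSolution D bc ν₀ ν₁ ν₂ f g h₁ h₂
    (fun t => actuate (a.Phi M) (K₁ bc a M lam₁ (c₁ t - r₁ t)))
    (fun t => actuate (a.Psi M) (K₂ bc a M lam₂ ((c₂ t - r₂ t) + ν₀ • (c₁ t - r₁ t))))
    c₁ c₂

/-- The growth assumption on `N_f(t, z) = f(r₁(t) + z) - f(r₁(t))` along the target: for almost all
`t > 0` and all `z ∈ D(A)`,
`-⟨A₀ N_f(t, z), z⟩ ≤ C ∑ᵢ ‖z‖_H ^ (ζ i) * ‖z‖_{D(A)} ^ (η i)`.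
It is only asked for those `z` with `N_f(t, z) ∈ L²(Ω)`. -/
def GrowthF (D : Domain d) (bc : BoundaryCondition) (f : ℝ → ℝ) (r₁ : ℝ → H D) {n : ℕ}
    (C : ℝ) (ζ η : Fin n → ℝ) : Prop :=
  ∀ᵐ t ∂volume.restrict (Ioi (0 : ℝ)), ∀ z : DA D bc,
    MemLp (fun x => f (r₁ t x + DA.toH D bc z x) - f (r₁ t x)) 2 (volume.restrict D.region) →
    -(∫ x in D.region, (f (r₁ t x + DA.toH D bc z x) - f (r₁ t x)) * DA.A₀ D bc z x)
      ≤ C * ∑ i, ‖DA.toH D bc z‖ ^ ζ i * ‖DA.A D bc z‖ ^ η i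

/-- The growth assumption on `N_g(t, z) = g(r₁(t) + z) - g(r₁(t))` along the target: for almost all
`t > 0` and all `z ∈ D(A)`,
`-⟨N_g(t, z), z⟩ ≤ C ∑ᵢ ‖z‖_H ^ (ζ i) * ‖z‖_{D(A)} ^ (η i)`.
It is only asked for those `z` with `N_g(t, z) ∈ L²(Ω)`. -/
def GrowthG (D : Domain d) (bc : BoundaryCondition) (g : ℝ → ℝ) (r₁ : ℝ → H D) {n : ℕ}
    (C : ℝ) (ζ η : Fin n → ℝ) : Prop :=
  ∀ᵐ t ∂volume.restrict (Ioi (0 : ℝ)), ∀ z : DA D bc,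
    MemLp (fun x => g (r₁ t x + DA.toH D bc z x) - g (r₁ t x)) 2 (volume.restrict D.region) →
    -(∫ x in D.region, (g (r₁ t x + DA.toH D bc z x) - g (r₁ t x)) * DA.toH D bc z x)
      ≤ C * ∑ i, ‖DA.toH D bc z‖ ^ ζ i * ‖DA.A D bc z‖ ^ η i

/-- The norm of `H × H`. -/
noncomputable def normHH {D : Domain d} (u v : H D) : ℝ := √(‖u‖ ^ 2 + ‖v‖ ^ 2)

end CahnHilliard

namespace CahnHilliard
open Filter Topology

/-! ### Energy inequality for weak time derivatives -/

section TimeDerivative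

variable {X : Type*} [NormedAddCommGroup X] [NormedSpace ℝ X]

/-! The proof is an energy argument for the difference of the two trajectories. Write `z` for the
difference of the first components and `w` for the difference of the second ones plus `ν₀ z`. The
quantity `w` is what the second equation differentiates in time, so the energy is `E = ‖z‖² + ‖w‖²`.
Testing the two equations with `z` and `w` cancels the forcing and the constant `f 0`. What remains
is the dissipation `ν₂‖A₀z‖² + ‖∇w‖²`, the increments of `f` and `g`, the coupling terms in `(∇z,
∇w)` and `‖∇z‖²`, and the feedback (`weak_energy₁`, `weak_energy₂`).

Feedback. The supports of the actuators are disjoint and each auxiliary function is positive exactly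
on the support of its actuator, so the two families are biorthogonal up to positive factors and the
oblique projections exist. If `p` is the projection of the state, the feedback contributes exactly
`-λ₁‖Ap‖²`, respectively `-λ₂‖p‖_V²` (`exists_inner_feedbackInput`). The remainder `state - p` has
zero mean on a small box in every cell. A Poincaré inequality with constant of order `M⁻²`
(`exists_poincare`) makes it negligible against the dissipation for large `M`. Any prescribed
multiple of `‖z‖²` or `‖w‖²` is thus bounded by a small part of the dissipation plus a multiple of
the projected norm, and that multiple does not depend on `M` (`exists_coercive₁`,
`exists_coercive₂`). Hence `M` and the gains can be chosen separately.

Nonlinearity. Since `η < 2`, Young's inequality bounds the growth terms by `ε‖Az‖² + K‖z‖²`, where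
`K` depends on an a priori bound for `‖z‖` because `ζ + η` may exceed 2 (`exists_growth_le`). The
coupling is absorbed by half of `‖∇w‖²` and by the interpolation `‖∇z‖² ≤ ‖Az‖‖z‖`. This gives `E' ≤
-2μE` while `E ≤ R² + 1` (`energy_deriv_le`). As `E` starts below `R²` and decreases under this
condition, it never reaches the threshold (`exponential_decay`). Only the first equation sees `K`,
so the bound on `λ₂` depends on `μ` alone.

Passing between `E` and the norm of the difference costs a factor `2(1 + ν₀²)` each way, whence the
constant of the theorem. -/

theorem measurePreserving_add_right_real (r : ℝ) :
    MeasurePreserving (⟨fun τ : ℝ => τ + r, by fun_prop⟩ : C(ℝ, ℝ)) volume volume :=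
  measurePreserving_add_right volume r

theorem continuous_shift_real :
    Continuous fun r : ℝ => (⟨fun τ : ℝ => τ + r, by fun_prop⟩ : C(ℝ, ℝ)) :=
  ContinuousMap.continuous_of_continuous_uncurry _ (by
    change Continuous fun p : ℝ × ℝ => p.2 + p.1
    fun_prop)

/-- The integrated duality product of two square integrable functions depends continuously on
translations of the two functions. -/
theorem continuous_setIntegral_shift {f : ℝ → StrongDual ℝ X} {g : ℝ → X}
    (hf : MemLp f 2 volume) (hg : MemLp g 2 volume) (S : Set ℝ) :
    Continuous fun p : ℝ × ℝ => ∫ τ in S, f (τ + p.1) (g (τ + p.2)) := by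
  let B : StrongDual ℝ X →L[ℝ] X →L[ℝ] ℝ := ContinuousLinearMap.id ℝ (StrongDual ℝ X)
  let a : ℝ → Lp (StrongDual ℝ X) 2 (volume : Measure ℝ) := fun r =>
    Lp.compMeasurePreserving _ (measurePreserving_add_right_real r) (hf.toLp f)
  let b : ℝ → Lp X 2 (volume : Measure ℝ) := fun r =>
    Lp.compMeasurePreserving _ (measurePreserving_add_right_real r) (hg.toLp g)
  -- Translation is strongly continuous on `L²` of the line, and the Hölder pairing of two `L²`
  -- spaces into `L¹` is continuous.
  have ha : Continuous a :=
    continuous_const.compMeasurePreservingLp continuous_shift_real _ (by simp)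
  have hb : Continuous b :=
    continuous_const.compMeasurePreservingLp continuous_shift_real _ (by simp)
  have hc : Continuous fun p : ℝ × ℝ => B.holderL volume 2 2 1 (a p.1) (b p.2) :=
    ((B.holderL volume 2 2 1).continuous.comp (ha.comp continuous_fst)).clm_apply
      (hb.comp continuous_snd)
  refine ((continuous_setIntegral S).comp hc).congr fun p => ?_
  refine integral_congr_ae (ae_restrict_of_ae ?_)
  have h1 := Lp.coeFn_compMeasurePreserving (hf.toLp f) (measurePreserving_add_right_real p.1)
  have h2 := Lp.coeFn_compMeasurePreserving (hg.toLp g) (measurePreserving_add_right_real p.2)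
  have h3 := (measurePreserving_add_right_real p.1).quasiMeasurePreserving.ae_eq_comp hf.coeFn_toLp
  have h4 := (measurePreserving_add_right_real p.2).quasiMeasurePreserving.ae_eq_comp hg.coeFn_toLp
  filter_upwards [B.coeFn_holder (r := 1) (a p.1) (b p.2), h1, h2, h3, h4] with τ k0 k1 k2 k3 k4
  rw [ContinuousLinearMap.holderL_apply_apply, k0]
  have e1 : a p.1 τ = f (τ + p.1) := k1.trans k3
  have e2 : b p.2 τ = g (τ + p.2) := k2.trans k4
  rw [e1, e2]
  rfl

/-- Justifies exchanging the two time integrals in the energy inequality. The integrand is dominated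
by the sum of the squared norms, whose integral in `τ` does not depend on the shift, and `r` runs
over an interval of finite length. -/
theorem integrable_prod_shift {f : ℝ → StrongDual ℝ X} {g : ℝ → X}
    (hf : MemLp f 2 volume) (hg : MemLp g 2 volume) (h : ℝ) (S : Set ℝ) :
    Integrable (Function.uncurry fun τ r : ℝ => f (τ + r) (g (τ + h)))
      ((volume.restrict S).prod (volume.restrict (Ioc 0 h))) := by
  set ν : Measure ℝ := volume.restrict (Ioc 0 h)
  suffices H : Integrable (Function.uncurry fun τ r : ℝ => f (τ + r) (g (τ + h)))
      ((volume : Measure ℝ).prod ν) by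
    refine H.mono_measure ?_
    exact Measure.prod_mono Measure.restrict_le_self le_rfl
  have q1 : Measure.QuasiMeasurePreserving (fun q : ℝ × ℝ => q.1 + q.2)
      ((volume : Measure ℝ).prod ν) volume := by
    refine (quasiMeasurePreserving_add (volume : Measure ℝ) volume).mono_left ?_
    exact (Measure.prod_mono le_rfl Measure.restrict_le_self).absolutelyContinuous
  have q2 : Measure.QuasiMeasurePreserving (fun q : ℝ × ℝ => q.1 + h)
      ((volume : Measure ℝ).prod ν) volume :=
    (measurePreserving_add_right volume h).quasiMeasurePreserving.comp
      Measure.quasiMeasurePreserving_fst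
  have m1 : AEStronglyMeasurable (fun q : ℝ × ℝ => f (q.1 + q.2)) (volume.prod ν) :=
    hf.1.comp_quasiMeasurePreserving q1
  have m2 : AEStronglyMeasurable (fun q : ℝ × ℝ => g (q.1 + h)) (volume.prod ν) :=
    hg.1.comp_quasiMeasurePreserving q2
  have m : AEStronglyMeasurable (Function.uncurry fun τ r : ℝ => f (τ + r) (g (τ + h)))
      (volume.prod ν) :=
    (ContinuousLinearMap.id ℝ (StrongDual ℝ X)).aestronglyMeasurable_comp₂ m1 m2
  have i1 : Integrable (fun τ => ‖f τ‖ ^ 2) volume := hf.integrable_norm_pow (by simp)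
  have i2 : Integrable (fun τ => ‖g τ‖ ^ 2) volume := hg.integrable_norm_pow (by simp)
  have I1 : Integrable (fun q : ℝ × ℝ => ‖f (q.1 + q.2)‖ ^ 2) (volume.prod ν) := by
    refine (integrable_prod_iff' (m1.norm.pow 2)).2
      ⟨Eventually.of_forall fun r => i1.comp_add_right r, ?_⟩
    change Integrable (fun r => ∫ x, ‖‖f (x + r)‖ ^ 2‖) ν
    have : (fun r => ∫ x, ‖‖f (x + r)‖ ^ 2‖ ∂volume) = fun _ => ∫ x, ‖‖f x‖ ^ 2‖ := by
      funext r
      exact integral_add_right_eq_self (fun x => ‖‖f x‖ ^ 2‖) r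
    simp only [this]
    exact integrable_const _
  have I2 : Integrable (fun q : ℝ × ℝ => ‖g (q.1 + h)‖ ^ 2) (volume.prod ν) :=
    (i2.comp_add_right h).comp_fst ν
  refine (I1.add I2).mono' m (Eventually.of_forall fun q => ?_)
  refine (ContinuousLinearMap.le_opNorm _ _).trans ?_
  simp only [Pi.add_apply]
  nlinarith [sq_nonneg (‖f (q.1 + q.2)‖ - ‖g (q.1 + h)‖), sq_nonneg ‖f (q.1 + q.2)‖,
    sq_nonneg ‖g (q.1 + h)‖]

variable {d : ℕ} {D : Domain d}

theorem L2Loc.memLp_indicator {X : Type*} [NormedAddCommGroup X] {F : ℝ → X} (hF : L2Loc F) {T : ℝ} (hT : 0 < T) :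
    MemLp ((Ioc 0 T).indicator F) 2 volume :=
  (memLp_indicator_iff_restrict measurableSet_Ioc).2 (hF T hT)

/-- The energy inequality for a function `y` with values in `X ⊆ H` and with derivative `ξ` in
`X'`. -/
theorem norm_sq_sub_le_of_isTimeDeriv {e : X →L[ℝ] H D} {y : ℝ → H D} {Y : ℝ → X}
    {ξ : ℝ → StrongDual ℝ X} (hy : ContinuousOn y (Ici 0)) (hY : L2Loc Y) (hξ : L2Loc ξ)
    (hd : IsTimeDeriv e y ξ) (hYy : ∀ᵐ t ∂volume.restrict (Ioi (0 : ℝ)), e (Y t) = y t)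
    {s t : ℝ} (hs : 0 ≤ s) (hst : s ≤ t) :
    ‖y t‖ ^ 2 - ‖y s‖ ^ 2 ≤ 2 * ∫ τ in s..t, ξ τ (Y τ) := by
  -- The margin 1 leaves room for time shifts `h < 1`.
  set T := t + 1 with hTdef
  have hT : 0 < T := by linarith
  set f := (Ioc 0 T).indicator ξ with hfdef
  set g := (Ioc 0 T).indicator Y with hgdef
  have hf : MemLp f 2 volume := hξ.memLp_indicator hT
  have hg : MemLp g 2 volume := hY.memLp_indicator hT
  have hF := continuous_setIntegral_shift hf hg (Ioc s t)
  set F : ℝ × ℝ → ℝ := fun p => ∫ τ in Ioc s t, f (τ + p.1) (g (τ + p.2)) with hFdef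
  have hF0 : F (0, 0) = ∫ τ in s..t, ξ τ (Y τ) := by
    rw [intervalIntegral.integral_of_le hst]
    refine setIntegral_congr_fun measurableSet_Ioc fun τ hτ => ?_
    have : τ ∈ Ioc 0 T := ⟨by linarith [hτ.1], by linarith [hτ.2]⟩
    simp [hfdef, hgdef, this]
  -- Freezing `y` at its initial value for negative times makes the energy continuous on the whole
  -- line.
  set E : ℝ → ℝ := fun τ => ‖y (max τ 0)‖ ^ 2 with hEdef
  have hE : Continuous E := by
    have : Continuous fun τ : ℝ => y (max τ 0) :=
      hy.comp_continuous (by fun_prop) fun τ => mem_Ici.2 (le_max_right _ _)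
    exact this.norm.pow 2
  have hEeq : ∀ τ, 0 ≤ τ → E τ = ‖y τ‖ ^ 2 := fun τ hτ => by simp [hEdef, max_eq_left hτ]
  rw [← hF0, ← hEeq t (hs.trans hst), ← hEeq s hs]
  refine le_of_forall_pos_le_add fun ε hε => ?_
  -- for small `h`
  obtain ⟨δ₁, hδ₁, h₁⟩ := Metric.continuousAt_iff.1 (hF.continuousAt (x := ((0 : ℝ), (0 : ℝ))))
    (ε / 8) (by linarith)
  obtain ⟨δ₂, hδ₂, h₂⟩ := Metric.continuousAt_iff.1 (hE.continuousAt (x := t)) (ε / 8) (by linarith)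
  obtain ⟨δ₃, hδ₃, h₃⟩ := Metric.continuousAt_iff.1 (hE.continuousAt (x := s)) (ε / 8) (by linarith)
  obtain ⟨h, hh0, hh⟩ := exists_between (show (0 : ℝ) < min (min 1 δ₁) (min δ₂ δ₃) by
    simp [hδ₁, hδ₂, hδ₃])
  simp only [lt_min_iff] at hh
  obtain ⟨⟨hh1, hhδ₁⟩, hhδ₂, hhδ₃⟩ := hh
  have hEi : ∀ a b, IntervalIntegrable E volume a b := fun a b => hE.intervalIntegrable a b
  -- Uses `‖a‖² - ‖b‖² ≤ 2(a - b, a)` with `a = y(τ + h)`. For almost every `τ` this `a` comes from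
  -- the fixed element `Y(τ + h)` of `X`, so the definition of the weak derivative applies to it.
  have key : ∫ τ in Ioc s t, (E (τ + h) - E τ) ≤ 2 * ∫ r in Ioc 0 h, F (r, h) := by
    have hint := integrable_prod_shift hf hg h (Ioc s t)
    rw [hFdef, ← integral_integral_swap hint, ← integral_const_mul]
    have hae : ∀ᵐ τ ∂volume.restrict (Ioc s t), E (τ + h) - E τ
        ≤ 2 * ∫ r in Ioc 0 h, f (τ + r) (g (τ + h)) := by
      have h5 : ∀ᵐ τ : ℝ, τ ∈ Ioi (0 : ℝ) → e (Y τ) = y τ :=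
        (ae_restrict_iff' measurableSet_Ioi).1 hYy
      have h6 := (measurePreserving_add_right (volume : Measure ℝ) h).quasiMeasurePreserving.ae h5
      filter_upwards [ae_restrict_of_ae h6, ae_restrict_mem measurableSet_Ioc] with τ hτ hτ'
      have hτ0 : 0 < τ := by linarith [hτ'.1]
      have hm : τ + h ∈ Ioc 0 T := ⟨by linarith, by linarith [hτ'.2]⟩
      have e1 := hτ hm.1
      have e2 := hd (Y (τ + h)) τ (τ + h) hτ0.le (by linarith)
      rw [e1] at e2
      have e3 : ∫ σ in τ..τ + h, ξ σ (Y (τ + h)) = ∫ r in Ioc 0 h, f (τ + r) (g (τ + h)) := by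
        rw [← intervalIntegral.integral_of_le hh0.le]
        have := intervalIntegral.integral_comp_add_left (a := 0) (b := h)
          (fun σ => ξ σ (Y (τ + h))) τ
        rw [add_zero] at this
        rw [← this]
        refine intervalIntegral.integral_congr fun r hr => ?_
        rw [uIcc_of_le hh0.le] at hr
        have hr' : τ + r ∈ Ioc 0 T := ⟨by linarith [hr.1], by linarith [hτ'.2, hr.2]⟩
        simp [hfdef, hgdef, hr', hm]
      rw [← e3, ← e2, hEeq _ hτ0.le, hEeq _ hm.1.le, ← real_inner_self_eq_norm_sq,
        ← real_inner_self_eq_norm_sq]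
      have h7 := real_inner_self_nonneg (x := y (τ + h) - y τ)
      rw [inner_sub_left, inner_sub_right, inner_sub_right,
        real_inner_comm (y (τ + h)) (y τ)] at h7
      rw [real_inner_comm (y (τ + h)) (y τ)] at *
      linarith
    refine integral_mono_ae ?_ (hint.integral_prod_left.const_mul 2) hae
    exact ((hE.comp (continuous_add_const h)).sub hE).integrableOn_Ioc
  have hR : ∫ r in Ioc 0 h, F (r, h) ≤ h * (F (0, 0) + ε / 8) := by
    have : ∫ r in Ioc 0 h, F (r, h) ≤ ∫ r in Ioc 0 h, (F (0, 0) + ε / 8) := by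
      refine setIntegral_mono_on (hF.comp (by fun_prop : Continuous fun r : ℝ => (r, h))
        |>.integrableOn_Ioc) (integrable_const _) measurableSet_Ioc fun r hr => ?_
      have : dist (r, h) ((0 : ℝ), (0 : ℝ)) < δ₁ := by
        rw [Prod.dist_eq, max_lt_iff, Real.dist_0_eq_abs, Real.dist_0_eq_abs, abs_of_pos hr.1,
          abs_of_pos hh0]
        exact ⟨hr.2.trans_lt hhδ₁, hhδ₁⟩
      have := h₁ this
      rw [Real.dist_eq] at this
      linarith [(abs_lt.1 this).2]
    simpa [hh0.le] using this
  -- The integral telescopes to the integral of `E` over `[t, t + h]` minus that over `[s, s + h]`.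
  have hL : h * (E t - E s - ε / 4) ≤ ∫ τ in Ioc s t, (E (τ + h) - E τ) := by
    have hEh : IntervalIntegrable (fun x => E (x + h)) volume s t :=
      (hE.comp (continuous_add_const h)).intervalIntegrable _ _
    rw [← intervalIntegral.integral_of_le hst, intervalIntegral.integral_sub hEh (hEi _ _),
      intervalIntegral.integral_comp_add_right E h]
    have i1 := intervalIntegral.integral_add_adjacent_intervals (hEi s (s + h)) (hEi (s + h) (t + h))
    have i2 := intervalIntegral.integral_add_adjacent_intervals (hEi s t) (hEi t (t + h))
    have j1 : h * (E t - ε / 8) ≤ ∫ τ in t..t + h, E τ := by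
      have := intervalIntegral.integral_mono_on (a := t) (b := t + h) (by linarith)
        (intervalIntegrable_const (c := E t - ε / 8)) (hEi _ _) fun x hx => by
          have : dist x t < δ₂ := by
            rw [Real.dist_eq, abs_of_nonneg (by linarith [hx.1])]; linarith [hx.2]
          have := h₂ this
          rw [Real.dist_eq] at this
          linarith [(abs_lt.1 this).1]
      rw [intervalIntegral.integral_const, smul_eq_mul, add_sub_cancel_left] at this
      exact this
    have j2 : ∫ τ in s..s + h, E τ ≤ h * (E s + ε / 8) := by
      have := intervalIntegral.integral_mono_on (a := s) (b := s + h) (by linarith) (hEi _ _)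
        (intervalIntegrable_const (c := E s + ε / 8)) fun x hx => by
          have : dist x s < δ₃ := by
            rw [Real.dist_eq, abs_of_nonneg (by linarith [hx.1])]; linarith [hx.2]
          have := h₃ this
          rw [Real.dist_eq] at this
          linarith [(abs_lt.1 this).2]
      rw [intervalIntegral.integral_const, smul_eq_mul, add_sub_cancel_left] at this
      exact this
    linarith
  have : h * (E t - E s - ε / 4) ≤ h * (2 * (F (0, 0) + ε / 8)) := by linarith
  have := le_of_mul_le_mul_left this hh0
  linarith

end TimeDerivative

/-! ### Decay below a threshold -/

section Decay

/-- A nonnegative quantity that decays exponentially as long as it is below a threshold, and is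
initially below the threshold, decays exponentially. -/
theorem exponential_decay {E b : ℝ → ℝ} {μ r ρ : ℝ} (hμ : 0 ≤ μ) (hE : ContinuousOn E (Ici 0))
    (hE0 : ∀ t, 0 ≤ t → 0 ≤ E t) (hr : E 0 ≤ r) (hrρ : r < ρ)
    (hb : ∀ T > 0, IntegrableOn b (Ioc 0 T))
    (hEb : ∀ s t, 0 ≤ s → s ≤ t → E t - E s ≤ ∫ τ in s..t, b τ)
    (hbE : ∀ᵐ τ ∂volume.restrict (Ioi (0 : ℝ)), E τ ≤ ρ → b τ ≤ -μ * E τ)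
    {s t : ℝ} (hs : 0 ≤ s) (hst : s ≤ t) :
    E t ≤ Real.exp (-μ * (t - s)) * E s := by
  have hbi : ∀ s t, 0 ≤ s → s ≤ t → IntervalIntegrable b volume s t := fun s t h0 h => by
    rw [intervalIntegrable_iff_integrableOn_Ioc_of_le h]
    exact (hb (t + 1) (by linarith)).mono_set (Ioc_subset_Ioc h0 (by linarith))
  have hEi : ∀ s t, 0 ≤ s → s ≤ t → IntervalIntegrable E volume s t := fun s t h0 h =>
    (hE.mono fun x hx => h0.trans hx.1).intervalIntegrable_of_Icc h
  have step : ∀ s t, 0 ≤ s → s ≤ t → (∀ τ ∈ Icc s t, E τ ≤ ρ) →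
      E t - E s ≤ -μ * ∫ τ in s..t, E τ := fun s t h0 h hρ => by
    refine (hEb s t h0 h).trans ?_
    rw [← intervalIntegral.integral_const_mul]
    refine intervalIntegral.integral_mono_ae_restrict h (hbi s t h0 h)
      ((hEi s t h0 h).const_mul _) ?_
    have h1 : ∀ᵐ τ : ℝ, τ ∈ Ioi (0 : ℝ) → E τ ≤ ρ → b τ ≤ -μ * E τ :=
      (ae_restrict_iff' measurableSet_Ioi).1 hbE
    -- The bound on `b` is available at positive times only, so the left endpoint, possibly 0, is
    -- discarded.
    have h2 : ∀ᵐ τ : ℝ, τ ≠ s := by simp [ae_iff]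
    filter_upwards [ae_restrict_of_ae h1, ae_restrict_of_ae h2,
      ae_restrict_mem measurableSet_Icc] with τ k1 k2 k3
    exact k1 (lt_of_le_of_lt h0 (lt_of_le_of_ne k3.1 k2.symm)) (hρ τ k3)
  have hle : ∀ t, 0 ≤ t → E t ≤ ρ := by
    by_contra! hcon
    obtain ⟨t₀, ht₀, hρ⟩ := hcon
    -- Its infimum is the first time at which the threshold is reached. Up to that time `E` does not
    -- increase, so there `E ≤ r < ρ`, a contradiction.
    set S := {τ ∈ Icc 0 t₀ | ρ ≤ E τ} with hS
    have hSc : IsClosed S := by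
      have := (hE.mono (fun x hx => hx.1 : Icc 0 t₀ ⊆ Ici 0)).preimage_isClosed_of_isClosed
        isClosed_Icc (isClosed_Ici (a := ρ))
      exact this
    have hSne : S.Nonempty := ⟨t₀, ⟨ht₀, le_rfl⟩, hρ.le⟩
    have hSb : BddBelow S := ⟨0, fun x hx => hx.1.1⟩
    have hm := hSc.csInf_mem hSne hSb
    set t₁ := sInf S
    have hlt : ∀ τ, 0 ≤ τ → τ < t₁ → E τ < ρ := fun τ h0 h => by
      by_contra! hc
      exact absurd (csInf_le hSb (show τ ∈ S from ⟨⟨h0, h.le.trans hm.1.2⟩, hc⟩)) (not_le.2 h)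
    have ht₁ : 0 < t₁ := by
      rcases hm.1.1.lt_or_eq with h | h
      · exact h
      · rw [← h] at hm
        linarith [hm.2]
    have heq : E t₁ ≤ ρ := by
      have hcl : t₁ ∈ closure (Ico 0 t₁) := by
        rw [closure_Ico ht₁.ne]; exact ⟨ht₁.le, le_rfl⟩
      exact ContinuousWithinAt.closure_le hcl
        ((hE t₁ ht₁.le).mono fun x hx => hx.1) continuousWithinAt_const
        fun τ hτ => (hlt τ hτ.1 hτ.2).le
    have := step 0 t₁ le_rfl ht₁.le fun τ hτ => by
      rcases hτ.2.lt_or_eq with h | h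
      · exact (hlt τ hτ.1 h).le
      · rw [h]; exact heq
    have hnn : 0 ≤ ∫ τ in (0 : ℝ)..t₁, E τ :=
      intervalIntegral.integral_nonneg ht₁.le fun u hu => hE0 u hu.1
    nlinarith [hm.2]
  -- `E` need not be differentiable; the integrated inequality bounds its right difference
  -- quotients, which is what this form of Grönwall's lemma requires.
  have := le_gronwallBound_of_liminf_deriv_right_le (f := E) (f' := fun x => -μ * E x)
    (δ := E s) (K := -μ) (ε := 0) (a := s) (b := t) (hE.mono fun x hx => hs.trans hx.1) ?_ le_rfl
    (fun x _ => by simp) t ⟨hst, le_rfl⟩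
  · rw [gronwallBound_ε0] at this
    linarith
  · intro x hx r hr
    have hx0 : 0 ≤ x := hs.trans hx.1
    refine Eventually.frequently ?_
    rcases hμ.lt_or_eq with hμ | hμ
    · have h1 : -r / μ < E x := by
        rw [div_lt_iff₀ hμ]; linarith
      obtain ⟨m, hm1, hm2⟩ := exists_between h1
      have hc : ∀ᶠ z in 𝓝[≥] x, m < E z :=
        ((hE x hx0).mono (Ici_subset_Ici.2 hx0)).eventually (lt_mem_nhds hm2)
      obtain ⟨u, hu, hsub⟩ := (mem_nhdsGE_iff_exists_Ico_subset).1 hc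
      filter_upwards [Ioo_mem_nhdsGT hu] with z hz
      have hst := step x z hx0 hz.1.le fun τ hτ => hle τ (hx0.trans hτ.1)
      have hI : (z - x) * m ≤ ∫ τ in x..z, E τ := by
        have := intervalIntegral.integral_mono_on (a := x) (b := z) hz.1.le
          (intervalIntegrable_const (c := m)) (hEi x z hx0 hz.1.le) fun τ hτ =>
            (hsub (show τ ∈ Ico x u from ⟨hτ.1, hτ.2.trans_lt hz.2⟩)).le
        simpa using this
      have hzx : 0 < z - x := sub_pos.2 hz.1
      rw [inv_mul_lt_iff₀ hzx]
      have : -r < m * μ := by rwa [div_lt_iff₀ hμ] at hm1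
      nlinarith
    · subst hμ
      filter_upwards [self_mem_nhdsWithin] with z hz
      have hst := step x z hx0 (le_of_lt hz) fun τ hτ => hle τ (hx0.trans hτ.1)
      have hzx : 0 < z - x := sub_pos.2 hz
      rw [inv_mul_lt_iff₀ hzx]
      nlinarith

end Decay

/-! ### The spaces V and D(A) -/

section Sobolev

variable {d : ℕ} {D : Domain d} {bc : BoundaryCondition}

theorem Domain.isOpen_region (D : Domain d) : IsOpen D.region := by
  cases D with
  | box L =>
    have : (Domain.box L).region = ⋂ n, {x : E d | 0 < x n ∧ x n < L n} := by
      ext x; simp [Domain.region]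
    rw [this]
    refine isOpen_iInter_of_finite fun n => ?_
    have hn : Continuous fun x : E d => x n := by fun_prop
    exact (isOpen_lt continuous_const hn).inter (isOpen_lt hn continuous_const)
  | triangle p => exact isOpen_interior

theorem inner_toLp_left {f : E d → ℝ} (hf : MemLp f 2 (volume.restrict D.region)) (u : H D) :
    inner ℝ (hf.toLp f) u = ∫ x in D.region, u x * f x := by
  rw [L2.inner_def]
  refine integral_congr_ae ?_
  filter_upwards [hf.coeFn_toLp] with x hx
  simp [hx]

theorem inner_HGrad (p q : HGrad D) :
    inner ℝ p q = inner ℝ p.fst q.fst + ∑ i, inner ℝ (p.snd i) (q.snd i) := by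
  rw [WithLp.prod_inner_apply]
  congr 1

/-- Each test function imposes a linear condition given by pairings with fixed `L²` functions.
Closedness yields both the inclusion of `W012` and the completeness of `V`. -/
theorem isClosed_W12 (D : Domain d) (bc : BoundaryCondition) :
    IsClosed (W12 D bc : Set (HGrad D)) := by
  have : (W12 D bc : Set (HGrad D)) = ⋂ φ, ⋂ h : IsTestFunction D bc φ, ⋂ i : Fin d,
      {p : HGrad D | inner ℝ ((memLp_of_continuous D (continuous_pderiv h.contDiff i)).toLp _) p.fst
        = - inner ℝ ((memLp_of_continuous D h.contDiff.continuous).toLp _) (p.snd i)} := by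
    ext p
    simp only [mem_iInter, mem_ofPred_eq, inner_toLp_left]
    rfl
  rw [this]
  refine isClosed_iInter fun φ => isClosed_iInter fun h => isClosed_iInter fun i => ?_
  refine isClosed_eq ?_ ?_
  · exact continuous_const.inner (WithLp.fstL 2 ℝ (H D) (PiLp 2 fun _ : Fin d => H D)).continuous
  · refine (continuous_const.inner ?_).neg
    exact (PiLp.proj 2 (fun _ : Fin d => H D) i : _ →L[ℝ] H D).continuous.comp
      (WithLp.sndL 2 ℝ (H D) (PiLp 2 fun _ : Fin d => H D)).continuous

theorem pderiv_eq_zero_of_notMem_tsupport {φ : E d → ℝ} {x : E d} (hx : x ∉ tsupport φ)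
    (i : Fin d) : pderiv φ i x = 0 := by
  have : fderiv ℝ φ x = 0 := by
    by_contra h
    exact hx (support_fderiv_subset ℝ h)
  simp [pderiv, this]

/-- Integration by parts with a smooth function compactly supported in `Ω`. -/
theorem integral_mul_pderiv {φ η : E d → ℝ} (hφ : ContDiff ℝ ∞ φ) (hc : HasCompactSupport φ)
    (hs : tsupport φ ⊆ D.region) (hη : ContDiff ℝ ∞ η) (i : Fin d) :
    ∫ x in D.region, φ x * pderiv η i x = - ∫ x in D.region, pderiv φ i x * η x := by
  have hφ' : Continuous (pderiv φ i) := continuous_pderiv hφ i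
  have hη' : Continuous (pderiv η i) := continuous_pderiv hη i
  have hc' : HasCompactSupport (pderiv φ i) :=
    hc.mono' (fun x hx => by
      by_contra h
      exact hx (pderiv_eq_zero_of_notMem_tsupport h i))
  rw [setIntegral_eq_integral_of_forall_compl_eq_zero fun x hx => by
      rw [image_eq_zero_of_notMem_tsupport fun h => hx (hs h), zero_mul],
    setIntegral_eq_integral_of_forall_compl_eq_zero fun x hx => by
      rw [pderiv_eq_zero_of_notMem_tsupport (fun h => hx (hs h)), zero_mul]]
  refine integral_mul_fderiv_eq_neg_fderiv_mul_of_integrable ?_ ?_ ?_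
    (fun x _ => (hφ.differentiable (by simp)) x) (fun x _ => (hη.differentiable (by simp)) x)
  · exact (hφ'.mul hη.continuous).integrable_of_hasCompactSupport hc'.mul_right
  · exact (hφ.continuous.mul hη').integrable_of_hasCompactSupport hc.mul_right
  · exact (hφ.continuous.mul hη.continuous).integrable_of_hasCompactSupport hc.mul_right

/-- The generators are compactly supported in the domain, so integrating by parts leaves no boundary
term against any smooth test function, whatever its behaviour at the boundary. -/
theorem W012_le_W12 (D : Domain d) (bc : BoundaryCondition) : W012 D ≤ W12 D bc := by
  refine Submodule.topologicalClosure_minimal _ (Submodule.span_le.2 ?_) (isClosed_W12 D bc)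
  rintro p ⟨φ, hφ, h0, h1⟩ η hη i
  have e1 : ∫ x in D.region, p.fst x * pderiv η i x = ∫ x in D.region, φ x * pderiv η i x := by
    refine integral_congr_ae ?_
    filter_upwards [h0] with x hx
    rw [hx]
  have e2 : ∫ x in D.region, p.snd i x * η x = ∫ x in D.region, pderiv φ i x * η x := by
    refine integral_congr_ae ?_
    filter_upwards [h1 i] with x hx
    rw [hx]
  change ∫ x in D.region, p.fst x * pderiv η i x = - ∫ x in D.region, p.snd i x * η x
  rw [e1, e2]
  exact integral_mul_pderiv hφ.1 hφ.2.1 hφ.2.2 hη.contDiff i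

theorem W012_le_VSub (D : Domain d) (bc : BoundaryCondition) : W012 D ≤ VSub D bc := by
  cases bc
  · exact le_rfl
  · exact W012_le_W12 D _
  · exact W012_le_W12 D _

/-- The lattice vector of the torus with index `k`. -/
noncomputable def latticeVector (L : Fin d → ℝ) (k : Fin d → ℤ) : E d :=
  WithLp.toLp 2 fun n => (k n : ℝ) * L n

/-- The sum of all the translates of a function by the vectors of the lattice. -/
noncomputable def periodization (L : Fin d → ℝ) (φ : E d → ℝ) (x : E d) : ℝ :=
  ∑ᶠ k : Fin d → ℤ, φ (x + latticeVector L k)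

theorem contDiff_periodization {L : Fin d → ℝ} (hL : ∀ n, 0 < L n) {φ : E d → ℝ}
    (hφ : ContDiff ℝ ∞ φ) (hs : tsupport φ ⊆ (Domain.box L).region) :
    ContDiff ℝ ∞ (periodization L φ) := by
  rw [← contMDiff_iff_contDiff]
  refine contMDiff_finsum (fun k => ?_) ?_
  · rw [contMDiff_iff_contDiff]
    exact hφ.comp (contDiff_id.add contDiff_const)
  -- Local finiteness: on a ball of radius 1, the support condition confines every coordinate of the
  -- lattice index to a bounded interval.
  · intro x
    refine ⟨Metric.ball x 1, Metric.ball_mem_nhds x one_pos, ?_⟩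
    have hfin : (Set.pi univ fun n : Fin d =>
        Icc ⌊(-x n - 1) / L n⌋ ⌈(L n - x n + 1) / L n⌉).Finite :=
      Set.Finite.pi fun n => finite_Icc _ _
    refine hfin.subset ?_
    rintro k ⟨z, hz, hzx⟩ n -
    have hreg := hs (subset_tsupport φ hz) n
    simp only [latticeVector, PiLp.add_apply] at hreg
    have hd : |z n - x n| < 1 := by
      have h1 : ‖(z - x) n‖ ≤ ‖z - x‖ := PiLp.norm_apply_le (z - x) n
      rw [Metric.mem_ball, dist_eq_norm] at hzx
      rw [PiLp.sub_apply, Real.norm_eq_abs] at h1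
      exact h1.trans_lt hzx
    rw [abs_lt] at hd
    constructor
    · refine Int.floor_le_iff.2 ?_
      have : (-x n - 1) / L n < k n := by
        rw [div_lt_iff₀ (hL n)]; linarith [hreg.1]
      linarith
    · refine Int.le_ceil_iff.2 ?_
      have : (k n : ℝ) < (L n - x n + 1) / L n := by
        rw [lt_div_iff₀ (hL n)]; linarith [hreg.2]
      linarith

theorem periodization_add_single (L : Fin d → ℝ) (φ : E d → ℝ) (n : Fin d) (x : E d) :
    periodization L φ (x + EuclideanSpace.single n (L n)) = periodization L φ x := by
  unfold periodization
  refine finsum_eq_of_bijective (fun k : Fin d → ℤ => k + Pi.single n 1)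
    (Equiv.addRight (Pi.single n 1 : Fin d → ℤ)).bijective fun k => ?_
  congr 1
  ext m
  simp only [latticeVector, PiLp.add_apply, Pi.add_apply]
  rcases eq_or_ne m n with rfl | h
  · simp; ring
  · simp [h]

theorem periodization_eq {L : Fin d → ℝ} {φ : E d → ℝ}
    (hs : tsupport φ ⊆ (Domain.box L).region) {x : E d} (hx : x ∈ (Domain.box L).region) :
    periodization L φ x = φ x := by
  unfold periodization
  rw [finsum_eq_single _ 0]
  · congr 1
    ext n
    simp [latticeVector]
  · intro k hk
    by_contra h
    obtain ⟨n, hn⟩ := Function.ne_iff.1 hk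
    have h1 := hs (subset_tsupport φ h) n
    have h2 := hx n
    simp only [latticeVector, PiLp.add_apply] at h1
    rcases lt_or_gt_of_ne hn with h3 | h3
    · have : (k n : ℝ) ≤ -1 := by exact_mod_cast Int.le_sub_one_of_lt h3
      nlinarith [h2.1.trans h2.2]
    · have : (1 : ℝ) ≤ k n := by exact_mod_cast h3
      nlinarith [h2.1.trans h2.2]

/-- A test function compactly supported in the cell coincides there with its periodization, which is
an admissible test function on the torus. -/
theorem W12_periodic_le {L : Fin d → ℝ} (hL : ∀ n, 0 < L n) :
    W12 (.box L) .periodic ≤ W12 (.box L) .neumann := by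
  intro p hp φ hφ i
  have hφ' : IsTestFunction (.box L) .dirichlet φ := hφ
  have hs := hφ'.2.2
  have ht : IsTestFunction (.box L) .periodic (periodization L φ) := by
    refine ⟨contDiff_periodization hL hφ'.1 hs, ?_⟩
    rintro v ⟨n, rfl⟩ x
    exact periodization_add_single L φ n x
  have e0 : ∀ x ∈ (Domain.box L).region, periodization L φ x = φ x :=
    fun x hx => periodization_eq hs hx
  have e1 : ∀ x ∈ (Domain.box L).region, pderiv (periodization L φ) i x = pderiv φ i x := by
    intro x hx
    have : periodization L φ =ᶠ[𝓝 x] φ := by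
      filter_upwards [(Domain.box L).isOpen_region.mem_nhds hx] with z hz using e0 z hz
    rw [pderiv, pderiv, this.fderiv_eq]
  have k1 : ∫ x in (Domain.box L).region, p.fst x * pderiv (periodization L φ) i x
      = ∫ x in (Domain.box L).region, p.fst x * pderiv φ i x :=
    setIntegral_congr_fun (Domain.box L).measurableSet_region fun x hx => by simp only [e1 x hx]
  have k2 : ∫ x in (Domain.box L).region, p.snd i x * periodization L φ x
      = ∫ x in (Domain.box L).region, p.snd i x * φ x :=
    setIntegral_congr_fun (Domain.box L).measurableSet_region fun x hx => by simp only [e0 x hx]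
  exact k1.symm.trans ((hp _ ht i).trans (congrArg _ k2))

/-- Lets the later arguments treat the three boundary conditions alike: weak gradients are only
tested with functions compactly supported inside the domain. -/
theorem VSub_le_W12_neumann (hD : D.Admissible bc) : VSub D bc ≤ W12 D .neumann := by
  cases bc
  · exact W012_le_W12 D _
  · exact le_rfl
  · cases D with
    | box L => exact W12_periodic_le hD.2
    | triangle p => exact absurd rfl hD.2.2

/-- The weak gradient of an element of `V` can be tested with the smooth functions compactly
supported in `Ω`. -/
theorem V.isWeakGradient (hD : D.Admissible bc) (v : V D bc) {φ : E d → ℝ}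
    (hφ : ContDiff ℝ ∞ φ) (hc : HasCompactSupport φ) (hs : tsupport φ ⊆ D.region) (i : Fin d) :
    ∫ x in D.region, V.toH D bc v x * pderiv φ i x
      = - ∫ x in D.region, V.grad D bc v i x * φ x :=
  VSub_le_W12_neumann hD v.2 φ ⟨hφ, hc, hs⟩ i

instance (D : Domain d) (bc : BoundaryCondition) : CompleteSpace (V D bc) := by
  have : IsClosed (VSub D bc : Set (HGrad D)) := by
    cases bc
    · exact Submodule.isClosed_topologicalClosure _
    · exact isClosed_W12 D _
    · exact isClosed_W12 D _
  exact this.completeSpace_coe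

theorem H.eq_zero_of_integral_eq_zero {u : H D}
    (h : ∀ φ : E d → ℝ, ContDiff ℝ ∞ φ → HasCompactSupport φ → tsupport φ ⊆ D.region →
      ∫ x in D.region, u x * φ x = 0) : u = 0 := by
  have hint : IntegrableOn (fun x => u x) D.region :=
    (Lp.memLp u).integrable (by norm_num)
  have := D.isOpen_region.ae_eq_zero_of_integral_contDiff_smul_eq_zero (μ := volume)
    hint.locallyIntegrableOn fun φ h1 h2 h3 => by
      rw [← setIntegral_eq_integral_of_forall_compl_eq_zero (s := D.region) fun x hx => by
        rw [image_eq_zero_of_notMem_tsupport fun h => hx (h3 h), zero_smul]]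
      rw [← h φ h1 h2 h3]
      exact integral_congr_ae (Eventually.of_forall fun x => by simp [mul_comm])
  refine (Lp.eq_zero_iff_ae_eq_zero).2 ?_
  exact (ae_restrict_iff' D.measurableSet_region).2 this

/-- Elements of `V` are pairs of a function and a gradient, so the claim is the uniqueness of weak
gradients. -/
theorem V.toH_injective (hD : D.Admissible bc) : Function.Injective (V.toH D bc) := by
  rw [injective_iff_map_eq_zero]
  intro v hv
  have hg : ∀ i, V.grad D bc v i = 0 := fun i => by
    refine H.eq_zero_of_integral_eq_zero fun φ h1 h2 h3 => ?_
    have := V.isWeakGradient hD v h1 h2 h3 i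
    rw [hv] at this
    have h0 : ∫ x in D.region, (0 : H D) x * pderiv φ i x = 0 := by
      refine integral_eq_zero_of_ae ?_
      filter_upwards [Lp.coeFn_zero ℝ 2 (volume.restrict D.region)] with x hx
      change (0 : H D) x * _ = 0
      rw [hx, Pi.zero_apply, zero_mul]
    rw [h0] at this
    linarith
  have hg' : V.grad D bc v = 0 := by
    ext1 i; exact hg i
  have := V.inner_eq D bc v v
  rw [hv, hg', inner_zero_left, inner_zero_left, add_zero] at this
  exact inner_self_eq_zero.1 this

/-- The element of `HGrad` with given components. -/
noncomputable def HGrad.mk (u : H D) (G : Fin d → H D) : HGrad D :=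
  WithLp.toLp 2 (u, WithLp.toLp 2 G)

/-- Density of `V` in `H`: already the test functions, which belong to `V` for every boundary
condition, separate the elements of `H`. -/
theorem eq_zero_of_inner_toH_eq_zero {u : H D}
    (h : ∀ v : V D bc, inner ℝ u (V.toH D bc v) = 0) : u = 0 := by
  refine H.eq_zero_of_integral_eq_zero fun φ h1 h2 h3 => ?_
  have hm := memLp_of_continuous D h1.continuous
  have hm' := fun i => memLp_of_continuous D (continuous_pderiv h1 i)
  have hp : HGrad.mk (hm.toLp φ) (fun i => (hm' i).toLp _) ∈ W012 D :=
    Submodule.le_topologicalClosure _ (Submodule.subset_span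
      ⟨φ, ⟨h1, h2, h3⟩, hm.coeFn_toLp, fun i => (hm' i).coeFn_toLp⟩)
  have := h ⟨_, W012_le_VSub D bc hp⟩
  rw [real_inner_comm] at this
  exact (inner_toLp_left hm u).symm.trans this

theorem DA.toH_injective (hD : D.Admissible bc) : Function.Injective (DA.toH D bc) := by
  rw [injective_iff_map_eq_zero]
  intro z hz
  obtain ⟨v, hv, hv'⟩ := z.2
  have hv0 : V.toH D bc v = V.toH D bc 0 := by rw [hv, map_zero]; exact hz
  have := V.toH_injective hD hv0
  subst this
  have hA : DA.A D bc z = 0 := eq_zero_of_inner_toH_eq_zero (bc := bc) fun w => by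
    rw [← inner_zero_left (𝕜 := ℝ) w]; exact (hv' w).symm
  rw [← norm_eq_zero, DA.norm_eq, hA, norm_zero]

/-- The inclusion of `D(A)` in `V`. -/
noncomputable def DA.toV (D : Domain d) (bc : BoundaryCondition) : DA D bc →L[ℝ] V D bc :=
  (ContinuousLinearMap.adjoint (V.toH D bc)).comp (DA.A D bc)

theorem DA.inner_toV (z : DA D bc) (w : V D bc) :
    inner ℝ (DA.toV D bc z) w = inner ℝ (DA.A D bc z) (V.toH D bc w) := by
  change inner ℝ (ContinuousLinearMap.adjoint (V.toH D bc) (DA.A D bc z)) w = _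
  rw [ContinuousLinearMap.adjoint_inner_left]

/-- The adjoint of the inclusion applied to `Az` represents the functional `w ↦ (Az, w)_H` on `V`.
By uniqueness in the Riesz theorem it is the element of `V` that the definition of `D(A)` provides.
-/
theorem DA.toH_toV (z : DA D bc) : V.toH D bc (DA.toV D bc z) = DA.toH D bc z := by
  obtain ⟨v, hv, hv'⟩ := z.2
  have : DA.toV D bc z = v := ext_inner_right ℝ fun w => by
    rw [DA.inner_toV]; exact (hv' w).symm
  rw [this]
  exact hv

theorem V.norm_sq_eq (v : V D bc) : ‖v‖ ^ 2 = ‖V.grad D bc v‖ ^ 2 + ‖V.toH D bc v‖ ^ 2 := by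
  rw [← real_inner_self_eq_norm_sq, V.inner_eq, real_inner_self_eq_norm_sq,
    real_inner_self_eq_norm_sq]

theorem V.norm_toH_le (v : V D bc) : ‖V.toH D bc v‖ ≤ ‖v‖ := by
  have := V.norm_sq_eq v
  exact le_of_sq_le_sq (by nlinarith [sq_nonneg ‖V.grad D bc v‖]) (norm_nonneg _)

/-- The interpolation between `H` and `D(A)` that absorbs the first-order terms; it is `(Az, z)_H =
‖z‖_V²` with Cauchy–Schwarz. -/
theorem DA.norm_toV_sq_le (z : DA D bc) :
    ‖DA.toV D bc z‖ ^ 2 ≤ ‖DA.A D bc z‖ * ‖DA.toH D bc z‖ := by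
  rw [← real_inner_self_eq_norm_sq, DA.inner_toV, DA.toH_toV]
  exact real_inner_le_norm _ _

theorem DA.norm_toV_le (z : DA D bc) : ‖DA.toV D bc z‖ ≤ ‖DA.A D bc z‖ := by
  have h1 := DA.norm_toV_sq_le z
  have h2 := V.norm_toH_le (DA.toV D bc z)
  rw [DA.toH_toV] at h2
  by_contra! h
  nlinarith [norm_nonneg (DA.toH D bc z), norm_nonneg (DA.A D bc z),
    norm_nonneg (DA.toV D bc z)]

theorem DA.norm_toH_le (z : DA D bc) : ‖DA.toH D bc z‖ ≤ ‖DA.A D bc z‖ := by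
  rw [← DA.toH_toV]
  exact (V.norm_toH_le _).trans (DA.norm_toV_le z)

end Sobolev

/-! ### A smooth truncation near zero -/

section Truncation

/-- A smooth function that vanishes for `y ≤ 1` and is the identity for `y ≥ 2`. -/
noncomputable def truncation (y : ℝ) : ℝ := y * Real.smoothTransition (y - 1)

theorem contDiff_truncation : ContDiff ℝ ∞ truncation :=
  contDiff_id.mul (Real.smoothTransition.contDiff.comp (contDiff_id.sub contDiff_const))

theorem truncation_of_le_one {y : ℝ} (h : y ≤ 1) : truncation y = 0 := by
  rw [truncation, Real.smoothTransition.zero_of_nonpos (by linarith), mul_zero]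

theorem truncation_of_two_le {y : ℝ} (h : 2 ≤ y) : truncation y = y := by
  rw [truncation, Real.smoothTransition.one_of_one_le (by linarith), mul_one]

theorem abs_truncation_le (y : ℝ) : |truncation y| ≤ |y| := by
  rw [truncation, abs_mul, abs_of_nonneg (Real.smoothTransition.nonneg _)]
  exact mul_le_of_le_one_right (abs_nonneg _) (Real.smoothTransition.le_one _)

theorem exists_deriv_truncation_le : ∃ C, ∀ y, |deriv truncation y| ≤ C := by
  have hc : Continuous (deriv truncation) := contDiff_truncation.continuous_deriv (by simp)
  obtain ⟨C, hC⟩ := isCompact_Icc.exists_bound_of_continuousOn (s := Icc (1 : ℝ) 2) hc.continuousOn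
  refine ⟨max C 1, fun y => ?_⟩
  rcases lt_or_ge y 1 with h | h
  · have : truncation =ᶠ[𝓝 y] fun _ => 0 := by
      filter_upwards [gt_mem_nhds h] with z hz using truncation_of_le_one hz.le
    rw [this.deriv_eq]
    simp
  rcases le_or_gt y 2 with h' | h'
  · exact (hC y ⟨h, h'⟩).trans (le_max_left _ _)
  · have : truncation =ᶠ[𝓝 y] fun z => z := by
      filter_upwards [lt_mem_nhds h'] with z hz using truncation_of_two_le hz.le
    rw [this.deriv_eq]
    simp

end Truncation

/-! ### The auxiliary functions belong to V and D(A) -/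

section Cutoff

variable {d : ℕ} {D : Domain d} {bc : BoundaryCondition}

theorem contDiff_pderiv {φ : E d → ℝ} (hφ : ContDiff ℝ ∞ φ) (i : Fin d) :
    ContDiff ℝ ∞ (pderiv φ i) :=
  (hφ.fderiv_right (m := ∞) (by simp)).clm_apply contDiff_const

theorem pderiv_mul {f g : E d → ℝ} (hf : ContDiff ℝ ∞ f) (hg : ContDiff ℝ ∞ g) (i : Fin d)
    (x : E d) : pderiv (fun x => f x * g x) i x = f x * pderiv g i x + g x * pderiv f i x := by
  unfold pderiv
  rw [fderiv_fun_mul (hf.differentiable (by simp) x) (hg.differentiable (by simp) x)]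
  simp

/-- A positive smooth weight on an open subset `B` of `Ω`, vanishing on the boundary of `B`. -/
structure IsBoundaryWeight (D : Domain d) (B : Set (E d)) (S : E d → ℝ) : Prop where
  isOpen : IsOpen B
  subset : B ⊆ D.region
  contDiff : ContDiff ℝ ∞ S
  pos : ∀ x ∈ B, 0 < S x
  eq_zero : ∀ x ∈ closure B, x ∉ B → S x = 0

/-- The functions `1_B S κ`, with a weight `S` that vanishes on the boundary of `B`, and their
gradients, are limits of smooth functions compactly supported in `Ω`. -/
theorem IsBoundaryWeight.exists_approx {B : Set (E d)} {S κ : E d → ℝ}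
    (hS : IsBoundaryWeight D B S) (hκ : ContDiff ℝ ∞ κ) :
    ∃ (ψ : ℕ → E d → ℝ) (C : ℝ), (∀ n, IsTestFunction D .dirichlet (ψ n)) ∧
      (∀ n x, |ψ n x| ≤ C) ∧ (∀ n x i, |pderiv (ψ n) i x| ≤ C) ∧
      (∀ x, Tendsto (fun n => ψ n x) atTop (𝓝 (B.indicator (fun x => S x * κ x) x))) ∧
      ∀ x i, Tendsto (fun n => pderiv (ψ n) i x) atTop
        (𝓝 (B.indicator (pderiv (fun x => S x * κ x) i) x)) := by
  have hBc : IsCompact (closure B) := (D.isBounded_region.subset hS.subset).isCompact_closure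
  have hbd : ∀ f : E d → ℝ, Continuous f → ∃ C, 0 ≤ C ∧ ∀ x ∈ B, |f x| ≤ C := fun f hf => by
    obtain ⟨C, hC⟩ := hBc.exists_bound_of_continuousOn hf.continuousOn
    exact ⟨max C 0, le_max_right _ _, fun x hx => (hC x (subset_closure hx)).trans (le_max_left _ _)⟩
  obtain ⟨C₀, hC₀⟩ := exists_deriv_truncation_le
  have hC₀0 : 0 ≤ C₀ := (abs_nonneg _).trans (hC₀ 0)
  obtain ⟨C₁, hC₁0, hC₁⟩ := hbd S hS.contDiff.continuous
  obtain ⟨C₂, hC₂0, hC₂⟩ := hbd κ hκ.continuous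
  choose C₃ hC₃0 hC₃ using fun i => hbd (pderiv S i) (continuous_pderiv hS.contDiff i)
  choose C₄ hC₄0 hC₄ using fun i => hbd (pderiv κ i) (continuous_pderiv hκ i)
  -- The rescaled truncation vanishes for small arguments and tends to the identity on positive
  -- ones, while its derivative keeps a bound independent of `n`. Hence `T n ∘ S` has gradients
  -- bounded uniformly on `B`.
  set T : ℕ → ℝ → ℝ := fun n y => truncation ((n + 1) * y) / (n + 1) with hT
  have hn0 : ∀ n : ℕ, (0 : ℝ) < n + 1 := fun n => by positivity
  have hTs : ∀ n, ContDiff ℝ ∞ (T n) := fun n =>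
    (contDiff_truncation.comp (contDiff_const.mul contDiff_id)).div_const _
  have hTabs : ∀ n y, |T n y| ≤ |y| := fun n y => by
    rw [hT]
    simp only [abs_div, abs_of_pos (hn0 n)]
    rw [div_le_iff₀ (hn0 n)]
    refine (abs_truncation_le _).trans (le_of_eq ?_)
    rw [abs_mul, abs_of_pos (hn0 n), mul_comm]
  have hTz : ∀ (n : ℕ) (y : ℝ), y < 1 / ((n : ℝ) + 1) → T n y = 0 := fun n y hy => by
    rw [hT]
    simp only
    rw [truncation_of_le_one, zero_div]
    rw [lt_div_iff₀ (hn0 n)] at hy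
    linarith
  have hTid : ∀ (n : ℕ) y, 2 < ((n : ℝ) + 1) * y → T n =ᶠ[𝓝 y] fun z => z := fun n y hy => by
    have : ∀ᶠ z in 𝓝 y, 2 < ((n : ℝ) + 1) * z :=
      (continuous_const.mul continuous_id).continuousAt.eventually (lt_mem_nhds hy)
    filter_upwards [this] with z hz
    rw [hT]
    simp only
    rw [truncation_of_two_le hz.le, mul_div_cancel_left₀ _ (hn0 n).ne']
  have hTd : ∀ n y, |deriv (T n) y| ≤ C₀ := fun n y => by
    have : HasDerivAt (T n) (deriv truncation ((n + 1) * y) * (((n : ℝ) + 1) * 1) / (n + 1)) y :=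
      (((contDiff_truncation.differentiable (by simp)) _).hasDerivAt.comp y
        ((hasDerivAt_id y).const_mul ((n : ℝ) + 1))).div_const _
    rw [this.deriv, mul_one, mul_div_assoc, div_self (hn0 n).ne', mul_one]
    exact hC₀ _
  set Ψ : ℕ → E d → ℝ := fun n x => T n (S x) * κ x with hΨ
  have hΨs : ∀ n, ContDiff ℝ ∞ (Ψ n) := fun n => ((hTs n).comp hS.contDiff).mul hκ
  set ψ : ℕ → E d → ℝ := fun n => B.indicator (Ψ n) with hψ
  -- As `S` vanishes on the boundary of `B`, this compact set lies inside `B`. It carries the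
  -- support of the `n`-th approximation, which is therefore smooth across the boundary.
  set K : ℕ → Set (E d) := fun n => closure B ∩ {x | 1 / ((n : ℝ) + 1) ≤ S x} with hK
  have hKc : ∀ n, IsCompact (K n) := fun n =>
    hBc.inter_right (isClosed_le continuous_const hS.contDiff.continuous)
  have hKB : ∀ n, K n ⊆ B := fun n x hx => by
    by_contra h
    have h0 := hS.eq_zero x hx.1 h
    have h1 : 1 / ((n : ℝ) + 1) ≤ S x := hx.2
    have : 0 < 1 / ((n : ℝ) + 1) := one_div_pos.2 (hn0 n)
    linarith
  have hψK : ∀ n x, x ∉ K n → ψ n x = 0 := fun n x hx => by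
    by_cases hB : x ∈ B
    · have : S x < 1 / ((n : ℝ) + 1) := by
        by_contra! h
        exact hx ⟨subset_closure hB, h⟩
      simp [hψ, hB, hΨ, hTz n _ this]
    · simp [hψ, hB]
  have hts : ∀ n, tsupport (ψ n) ⊆ K n := fun n =>
    closure_minimal (fun x hx => by
      by_contra h
      exact hx (hψK n x h)) (hKc n).isClosed
  have hψB : ∀ n, ∀ x ∈ B, ψ n =ᶠ[𝓝 x] Ψ n := fun n x hx => by
    filter_upwards [hS.isOpen.mem_nhds hx] with z hz
    simp [hψ, hz]
  have hψn : ∀ n, ∀ x ∉ B, ψ n =ᶠ[𝓝 x] fun _ => 0 := fun n x hx => by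
    filter_upwards [(hKc n).isClosed.isOpen_compl.mem_nhds fun h => hx (hKB n h)] with z hz
    exact hψK n z hz
  have hψd : ∀ n x i, pderiv (ψ n) i x
      = B.indicator (fun x => T n (S x) * pderiv κ i x + κ x * (deriv (T n) (S x) * pderiv S i x)) x
      := fun n x i => by
    by_cases hB : x ∈ B
    · have h1 : pderiv (ψ n) i x = pderiv (Ψ n) i x := by
        rw [pderiv, (hψB n x hB).fderiv_eq, pderiv]
      have h2 : pderiv (fun x => T n (S x)) i x = deriv (T n) (S x) * pderiv S i x := by
        have := ((hTs n).differentiable (by simp) (S x)).hasDerivAt.comp_hasFDerivAt x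
          (hS.contDiff.differentiable (by simp) x).hasFDerivAt
        rw [pderiv, show (fun x => T n (S x)) = T n ∘ S from rfl, this.fderiv]
        rfl
      have h3 := pderiv_mul (f := fun x => T n (S x)) ((hTs n).comp hS.contDiff) hκ i x
      rw [h2] at h3
      rw [h1, indicator_of_mem hB]
      exact h3
    · rw [pderiv, (hψn n x hB).fderiv_eq]
      simp [hB]
  refine ⟨ψ, C₁ * C₂ + ∑ i, (C₁ * C₄ i + C₂ * (C₀ * C₃ i)), fun n => ⟨?_, ?_, ?_⟩, ?_, ?_, ?_, ?_⟩
  · rw [contDiff_iff_contDiffAt]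
    intro x
    by_cases hB : x ∈ B
    · exact (hΨs n).contDiffAt.congr_of_eventuallyEq (hψB n x hB)
    · exact contDiffAt_const.congr_of_eventuallyEq (hψn n x hB)
  · exact (hKc n).of_isClosed_subset (isClosed_tsupport _) (hts n)
  · exact ((hts n).trans (hKB n)).trans hS.subset
  · intro n x
    have hnn : 0 ≤ ∑ i, (C₁ * C₄ i + C₂ * (C₀ * C₃ i)) :=
      Finset.sum_nonneg fun i _ => by have := hC₃0 i; have := hC₄0 i; positivity
    have hnn' : 0 ≤ C₁ * C₂ := by positivity
    by_cases hB : x ∈ B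
    · have : |Ψ n x| ≤ C₁ * C₂ := by
        rw [hΨ]
        simp only [abs_mul]
        exact mul_le_mul ((hTabs n _).trans (hC₁ x hB)) (hC₂ x hB) (abs_nonneg _) hC₁0
      simp only [hψ, indicator_of_mem hB]
      linarith
    · simp only [hψ, indicator_of_notMem hB, abs_zero]
      linarith
  · intro n x i
    rw [hψd]
    have hle : C₁ * C₄ i + C₂ * (C₀ * C₃ i) ≤ ∑ i, (C₁ * C₄ i + C₂ * (C₀ * C₃ i)) :=
      Finset.single_le_sum (f := fun i => C₁ * C₄ i + C₂ * (C₀ * C₃ i))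
        (fun i _ => by have := hC₃0 i; have := hC₄0 i; positivity) (Finset.mem_univ i)
    have hnn : 0 ≤ C₁ * C₄ i + C₂ * (C₀ * C₃ i) := by
      have := hC₃0 i; have := hC₄0 i; positivity
    have hnn' : 0 ≤ C₁ * C₂ := by positivity
    by_cases hB : x ∈ B
    · simp only [indicator_of_mem hB]
      have h1 : |T n (S x) * pderiv κ i x| ≤ C₁ * C₄ i := by
        rw [abs_mul]
        exact mul_le_mul ((hTabs n _).trans (hC₁ x hB)) (hC₄ i x hB) (abs_nonneg _) hC₁0
      have h2 : |κ x * (deriv (T n) (S x) * pderiv S i x)| ≤ C₂ * (C₀ * C₃ i) := by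
        rw [abs_mul, abs_mul]
        exact mul_le_mul (hC₂ x hB) (mul_le_mul (hTd n _) (hC₃ i x hB) (abs_nonneg _) hC₀0)
          (by positivity) hC₂0
      have := abs_add_le (T n (S x) * pderiv κ i x) (κ x * (deriv (T n) (S x) * pderiv S i x))
      linarith
    · simp only [indicator_of_notMem hB, abs_zero]
      linarith
  · intro x
    by_cases hB : x ∈ B
    · refine tendsto_const_nhds.congr' ?_
      obtain ⟨N, hN⟩ := exists_nat_gt (2 / S x)
      filter_upwards [eventually_ge_atTop N] with n hn
      have hSx := hS.pos x hB
      have : 2 < ((n : ℝ) + 1) * S x := by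
        rw [div_lt_iff₀ hSx] at hN
        have : (N : ℝ) ≤ n := by exact_mod_cast hn
        nlinarith
      simp only [hψ, indicator_of_mem hB, hΨ, (hTid n _ this).eq_of_nhds]
    · simp only [hψ, indicator_of_notMem hB]
      exact tendsto_const_nhds
  · intro x i
    by_cases hB : x ∈ B
    · refine tendsto_const_nhds.congr' ?_
      obtain ⟨N, hN⟩ := exists_nat_gt (2 / S x)
      filter_upwards [eventually_ge_atTop N] with n hn
      have hSx := hS.pos x hB
      have : 2 < ((n : ℝ) + 1) * S x := by
        rw [div_lt_iff₀ hSx] at hN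
        have : (N : ℝ) ≤ n := by exact_mod_cast hn
        nlinarith
      have h1 := hTid n _ this
      rw [hψd, indicator_of_mem hB, indicator_of_mem hB, h1.eq_of_nhds, h1.deriv_eq,
        pderiv_mul hS.contDiff hκ]
      simp
    · simp only [hψd, indicator_of_notMem hB]
      exact tendsto_const_nhds

theorem inner_mk (u : H D) (G : Fin d → H D) (q : HGrad D) :
    inner ℝ (HGrad.mk u G) q = inner ℝ u q.fst + ∑ i, inner ℝ (G i) (q.snd i) :=
  inner_HGrad _ _

/-- Bounded pointwise convergence gives weak convergence in `H`, which is all that the approximation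
arguments need. -/
theorem tendsto_setIntegral_mul {u : H D} {f : ℕ → E d → ℝ} {g : E d → ℝ} {C : ℝ}
    (hf : ∀ n, Continuous (f n)) (hC : ∀ n x, |f n x| ≤ C)
    (hfg : ∀ x, Tendsto (fun n => f n x) atTop (𝓝 (g x))) :
    Tendsto (fun n => ∫ x in D.region, u x * f n x) atTop (𝓝 (∫ x in D.region, u x * g x)) := by
  refine tendsto_integral_of_dominated_convergence (fun x => ‖u x‖ * C) (fun n => ?_) ?_
    (fun n => Eventually.of_forall fun x => ?_) (Eventually.of_forall fun x => ?_)
  · exact (Lp.aestronglyMeasurable u).mul (hf n).aestronglyMeasurable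
  · exact ((Lp.memLp u).integrable (by norm_num)).norm.mul_const C
  · rw [norm_mul]
    exact mul_le_mul_of_nonneg_left (hC n x) (norm_nonneg _)
  · exact (hfg x).const_mul _

namespace IsBoundaryWeight

variable {B : Set (E d)} {S κ : E d → ℝ}

theorem memLp_indicator (hS : IsBoundaryWeight D B S) {f : E d → ℝ} (hf : Continuous f) :
    MemLp (B.indicator f) 2 (volume.restrict D.region) :=
  (memLp_of_continuous D hf).indicator hS.isOpen.measurableSet

/-- The weak gradient of an element of `V` can be tested with the functions `1_B S κ`. -/
theorem integral_eq (hS : IsBoundaryWeight D B S) (hD : D.Admissible bc) (hκ : ContDiff ℝ ∞ κ)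
    (v : V D bc) (i : Fin d) :
    ∫ x in D.region, V.toH D bc v x * B.indicator (pderiv (fun x => S x * κ x) i) x
      = - ∫ x in D.region, V.grad D bc v i x * B.indicator (fun x => S x * κ x) x := by
  obtain ⟨ψ, C, h1, h2, h3, h4, h5⟩ := hS.exists_approx hκ
  have l1 := tendsto_setIntegral_mul (u := V.toH D bc v)
    (fun n => continuous_pderiv (h1 n).contDiff i) (fun n x => h3 n x i) (fun x => h5 x i)
  have l2 := tendsto_setIntegral_mul (u := V.grad D bc v i)
    (fun n => (h1 n).contDiff.continuous) h2 h4
  refine tendsto_nhds_unique l1 (l2.neg.congr fun n => ?_)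
  exact (V.isWeakGradient hD v (h1 n).1 (h1 n).2.1 (h1 n).2.2 i).symm

/-- A closed subspace equals its double orthogonal complement, so it contains the weak limits of its
elements. -/
theorem mem_W012 (hS : IsBoundaryWeight D B S) (hκ : ContDiff ℝ ∞ κ) :
    HGrad.mk ((hS.memLp_indicator (hS.contDiff.mul hκ).continuous).toLp _)
      (fun i => (hS.memLp_indicator (continuous_pderiv (hS.contDiff.mul hκ) i)).toLp _)
      ∈ W012 D := by
  obtain ⟨ψ, C, h1, h2, h3, h4, h5⟩ := hS.exists_approx hκ
  have hcl : IsClosed (W012 D : Set (HGrad D)) := Submodule.isClosed_topologicalClosure _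
  have : CompleteSpace (W012 D) := hcl.completeSpace_coe
  rw [← Submodule.orthogonal_orthogonal (W012 D), Submodule.mem_orthogonal']
  intro q hq
  have hm := fun n => memLp_of_continuous D (h1 n).contDiff.continuous
  have hm' := fun n i => memLp_of_continuous D (continuous_pderiv (h1 n).contDiff i)
  have hz : ∀ n, inner ℝ (HGrad.mk ((hm n).toLp _) (fun i => (hm' n i).toLp _)) q = 0 := fun n => by
    refine (Submodule.mem_orthogonal _ _).1 hq _ (Submodule.le_topologicalClosure _
      (Submodule.subset_span ⟨ψ n, h1 n, (hm n).coeFn_toLp, fun i => (hm' n i).coeFn_toLp⟩))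
  have hlim : Tendsto (fun n => inner ℝ (HGrad.mk ((hm n).toLp _) (fun i => (hm' n i).toLp _)) q)
      atTop (𝓝 (inner ℝ (HGrad.mk
        ((hS.memLp_indicator (hS.contDiff.mul hκ).continuous).toLp _)
        (fun i => (hS.memLp_indicator (continuous_pderiv (hS.contDiff.mul hκ) i)).toLp _)) q)) := by
    simp only [inner_mk]
    refine Tendsto.add ?_ (tendsto_finsetSum _ fun i _ => ?_)
    · simp only [inner_toLp_left]
      exact tendsto_setIntegral_mul (fun n => (h1 n).contDiff.continuous) h2 h4
    · simp only [inner_toLp_left]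
      exact tendsto_setIntegral_mul (fun n => continuous_pderiv (h1 n).contDiff i)
        (fun n x => h3 n x i) (fun x => h5 x i)
  simp only [hz] at hlim
  exact (tendsto_nhds_unique hlim tendsto_const_nhds)

theorem exists_V (hS : IsBoundaryWeight D B S) (bc : BoundaryCondition) (hκ : ContDiff ℝ ∞ κ) :
    ∃ v : V D bc,
      V.toH D bc v = (hS.memLp_indicator (hS.contDiff.mul hκ).continuous).toLp _ ∧
      ∀ i, V.grad D bc v i
        = (hS.memLp_indicator (continuous_pderiv (hS.contDiff.mul hκ) i)).toLp _ :=
  ⟨⟨_, W012_le_VSub D bc (hS.mem_W012 hκ)⟩, rfl, fun _ => rfl⟩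

/-- The square of a boundary weight belongs to the domain of the Laplacian. -/
theorem exists_DA (hS : IsBoundaryWeight D B S) (hD : D.Admissible bc) :
    ∃ z : DA D bc, DA.toH D bc z
      = (hS.memLp_indicator (hS.contDiff.mul hS.contDiff).continuous).toLp _ := by
  obtain ⟨v, hv, hv'⟩ := hS.exists_V bc hS.contDiff
  have hκ : ∀ i, ContDiff ℝ ∞ fun x => 2 * pderiv S i x := fun i =>
    contDiff_const.mul (contDiff_pderiv hS.contDiff i)
  -- The reason for the square: its gradient still contains a factor `S`, so integrating by parts
  -- against the gradient of an element of `V` produces no boundary term on `∂B`. The distributional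
  -- Laplacian is then the `L²` function `1_B Δ(S²)`. For `S` alone the normal derivative may jump.
  have hG : ∀ i, pderiv (fun x => S x * S x) i = fun x => S x * (2 * pderiv S i x) := fun i => by
    funext x
    rw [pderiv_mul hS.contDiff hS.contDiff]
    ring
  set Lu : Fin d → H D := fun i =>
    (hS.memLp_indicator (continuous_pderiv (hS.contDiff.mul (hκ i)) i)).toLp _ with hLu
  refine ⟨⟨(V.toH D bc v, V.toH D bc v - ∑ i, Lu i), v, rfl, fun w => ?_⟩, hv⟩
  have hi : ∀ i, inner ℝ (V.grad D bc v i) (V.grad D bc w i) = - inner ℝ (Lu i) (V.toH D bc w) :=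
    fun i => by
      rw [hv', hLu, inner_toLp_left, inner_toLp_left]
      have := hS.integral_eq hD (hκ i) w i
      simp only [hG]
      linarith
  rw [V.inner_eq]
  change inner ℝ (V.grad D bc v) (V.grad D bc w) + _ =
    inner ℝ (V.toH D bc v - ∑ i, Lu i) (V.toH D bc w)
  rw [PiLp.inner_apply, Finset.sum_congr rfl fun i _ => hi i, inner_sub_left, sum_inner,
    Finset.sum_neg_distrib]
  ring

end IsBoundaryWeight

/-- The product of sines in the definition of `bump`, without the cutoff. -/
noncomputable def sineProduct (l : Fin d → ℝ) (z : E d) : ℝ :=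
  ∏ n, Real.sin (Real.pi * ((z n + l n) / (2 * l n)))

theorem isOpen_omega (l : Fin d → ℝ) : IsOpen (omega l) := by
  have : omega l = ⋂ n, {x : E d | -l n < x n ∧ x n < l n} := by
    ext x; simp [omega]
  rw [this]
  refine isOpen_iInter_of_finite fun n => ?_
  have hn : Continuous fun x : E d => x n := by fun_prop
  exact (isOpen_lt continuous_const hn).inter (isOpen_lt hn continuous_const)

theorem contDiff_sineProduct (l : Fin d → ℝ) : ContDiff ℝ ∞ (sineProduct l) := by
  refine contDiff_prod fun n _ => Real.contDiff_sin.comp (contDiff_const.mul ?_)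
  exact ((contDiff_piLp_apply (p := 2)).add contDiff_const).div_const _

theorem sineProduct_pos {l : Fin d → ℝ} {z : E d} (hz : z ∈ omega l) :
    0 < sineProduct l z := by
  refine Finset.prod_pos fun n _ => ?_
  have h := hz n
  have h2 : 0 < 2 * l n := by linarith
  refine Real.sin_pos_of_pos_of_lt_pi ?_ ?_
  · exact mul_pos Real.pi_pos (div_pos (by linarith) h2)
  · have : (z n + l n) / (2 * l n) < 1 := by rw [div_lt_one h2]; linarith
    nlinarith [Real.pi_pos]

theorem sineProduct_eq_zero {l : Fin d → ℝ} (hl : ∀ n, 0 < l n) {z : E d}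
    (hz : z ∈ closure (omega l)) (hz' : z ∉ omega l) : sineProduct l z = 0 := by
  have hc : ∀ n, -l n ≤ z n ∧ z n ≤ l n := fun n => by
    have hn : Continuous fun x : E d => x n := by fun_prop
    have hcl : IsClosed ({x : E d | -l n ≤ x n} ∩ {x | x n ≤ l n}) :=
      (isClosed_le continuous_const hn).inter (isClosed_le hn continuous_const)
    have hsub : omega l ⊆ {x : E d | -l n ≤ x n} ∩ {x | x n ≤ l n} :=
      fun x hx => ⟨(hx n).1.le, (hx n).2.le⟩
    exact closure_minimal hsub hcl hz
  have : ∃ n, ¬ (-l n < z n ∧ z n < l n) := by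
    by_contra! h
    exact hz' h
  obtain ⟨n, hn⟩ := this
  refine Finset.prod_eq_zero (Finset.mem_univ n) ?_
  have h2 : 2 * l n ≠ 0 := by linarith [hl n]
  rcases (hc n).1.lt_or_eq with h | h
  · have : z n = l n := le_antisymm (hc n).2 (not_lt.1 fun h' => hn ⟨h, h'⟩)
    rw [this, ← two_mul, div_self h2, mul_one, Real.sin_pi]
  · rw [← h]
    simp

/-- The rescaled copies of `bump` in `Ω` are boundary weights. -/
theorem isBoundaryWeight_sineProduct {l : Fin d → ℝ} (hl : ∀ n, 0 < l n) {r : ℝ}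
    {b : E d} (hB : {x | r • x + b ∈ omega l} ⊆ D.region) :
    IsBoundaryWeight D {x | r • x + b ∈ omega l} fun x => sineProduct l (r • x + b) where
  isOpen := (isOpen_omega l).preimage (f := fun x : E d => r • x + b) (by fun_prop)
  subset := hB
  contDiff := (contDiff_sineProduct l).comp ((contDiff_const_smul r).add contDiff_const)
  pos x hx := sineProduct_pos hx
  eq_zero x hx hx' := by
    refine sineProduct_eq_zero hl ?_ hx'
    have hc : Continuous fun x : E d => r • x + b := by fun_prop
    exact hc.closure_preimage_subset _ hx

theorem bump_eq_indicator (l : Fin d → ℝ) (r : ℝ) (b x : E d) :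
    bump l (r • x + b)
      = {x | r • x + b ∈ omega l}.indicator (fun x => sineProduct l (r • x + b)) x := by
  by_cases h : r • x + b ∈ omega l
  · rw [bump, indicator_of_mem h, indicator_of_mem (show x ∈ {x | r • x + b ∈ omega l} from h)]
    rfl
  · rw [bump, indicator_of_notMem h,
      indicator_of_notMem (show x ∉ {x | r • x + b ∈ omega l} from h)]

theorem exists_V_bump {l : Fin d → ℝ} (hl : ∀ n, 0 < l n) {r : ℝ}
    {b : E d} (hB : {x | r • x + b ∈ omega l} ⊆ D.region) (bc : BoundaryCondition)
    {f : E d → ℝ} (hf : MemLp f 2 (volume.restrict D.region))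
    (hfb : ∀ x, f x = bump l (r • x + b) ^ 1) :
    ∃ v : V D bc, V.toH D bc v = hf.toLp f := by
  obtain ⟨v, hv, -⟩ := (isBoundaryWeight_sineProduct hl hB).exists_V bc
    (contDiff_const (c := (1 : ℝ)))
  refine ⟨v, hv.trans (MemLp.toLp_congr _ _ (Eventually.of_forall fun x => ?_))⟩
  rw [hfb, pow_one, bump_eq_indicator]
  simp

theorem exists_DA_bump {l : Fin d → ℝ} (hl : ∀ n, 0 < l n) {r : ℝ}
    {b : E d} (hB : {x | r • x + b ∈ omega l} ⊆ D.region) (hD : D.Admissible bc)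
    {f : E d → ℝ} (hf : MemLp f 2 (volume.restrict D.region))
    (hfb : ∀ x, f x = bump l (r • x + b) ^ 2) :
    ∃ z : DA D bc, DA.toH D bc z = hf.toLp f := by
  obtain ⟨z, hz⟩ := (isBoundaryWeight_sineProduct hl hB).exists_DA hD
  refine ⟨z, hz.trans (MemLp.toLp_congr _ _ (Eventually.of_forall fun x => ?_))⟩
  rw [hfb, bump_eq_indicator]
  by_cases h : x ∈ {x | r • x + b ∈ omega l}
  · simp only [indicator_of_mem h]; ring
  · simp only [indicator_of_notMem h]; ring

end Cutoff

/-! ### Geometry of the subdivision into cells -/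

section Cells

variable {d : ℕ} {D : Domain d} {bc : BoundaryCondition}

/-- In barycentric coordinates the four rescalings of the midpoint subdivision become `c ↦ 2c - δ`
and `c ↦ 1 - 2c`, which reduces the geometry of triangles to linear inequalities. -/
theorem exists_barycentric (p : Fin 3 → E d) (hd : d = 2) (hp : AffineIndependent ℝ p) :
    ∃ c : Fin 3 → E d → ℝ, (∀ x, x ∈ (Domain.triangle p).region ↔ ∀ i, 0 < c i x) ∧
      (∀ x, c 0 x + c 1 x + c 2 x = 1) ∧
      (∀ (i j : Fin 3) x, c i ((2 : ℝ) • x - p j) = 2 * c i x - if i = j then 1 else 0) ∧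
      ∀ (i : Fin 3) x, c i (p 0 + p 1 + p 2 - (2 : ℝ) • x) = 1 - 2 * c i x := by
  have htop : affineSpan ℝ (range p) = ⊤ := by
    refine hp.affineSpan_eq_top_iff_card_eq_finrank_add_one.2 ?_
    simp [hd]
  let β : AffineBasis (Fin 3) ℝ (E d) := ⟨p, hp, htop⟩
  have hlin : ∀ i x, β.coord i x = (β.coord i).linear x + β.coord i 0 := fun i x => by
    have := congrFun (AffineMap.decomp (β.coord i)) x
    simpa using this
  have hβ : ∀ i j, β.coord i (p j) = if i = j then 1 else 0 := fun i j => β.coord_apply i j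
  refine ⟨fun i x => β.coord i x, fun x => ?_, fun x => ?_, fun i j x => ?_, fun i x => ?_⟩
  · have := AffineBasis.interior_convexHull β
    change x ∈ interior (convexHull ℝ (range p)) ↔ _
    rw [show p = β from rfl, this]
    rfl
  · have := β.sum_coord_apply_eq_one x
    rwa [Fin.sum_univ_three] at this
  · beta_reduce
    rw [← hβ, hlin i (_ - _), hlin i x, hlin i (p j), map_sub, map_smul, smul_eq_mul]
    ring
  · have h : (if i = 0 then (1 : ℝ) else 0) + (if i = 1 then 1 else 0) + (if i = 2 then 1 else 0)
        = 1 := by fin_cases i <;> simp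
    have h0 := hβ i 0
    have h1 := hβ i 1
    have h2 := hβ i 2
    rw [← h0, ← h1, ← h2] at h
    rw [hlin i (p 0), hlin i (p 1), hlin i (p 2)] at h
    beta_reduce
    rw [hlin i (_ - _), hlin i x, map_sub, map_add, map_add, map_smul, smul_eq_mul]
    linarith

theorem mem_region_of_triangleUnscale {p : Fin 3 → E d} (hd : d = 2) (hp : AffineIndependent ℝ p)
    {i : Fin 4} {x : E d} (h : triangleUnscale p i x ∈ (Domain.triangle p).region) :
    x ∈ (Domain.triangle p).region := by
  obtain ⟨c, h1, h2, h3, h4⟩ := exists_barycentric p hd hp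
  rw [h1] at h ⊢
  unfold triangleUnscale at h
  split_ifs at h with hi
  · simp only [h3] at h
    intro j
    have := h j
    split_ifs at this <;> linarith
  · simp only [h4] at h
    have := h2 x
    have k0 := h 0
    have k1 := h 1
    have k2 := h 2
    intro j
    fin_cases j <;> simp only [Fin.zero_eta, Fin.mk_one, Fin.reduceFinMk] <;> linarith

/-- The corner triangle at a vertex is where the coordinate of that vertex exceeds 1/2, and the
central one is where all coordinates are below 1/2. Two positive coordinates of sum less than 1
cannot both exceed 1/2. -/
theorem triangleUnscale_index_eq {p : Fin 3 → E d} (hd : d = 2) (hp : AffineIndependent ℝ p)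
    {i j : Fin 4} {x : E d} (hi : triangleUnscale p i x ∈ (Domain.triangle p).region)
    (hj : triangleUnscale p j x ∈ (Domain.triangle p).region) : i = j := by
  have hx := mem_region_of_triangleUnscale hd hp hi
  obtain ⟨c, h1, h2, h3, h4⟩ := exists_barycentric p hd hp
  rw [h1] at hx hi hj
  unfold triangleUnscale at hi hj
  have hs := h2 x
  have k0 := hx 0
  have k1 := hx 1
  have k2 := hx 2
  split_ifs at hi hj with hi' hj' hj'
  · simp only [h3] at hi hj
    have a1 := hi ⟨i.val, hi'⟩
    have a2 := hj ⟨j.val, hj'⟩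
    rw [if_pos rfl] at a1 a2
    have : ∀ m n : Fin 3, 0 < 2 * c m x - 1 → 0 < 2 * c n x - 1 → m = n := by
      intro m n hm hn
      fin_cases m <;> fin_cases n <;> first | rfl | (exfalso; simp at hm hn; linarith)
    have := this _ _ a1 a2
    simp only [Fin.mk.injEq] at this
    exact Fin.ext this
  · simp only [h3, h4] at hi hj
    have a1 := hi ⟨i.val, hi'⟩
    have a2 := hj ⟨i.val, hi'⟩
    rw [if_pos rfl] at a1
    linarith
  · simp only [h3, h4] at hi hj
    have a1 := hj ⟨j.val, hj'⟩
    have a2 := hi ⟨j.val, hj'⟩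
    rw [if_pos rfl] at a1
    linarith
  · ext; omega

theorem foldl_triangleUnscale_mem {p : Fin 3 → E d} (hd : d = 2) (hp : AffineIndependent ℝ p)
    (s : List (Fin 4)) {x : E d}
    (h : s.foldl (fun y i => triangleUnscale p i y) x ∈ (Domain.triangle p).region) :
    x ∈ (Domain.triangle p).region := by
  induction s generalizing x with
  | nil => exact h
  | cons i s ih => exact mem_region_of_triangleUnscale hd hp (ih h)

/-- The fold applies the head of the list first, so the head names the largest subtriangle
containing `x`, and the tail is an index for the rescaled point. -/
theorem foldl_triangleUnscale_inj {p : Fin 3 → E d} (hd : d = 2) (hp : AffineIndependent ℝ p)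
    (s s' : List (Fin 4)) (hl : s.length = s'.length) {x : E d}
    (h : s.foldl (fun y i => triangleUnscale p i y) x ∈ (Domain.triangle p).region)
    (h' : s'.foldl (fun y i => triangleUnscale p i y) x ∈ (Domain.triangle p).region) :
    s = s' := by
  induction s generalizing x s' with
  | nil => exact (List.length_eq_zero_iff.1 hl.symm).symm
  | cons i s ih =>
    cases s' with
    | nil => simp at hl
    | cons j s' =>
      have hij := triangleUnscale_index_eq hd hp (foldl_triangleUnscale_mem hd hp s h)
        (foldl_triangleUnscale_mem hd hp s' h')
      subst hij
      rw [ih s' (by simpa using hl) h h']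

theorem foldl_triangleUnscale_affine (p : Fin 3 → E d) (s : List (Fin 4)) :
    ∃ (r : ℝ) (b : E d), |r| = 2 ^ s.length ∧
      ∀ x, s.foldl (fun y i => triangleUnscale p i y) x = r • x + b := by
  induction s with
  | nil => exact ⟨1, 0, by simp, fun x => by simp⟩
  | cons i s ih =>
    obtain ⟨r, b, hr, h⟩ := ih
    by_cases hi : i.val < 3
    · refine ⟨r * 2, b - r • p ⟨i.val, hi⟩, ?_, fun x => ?_⟩
      · rw [abs_mul, hr, List.length_cons, pow_succ]; simp
      · rw [List.foldl_cons, h, triangleUnscale, dif_pos hi, smul_sub, smul_smul]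
        abel
    · refine ⟨-(r * 2), b + r • (p 0 + p 1 + p 2), ?_, fun x => ?_⟩
      · rw [abs_neg, abs_mul, hr, List.length_cons, pow_succ]; simp
      · rw [List.foldl_cons, h, triangleUnscale, dif_neg hi, smul_sub, smul_smul, neg_smul]
        abel

/-- The part of `Ω` with index `k`. -/
def Domain.cell (D : Domain d) (M : ℕ) (k : D.Cell M) : Set (E d) :=
  {x | D.unscale M k x ∈ D.region}

theorem Domain.cell_subset (hD : D.Admissible bc) {M : ℕ} (k : D.Cell M) :
    D.cell M k ⊆ D.region := by
  cases D with
  | box L =>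
    intro x hx n
    have h := hx n
    simp only [Domain.unscale] at h
    have hk : ((k n : ℕ) : ℝ) + 1 ≤ M := by exact_mod_cast (k n).isLt
    have hk0 : (0 : ℝ) ≤ (k n : ℕ) := by positivity
    have hM : (0 : ℝ) < M := by linarith
    have hL := hD.2 n
    constructor
    · have : 0 < (M : ℝ) * x n := by nlinarith [h.1]
      exact pos_of_mul_pos_right this hM.le
    · have : (M : ℝ) * x n < M * L n := by nlinarith [h.2]
      exact lt_of_mul_lt_mul_left this hM.le
  | triangle p =>
    intro x hx
    exact foldl_triangleUnscale_mem hD.1 hD.2.1 _ hx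

theorem Domain.cell_index_eq (hD : D.Admissible bc) {M : ℕ} {k k' : D.Cell M} {x : E d}
    (hk : x ∈ D.cell M k) (hk' : x ∈ D.cell M k') : k = k' := by
  cases D with
  | box L =>
    funext n
    have h := hk n
    have h' := hk' n
    simp only [Domain.unscale] at h h'
    have hL := hD.2 n
    rcases lt_trichotomy (k n) (k' n) with hlt | heq | hlt
    · have : ((k n : ℕ) : ℝ) + 1 ≤ (k' n : ℕ) := by exact_mod_cast hlt
      nlinarith [h.2, h'.1]
    · exact heq
    · have : ((k' n : ℕ) : ℝ) + 1 ≤ (k n : ℕ) := by exact_mod_cast hlt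
      nlinarith [h'.2, h.1]
  | triangle p =>
    exact List.ofFn_injective (foldl_triangleUnscale_inj hD.1 hD.2.1 _ _ (by simp) hk hk')

/-- The rescalings of the cells are homotheties with a common ratio, up to the sign. -/
theorem Domain.exists_ratio (hD : D.Admissible bc) {M : ℕ} (hM : 0 < M) :
    ∃ m : ℝ, (M : ℝ) ≤ m ∧ (Fintype.card (D.Cell M) : ℝ) = m ^ d ∧
      ∀ k : D.Cell M, ∃ (r : ℝ) (b : E d), |r| = m ∧ ∀ x, D.unscale M k x = r • x + b := by
  cases D with
  | box L =>
    refine ⟨M, le_rfl, ?_, fun k => ⟨M, WithLp.toLp 2 fun n => - ((k n : ℕ) * L n), by simp,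
      fun x => ?_⟩⟩
    · have : Fintype.card (Fin d → Fin M) = M ^ d := by simp
      change ((Fintype.card (Fin d → Fin M) : ℕ) : ℝ) = _
      rw [this]
      push_cast
      rfl
    · ext n
      simp [Domain.unscale, sub_eq_add_neg]
  | triangle p =>
    -- Each midpoint subdivision doubles the ratio, and `4 ^ (M - 1)` is the square of the ratio
    -- since `d = 2`. The number of cells times the volume of one is then the volume of the domain.
    refine ⟨2 ^ (M - 1), ?_, ?_, fun k => ?_⟩
    · have : M ≤ 2 ^ (M - 1) := by
        obtain ⟨n, rfl⟩ := Nat.exists_eq_succ_of_ne_zero hM.ne'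
        exact Nat.lt_two_pow_self
      exact_mod_cast this
    · have : Fintype.card (Fin (M - 1) → Fin 4) = 4 ^ (M - 1) := by simp
      change ((Fintype.card (Fin (M - 1) → Fin 4) : ℕ) : ℝ) = _
      rw [this, hD.1, ← pow_mul, mul_comm, pow_mul]
      norm_num
    · obtain ⟨r, b, hr, h⟩ := foldl_triangleUnscale_affine p (List.ofFn k)
      exact ⟨r, b, by simpa using hr, h⟩

theorem Domain.convex_region (D : Domain d) : Convex ℝ D.region := by
  cases D with
  | box L =>
    intro x hx y hy a b ha hb hab n
    have h1 := hx n
    have h2 := hy n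
    simp only [PiLp.add_apply, PiLp.smul_apply, smul_eq_mul]
    exact (convex_Ioo 0 (L n)) h1 h2 ha hb hab
  | triangle p => exact (convex_convexHull ℝ _).interior

theorem volume_preimage_affine {r : ℝ} (hr : r ≠ 0) (b : E d) (s : Set (E d)) :
    volume {x : E d | r • x + b ∈ s} = ENNReal.ofReal (|r| ^ d)⁻¹ * volume s := by
  have : {x : E d | r • x + b ∈ s} = (r • ·) ⁻¹' ((· + b) ⁻¹' s) := rfl
  rw [this, Measure.addHaar_preimage_smul volume hr, measure_preimage_add_right]
  simp [abs_inv, abs_pow]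

end Cells

/-! ### Poincaré inequality on convex sets -/

section Poincare

variable {d : ℕ}

open scoped ENNReal

/-- Cauchy–Schwarz for a general measure, so that it also serves with the mollifier as a density. -/
theorem sq_lintegral_le {α : Type*} [MeasurableSpace α] (ν : Measure α) {f : α → ℝ≥0∞}
    (hf : AEMeasurable f ν) : (∫⁻ a, f a ∂ν) ^ 2 ≤ ν univ * ∫⁻ a, f a ^ 2 ∂ν := by
  have h := ENNReal.lintegral_mul_le_Lp_mul_Lq ν Real.HolderConjugate.two_two hf
    (aemeasurable_const (b := (1 : ℝ≥0∞)))
  simp only [Pi.mul_apply, mul_one, ENNReal.one_rpow, lintegral_const, one_mul] at h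
  calc (∫⁻ a, f a ∂ν) ^ 2
      ≤ ((∫⁻ a, f a ^ (2 : ℝ) ∂ν) ^ (1 / 2 : ℝ) * ν univ ^ (1 / 2 : ℝ)) ^ 2 := by gcongr
    _ = ν univ * ∫⁻ a, f a ^ 2 ∂ν := by
      rw [mul_pow, ← ENNReal.rpow_natCast, ← ENNReal.rpow_natCast, ← ENNReal.rpow_mul,
        ← ENNReal.rpow_mul, mul_comm]
      norm_num

/-- The square of the norm of the gradient. -/
noncomputable def gradSq (v : E d → ℝ) (x : E d) : ℝ := ∑ i, pderiv v i x ^ 2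

theorem gradSq_nonneg (v : E d → ℝ) (x : E d) : 0 ≤ gradSq v x :=
  Finset.sum_nonneg fun _ _ => sq_nonneg _

theorem continuous_gradSq {v : E d → ℝ} (hv : ContDiff ℝ ∞ v) : Continuous (gradSq v) :=
  continuous_finsetSum _ fun i _ => (continuous_pderiv hv i).pow 2

theorem fderiv_apply_sq_le (v : E d → ℝ) (x h : E d) :
    (fderiv ℝ v x h) ^ 2 ≤ ‖h‖ ^ 2 * gradSq v x := by
  have h1 : fderiv ℝ v x h = ∑ i, h i * pderiv v i x := by
    conv_lhs => rw [← (EuclideanSpace.basisFun (Fin d) ℝ).sum_repr h]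
    simp [pderiv]
  rw [h1, EuclideanSpace.norm_sq_eq, gradSq]
  simp only [Real.norm_eq_abs, sq_abs]
  exact Finset.sum_mul_sq_le_sq_mul_sq _ _ _

/-- The fundamental theorem of calculus along the segment from `y` to `x`, followed by
Cauchy–Schwarz in the parameter. -/
theorem enorm_sub_sq_le {v : E d → ℝ} (hv : ContDiff ℝ ∞ v) {δ : ℝ} {x y : E d}
    (hxy : ‖x - y‖ ≤ δ) :
    ‖v x - v y‖ₑ ^ 2 ≤ ENNReal.ofReal (δ ^ 2)
      * ∫⁻ s in Ioc (0 : ℝ) 1, ENNReal.ofReal (gradSq v (y + s • (x - y))) := by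
  have hd : ∀ s : ℝ, HasDerivAt (fun s : ℝ => v (y + s • (x - y)))
      (fderiv ℝ v (y + s • (x - y)) (x - y)) s := fun s => by
    have h1 : HasDerivAt (fun s : ℝ => y + s • (x - y)) (x - y) s := by
      simpa using ((hasDerivAt_id s).smul_const (x - y)).const_add y
    exact (hv.differentiable (by simp) _).hasFDerivAt.comp_hasDerivAt s h1
  have hc : Continuous fun s : ℝ => fderiv ℝ v (y + s • (x - y)) (x - y) :=
    ((hv.continuous_fderiv (by simp)).comp (by fun_prop)).clm_apply continuous_const
  have h1 : v x - v y = ∫ s in Ioc (0 : ℝ) 1, fderiv ℝ v (y + s • (x - y)) (x - y) := by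
    rw [← intervalIntegral.integral_of_le zero_le_one,
      intervalIntegral.integral_eq_sub_of_hasDerivAt (fun s _ => hd s) (hc.intervalIntegrable _ _)]
    simp
  calc ‖v x - v y‖ₑ ^ 2
      ≤ (∫⁻ s in Ioc (0 : ℝ) 1, ‖fderiv ℝ v (y + s • (x - y)) (x - y)‖ₑ) ^ 2 := by
        rw [h1]; gcongr; exact enorm_integral_le_lintegral_enorm _
    _ ≤ (volume.restrict (Ioc (0 : ℝ) 1)) univ
          * ∫⁻ s in Ioc (0 : ℝ) 1, ‖fderiv ℝ v (y + s • (x - y)) (x - y)‖ₑ ^ 2 :=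
        sq_lintegral_le _ hc.enorm.measurable.aemeasurable
    _ = ∫⁻ s in Ioc (0 : ℝ) 1, ‖fderiv ℝ v (y + s • (x - y)) (x - y)‖ₑ ^ 2 := by simp
    _ ≤ ∫⁻ s in Ioc (0 : ℝ) 1, ENNReal.ofReal (δ ^ 2)
          * ENNReal.ofReal (gradSq v (y + s • (x - y))) := by
        refine lintegral_mono fun s => ?_
        rw [← ENNReal.ofReal_mul (sq_nonneg δ), Real.enorm_eq_ofReal_abs,
          ← ENNReal.ofReal_pow (abs_nonneg _), sq_abs]
        refine ENNReal.ofReal_le_ofReal ((fderiv_apply_sq_le _ _ _).trans ?_)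
        gcongr
        exact gradSq_nonneg _ _
    _ = _ := lintegral_const_mul _
        (((continuous_gradSq hv).comp (by fun_prop)).measurable.ennreal_ofReal)

theorem lintegral_comp_affine {s : ℝ} (hs : s ≠ 0) (b : E d) {F : E d → ℝ≥0∞}
    (hF : Measurable F) :
    ∫⁻ x, F (s • x + b) = ENNReal.ofReal (|s| ^ d)⁻¹ * ∫⁻ x, F x := by
  have h1 : ∫⁻ x, F (s • x + b) = ∫⁻ z, F (z + b) ∂(Measure.map (s • ·) volume) := by
    exact (lintegral_map (hF.comp (measurable_add_const b)) (measurable_const_smul s)).symm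
  rw [h1, Measure.map_addHaar_smul volume hs, lintegral_smul_measure,
    lintegral_add_right_eq_self (fun x => F x) b]
  simp [abs_inv, abs_pow]

/-- By convexity the contraction towards `y` maps `K` into itself; the change of variables costs
`s⁻ᵈ`, at most `2ᵈ` when `s ≥ 1/2`. -/
theorem setLIntegral_contraction_le {K : Set (E d)} (hK : Convex ℝ K) (hKm : MeasurableSet K)
    {F : E d → ℝ≥0∞} (hF : Measurable F) {s : ℝ} (hs : 1 / 2 ≤ s) (hs1 : s ≤ 1) {y : E d}
    (hy : y ∈ K) :
    ∫⁻ x in K, F (y + s • (x - y)) ≤ 2 ^ d * ∫⁻ x in K, F x := by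
  have hs0 : 0 < s := by linarith
  rw [← lintegral_indicator hKm, ← lintegral_indicator hKm]
  calc ∫⁻ x, K.indicator (fun x => F (y + s • (x - y))) x
      ≤ ∫⁻ x, K.indicator F (s • x + (1 - s) • y) := by
        refine lintegral_mono fun x => ?_
        by_cases hx : x ∈ K
        · have hm : s • x + (1 - s) • y ∈ K := hK hx hy hs0.le (by linarith) (by ring)
          rw [indicator_of_mem hx, indicator_of_mem hm]
          refine le_of_eq (congrArg F ?_)
          rw [smul_sub, sub_smul, one_smul]
          abel
        · rw [indicator_of_notMem hx]
          exact zero_le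
    _ = ENNReal.ofReal (|s| ^ d)⁻¹ * ∫⁻ x, K.indicator F x :=
        lintegral_comp_affine hs0.ne' _ (hF.indicator hKm)
    _ ≤ 2 ^ d * ∫⁻ x, K.indicator F x := by
        gcongr
        rw [abs_of_pos hs0, ← inv_pow, ENNReal.ofReal_pow (by positivity)]
        gcongr
        rw [← ENNReal.ofReal_ofNat 2]
        refine ENNReal.ofReal_le_ofReal ?_
        rw [inv_le_comm₀ hs0 two_pos]
        linarith

/-- The Jacobian degenerates as `s` tends to 0 if `x` is the variable, and as `s` tends to 1 if it
is `y`. Integrating first in `x` for `s ≥ 1/2` and first in `y` for `s ≤ 1/2` avoids both. -/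
theorem lintegral_lintegral_segment_le {K : Set (E d)} (hK : Convex ℝ K) (hKm : MeasurableSet K)
    {F : E d → ℝ≥0∞} (hF : Measurable F) {s : ℝ} (hs : 0 ≤ s) (hs1 : s ≤ 1) :
    ∫⁻ x in K, ∫⁻ y in K, F (y + s • (x - y)) ≤ 2 ^ d * volume K * ∫⁻ x in K, F x := by
  have hm : Measurable (Function.uncurry fun x y : E d => F (y + s • (x - y))) :=
    hF.comp (by fun_prop)
  have hconst : ∫⁻ _ in K, (2 ^ d * ∫⁻ x in K, F x) = 2 ^ d * volume K * ∫⁻ x in K, F x := by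
    rw [lintegral_const, Measure.restrict_apply_univ]
    ring
  rw [← hconst]
  rcases le_total (1 / 2) s with h | h
  · rw [lintegral_lintegral_swap hm.aemeasurable]
    exact setLIntegral_mono' hKm fun y hy => setLIntegral_contraction_le hK hKm hF h hs1 hy
  · refine setLIntegral_mono' hKm fun x hx => ?_
    have := setLIntegral_contraction_le hK hKm hF (s := 1 - s) (by linarith) (by linarith) hx
    refine le_trans (le_of_eq (lintegral_congr fun y => congrArg F ?_)) this
    rw [smul_sub, smul_sub, sub_smul, sub_smul, one_smul, one_smul]
    abel

theorem lintegral_lintegral_lintegral_segment_le {K : Set (E d)} (hK : Convex ℝ K)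
    (hKm : MeasurableSet K) {F : E d → ℝ≥0∞} (hF : Measurable F) :
    ∫⁻ x in K, ∫⁻ y in K, ∫⁻ s in Ioc (0 : ℝ) 1, F (y + s • (x - y))
      ≤ 2 ^ d * volume K * ∫⁻ x in K, F x := by
  have e1 : ∀ x : E d, ∫⁻ y in K, ∫⁻ s in Ioc (0 : ℝ) 1, F (y + s • (x - y))
      = ∫⁻ s in Ioc (0 : ℝ) 1, ∫⁻ y in K, F (y + s • (x - y)) := fun x => by
    have hm : Measurable (Function.uncurry fun (y : E d) (s : ℝ) => F (y + s • (x - y))) :=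
      hF.comp (by fun_prop)
    exact lintegral_lintegral_swap hm.aemeasurable
  have hm1 : Measurable (Function.uncurry fun (x : E d) (s : ℝ) =>
      ∫⁻ y in K, F (y + s • (x - y))) :=
    Measurable.lintegral_prod_right'
      (f := fun q : (E d × ℝ) × E d => F (q.2 + q.1.2 • (q.1.1 - q.2))) (hF.comp (by fun_prop))
  have e2 : ∫⁻ x in K, ∫⁻ s in Ioc (0 : ℝ) 1, ∫⁻ y in K, F (y + s • (x - y))
      = ∫⁻ s in Ioc (0 : ℝ) 1, ∫⁻ x in K, ∫⁻ y in K, F (y + s • (x - y)) :=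
    lintegral_lintegral_swap hm1.aemeasurable
  have e3 : ∫⁻ s in Ioc (0 : ℝ) 1, ∫⁻ x in K, ∫⁻ y in K, F (y + s • (x - y))
      ≤ ∫⁻ _ in Ioc (0 : ℝ) 1, 2 ^ d * volume K * ∫⁻ x in K, F x :=
    setLIntegral_mono' measurableSet_Ioc fun s hs =>
      lintegral_lintegral_segment_le hK hKm hF hs.1.le hs.2
  rw [lintegral_congr e1, e2]
  refine e3.trans (le_of_eq ?_)
  rw [lintegral_const, Measure.restrict_apply_univ, Real.volume_Ioc]
  simp

theorem lintegral_enorm_sub_sq_le {K : Set (E d)} (hK : Convex ℝ K) (hKm : MeasurableSet K)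
    {δ : ℝ} (hδ : ∀ x ∈ K, ∀ y ∈ K, ‖x - y‖ ≤ δ) {v : E d → ℝ} (hv : ContDiff ℝ ∞ v) :
    ∫⁻ x in K, ∫⁻ y in K, ‖v x - v y‖ₑ ^ 2
      ≤ ENNReal.ofReal (δ ^ 2) * (2 ^ d * volume K * ∫⁻ x in K, ENNReal.ofReal (gradSq v x)) := by
  have hF : Measurable fun x => ENNReal.ofReal (gradSq v x) :=
    (continuous_gradSq hv).measurable.ennreal_ofReal
  have h1 : ∫⁻ x in K, ∫⁻ y in K, ‖v x - v y‖ₑ ^ 2 ≤ ∫⁻ x in K, ∫⁻ y in K,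
      ENNReal.ofReal (δ ^ 2) * ∫⁻ s in Ioc (0 : ℝ) 1,
        ENNReal.ofReal (gradSq v (y + s • (x - y))) :=
    setLIntegral_mono' hKm fun x hx => setLIntegral_mono' hKm fun y hy =>
      enorm_sub_sq_le hv (hδ x hx y hy)
  refine h1.trans ?_
  simp only [lintegral_const_mul' _ _ ENNReal.ofReal_ne_top]
  exact mul_le_mul_right (lintegral_lintegral_lintegral_segment_le hK hKm hF) _

/-- `G` is the weak gradient of `u` on the open set `U`. -/
def HasWeakGradientOn (U : Set (E d)) (u : E d → ℝ) (G : Fin d → E d → ℝ) : Prop :=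
  ∀ φ : E d → ℝ, ContDiff ℝ ∞ φ → HasCompactSupport φ → tsupport φ ⊆ U → ∀ i,
    ∫ x in U, u x * pderiv φ i x = - ∫ x in U, G i x * φ x

/-- The mollification of a function that is extended by zero outside of `U`. -/
noncomputable def mollify (ρ : ContDiffBump (0 : E d)) (U : Set (E d)) (u : E d → ℝ) : E d → ℝ :=
  convolution (U.indicator u) (ρ.normed volume) (ContinuousLinearMap.lsmul ℝ ℝ).flip volume

theorem contDiff_mollify (ρ : ContDiffBump (0 : E d)) {U : Set (E d)} (hU : MeasurableSet U)
    {u : E d → ℝ} (hu : IntegrableOn u U) : ContDiff ℝ ∞ (mollify ρ U u) :=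
  (ρ.hasCompactSupport_normed).contDiff_convolution_right _
    (hu.integrable_indicator hU).locallyIntegrable (ρ.contDiff_normed (n := ⊤))

/-- When the ball of the mollifier around `x` stays in `U`, the kernel `y ↦ ρ(x - y)` is an
admissible test function, so the derivative passes from the kernel to the weak gradient. -/
theorem pderiv_mollify (ρ : ContDiffBump (0 : E d)) {U : Set (E d)} (hU : MeasurableSet U)
    {u : E d → ℝ} {G : Fin d → E d → ℝ} (hu : IntegrableOn u U) (hG : HasWeakGradientOn U u G)
    {x : E d} (hx : Metric.closedBall x ρ.rOut ⊆ U) (i : Fin d) :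
    pderiv (mollify ρ U u) i x = ∫ y in U, G i y * ρ.normed volume (x - y) := by
  set f := ρ.normed (volume : Measure (E d)) with hf
  have hfs : ContDiff ℝ ∞ f := ρ.contDiff_normed (n := ⊤)
  have hfc : HasCompactSupport f := ρ.hasCompactSupport_normed
  have hL : LocallyIntegrable (U.indicator u) := (hu.integrable_indicator hU).locallyIntegrable
  have h1 := hfc.hasFDerivAt_convolution_right (ContinuousLinearMap.lsmul ℝ ℝ).flip hL
    (hfs.of_le (by simp)) x
  have h2 : pderiv (mollify ρ U u) i x = ∫ y in U, u y * pderiv f i (x - y) := by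
    rw [pderiv, mollify, h1.fderiv, convolution_precompR_apply _ hL (hfc.fderiv ℝ)
      (hfs.continuous_fderiv (by simp)), convolution_def, ← integral_indicator hU]
    refine integral_congr_ae (Eventually.of_forall fun y => ?_)
    by_cases hy : y ∈ U
    · simp [hy, pderiv, mul_comm]
    · simp [hy]
  set φ : E d → ℝ := fun y => f (x - y) with hφ
  have hφs : ContDiff ℝ ∞ φ := hfs.comp (contDiff_const.sub contDiff_id)
  have hsub : tsupport φ ⊆ Metric.closedBall x ρ.rOut := by
    refine closure_minimal (fun y hy => ?_) Metric.isClosed_closedBall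
    have : x - y ∈ Function.support f := hy
    rw [hf, ρ.support_normed_eq, mem_ball_zero_iff] at this
    rw [Metric.mem_closedBall, dist_comm, dist_eq_norm]
    exact this.le
  have hφc : HasCompactSupport φ :=
    (isCompact_closedBall x ρ.rOut).of_isClosed_subset (isClosed_tsupport _) hsub
  have hd : ∀ y, pderiv φ i y = - pderiv f i (x - y) := fun y => by
    have : HasFDerivAt φ ((fderiv ℝ f (x - y)).comp (-(ContinuousLinearMap.id ℝ (E d)))) y :=
      (hfs.differentiable (by simp) _).hasFDerivAt.comp y ((hasFDerivAt_id y).const_sub x)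
    rw [pderiv, this.fderiv]
    simp [pderiv]
  have h3 := hG φ hφs hφc (hsub.trans hx) i
  simp only [hd, mul_neg, integral_neg] at h3
  rw [h2]
  linarith

theorem lintegral_pderiv_mollify_le (ρ : ContDiffBump (0 : E d)) {U K : Set (E d)}
    (hU : MeasurableSet U) (hKm : MeasurableSet K)
    {u : E d → ℝ} {G : Fin d → E d → ℝ} (hu : IntegrableOn u U) (hG : HasWeakGradientOn U u G)
    (hGm : ∀ i, AEMeasurable (G i) (volume.restrict U))
    (hK : ∀ x ∈ K, Metric.closedBall x ρ.rOut ⊆ U) (i : Fin d) :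
    ∫⁻ x in K, ENNReal.ofReal (pderiv (mollify ρ U u) i x ^ 2) ≤ ∫⁻ y in U, ‖G i y‖ₑ ^ 2 := by
  set f := ρ.normed (volume : Measure (E d)) with hf
  have hfc : Continuous f := ρ.continuous_normed
  have hf0 : ∀ z, 0 ≤ f z := ρ.nonneg_normed
  have hfint : ∫⁻ z, ENNReal.ofReal (f z) = 1 := by
    rw [← ofReal_integral_eq_lintegral_ofReal ρ.integrable_normed (Eventually.of_forall hf0),
      ρ.integral_normed, ENNReal.ofReal_one]
  have hpt : ∀ x ∈ K, ENNReal.ofReal (pderiv (mollify ρ U u) i x ^ 2)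
      ≤ ∫⁻ y in U, ENNReal.ofReal (f (x - y)) * ‖G i y‖ₑ ^ 2 := fun x hx => by
    have hw : Measurable fun y => ENNReal.ofReal (f (x - y)) :=
      (hfc.comp (by fun_prop)).measurable.ennreal_ofReal
    -- Cauchy–Schwarz is applied to the measure on `U` with density `f(x - ·)`, whose total mass is
    -- at most 1; Tonelli then removes the kernel.
    have hwG := (hGm i).enorm.mono_ac (withDensity_absolutelyContinuous (volume.restrict U)
      fun y => ENNReal.ofReal (f (x - y)))
    have hCS := sq_lintegral_le _ hwG
    rw [lintegral_withDensity_eq_lintegral_mul₀ hw.aemeasurable (hGm i).enorm,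
      lintegral_withDensity_eq_lintegral_mul₀ hw.aemeasurable ((hGm i).enorm.pow_const 2),
      withDensity_apply _ MeasurableSet.univ, Measure.restrict_univ] at hCS
    have htot : ∫⁻ y in U, ENNReal.ofReal (f (x - y)) ≤ 1 := by
      rw [← hfint]
      refine (setLIntegral_le_lintegral _ _).trans (le_of_eq ?_)
      exact lintegral_sub_left_eq_self (fun z => ENNReal.ofReal (f z)) x
    rw [pderiv_mollify ρ hU hu hG (hK x hx) i, ← sq_abs, ENNReal.ofReal_pow (abs_nonneg _),
      ← Real.enorm_eq_ofReal_abs]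
    calc ‖∫ y in U, G i y * f (x - y)‖ₑ ^ 2
        ≤ (∫⁻ y in U, ‖G i y * f (x - y)‖ₑ) ^ 2 := by
          gcongr; exact enorm_integral_le_lintegral_enorm _
      _ = (∫⁻ y in U, ENNReal.ofReal (f (x - y)) * ‖G i y‖ₑ) ^ 2 := by
          congr 1
          refine lintegral_congr fun y => ?_
          rw [enorm_mul, mul_comm, Real.enorm_eq_ofReal (hf0 _)]
      _ ≤ (∫⁻ y in U, ENNReal.ofReal (f (x - y)))
            * ∫⁻ y in U, ENNReal.ofReal (f (x - y)) * ‖G i y‖ₑ ^ 2 := hCS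
      _ ≤ 1 * ∫⁻ y in U, ENNReal.ofReal (f (x - y)) * ‖G i y‖ₑ ^ 2 := by gcongr
      _ = _ := one_mul _
  have hmeas : AEMeasurable (Function.uncurry fun x y => ENNReal.ofReal (f (x - y)) * ‖G i y‖ₑ ^ 2)
      ((volume : Measure (E d)).prod (volume.restrict U)) := by
    have m1 : Measurable fun q : E d × E d => ENNReal.ofReal (f (q.1 - q.2)) :=
      (hfc.comp (by fun_prop : Continuous fun q : E d × E d => q.1 - q.2)).measurable.ennreal_ofReal
    have m2 : AEMeasurable (fun q : E d × E d => ‖G i q.2‖ₑ ^ 2)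
        ((volume : Measure (E d)).prod (volume.restrict U)) :=
      ((hGm i).enorm.pow_const 2).comp_quasiMeasurePreserving Measure.quasiMeasurePreserving_snd
    exact m1.aemeasurable.mul m2
  calc ∫⁻ x in K, ENNReal.ofReal (pderiv (mollify ρ U u) i x ^ 2)
      ≤ ∫⁻ x in K, ∫⁻ y in U, ENNReal.ofReal (f (x - y)) * ‖G i y‖ₑ ^ 2 :=
        setLIntegral_mono' hKm hpt
    _ ≤ ∫⁻ x, ∫⁻ y in U, ENNReal.ofReal (f (x - y)) * ‖G i y‖ₑ ^ 2 :=
        setLIntegral_le_lintegral _ _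
    _ = ∫⁻ y in U, ∫⁻ x, ENNReal.ofReal (f (x - y)) * ‖G i y‖ₑ ^ 2 :=
        lintegral_lintegral_swap hmeas
    _ = ∫⁻ y in U, ‖G i y‖ₑ ^ 2 := by
        refine lintegral_congr fun y => ?_
        have m1 : Measurable fun x => ENNReal.ofReal (f (x - y)) :=
          (hfc.comp (by fun_prop : Continuous fun x : E d => x - y)).measurable.ennreal_ofReal
        rw [lintegral_mul_const _ m1,
          lintegral_sub_right_eq_self (fun z => ENNReal.ofReal (f z)) y, hfint, one_mul]

/-- A Poincaré inequality on bounded convex open sets. -/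
theorem HasWeakGradientOn.lintegral_sub_sq_le {U : Set (E d)} (hU : IsOpen U) (hUc : Convex ℝ U)
    {δ : ℝ} (hδ : ∀ x ∈ U, ∀ y ∈ U, ‖x - y‖ ≤ δ) {u : E d → ℝ} {G : Fin d → E d → ℝ}
    (hG : HasWeakGradientOn U u G) (hu : IntegrableOn u U)
    (hGm : ∀ i, AEMeasurable (G i) (volume.restrict U)) :
    ∫⁻ x in U, ∫⁻ y in U, ‖u x - u y‖ₑ ^ 2
      ≤ ENNReal.ofReal (δ ^ 2) * (2 ^ d * volume U * ∑ i, ∫⁻ x in U, ‖G i x‖ₑ ^ 2) := by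
  rcases U.eq_empty_or_nonempty with rfl | ⟨x₀, hx₀⟩
  · simp
  obtain ⟨r, hr, hball⟩ := Metric.isOpen_iff.1 hU x₀ hx₀
  have hn0 : ∀ n : ℕ, (0 : ℝ) < n + 2 := fun n => by positivity
  set s : ℕ → ℝ := fun n => 1 - 1 / ((n : ℝ) + 2) with hs
  have hs0 : ∀ n, 0 < s n := fun n => by
    have : 1 / ((n : ℝ) + 2) < 1 := by
      rw [div_lt_one (hn0 n)]
      have : (0 : ℝ) ≤ n := by positivity
      linarith
    simp only [hs]; linarith
  have hs1 : ∀ n, 1 - s n = 1 / ((n : ℝ) + 2) := fun n => by simp [hs]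
  have hs1' : ∀ n, 0 < 1 - s n := fun n => by rw [hs1]; exact one_div_pos.2 (hn0 n)
  -- The outer radius makes the ball around a point of the shrunk set fit in `U`; the fixed ratio 2
  -- of the radii is what almost everywhere convergence of the mollifications requires.
  set ρ : ℕ → ContDiffBump (0 : E d) := fun n =>
    { rIn := (1 - s n) * r / 4
      rOut := (1 - s n) * r / 2
      rIn_pos := by have := hs1' n; positivity
      rIn_lt_rOut := by have := mul_pos (hs1' n) hr; linarith } with hρ
  have hlim0 : Tendsto (fun n => 1 - s n) atTop (𝓝 0) := by
    simp only [hs1]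
    have := (tendsto_one_div_add_atTop_nhds_zero_nat (𝕜 := ℝ)).comp (tendsto_add_atTop_nat 1)
    refine this.congr fun n => ?_
    simp only [Function.comp_apply]
    push_cast
    ring
  have hlims : Tendsto s atTop (𝓝 1) := by
    have := hlim0.const_sub 1
    simpa using this
  -- The image of `U` under the homothety of centre `x₀` and ratio `s n < 1`: convex, contained in
  -- `U`, and eventually containing each point of `U`.
  set K : ℕ → Set (E d) := fun n => {x | (s n)⁻¹ • x + (1 - (s n)⁻¹) • x₀ ∈ U} with hK
  have hKo : ∀ n, IsOpen (K n) := fun n =>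
    hU.preimage (f := fun x : E d => (s n)⁻¹ • x + (1 - (s n)⁻¹) • x₀) (by fun_prop)
  have hKc : ∀ n, Convex ℝ (K n) := fun n => by
    intro x hx y hy a b ha hb hab
    have := hUc hx hy ha hb hab
    have e : a • ((s n)⁻¹ • x + (1 - (s n)⁻¹) • x₀) + b • ((s n)⁻¹ • y + (1 - (s n)⁻¹) • x₀)
        = (s n)⁻¹ • (a • x + b • y) + (1 - (s n)⁻¹) • x₀ := by
      obtain rfl : b = 1 - a := by linarith
      module
    rw [e] at this
    exact this
  have hKball : ∀ n, ∀ x ∈ K n, Metric.closedBall x (ρ n).rOut ⊆ U := fun n x hx z hz => by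
    have h1 : x₀ + (1 - s n)⁻¹ • (z - x) ∈ U := by
      apply hball
      rw [Metric.mem_ball, dist_eq_norm, add_sub_cancel_left, norm_smul, norm_inv,
        Real.norm_eq_abs, abs_of_pos (hs1' n), inv_mul_lt_iff₀ (hs1' n), ← dist_eq_norm]
      have h2 : dist z x ≤ (1 - s n) * r / 2 := hz
      have := mul_pos (hs1' n) hr
      linarith
    have h3 := hUc hx h1 (hs0 n).le (hs1' n).le (by ring)
    -- A point `z` near `x` is a convex combination of the point of `U` that the homothety sends to
    -- `x` and a point of the ball around `x₀`.
    have e : s n • ((s n)⁻¹ • x + (1 - (s n)⁻¹) • x₀) + (1 - s n) • (x₀ + (1 - s n)⁻¹ • (z - x))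
        = z := by
      rw [smul_add, smul_add, smul_smul, smul_smul, smul_smul, mul_inv_cancel₀ (hs0 n).ne',
        mul_inv_cancel₀ (hs1' n).ne', mul_sub, mul_inv_cancel₀ (hs0 n).ne']
      module
    rwa [e] at h3
  have hKU : ∀ n, K n ⊆ U := fun n x hx => hKball n x hx
    (Metric.mem_closedBall_self (ρ n).rOut_pos.le)
  have hev : ∀ x ∈ U, ∀ᶠ n in atTop, x ∈ K n := fun x hx => by
    have h1 : Tendsto (fun n => (s n)⁻¹ • x + (1 - (s n)⁻¹) • x₀) atTop
        (𝓝 ((1 : ℝ)⁻¹ • x + (1 - (1 : ℝ)⁻¹) • x₀)) := by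
      have := hlims.inv₀ one_ne_zero
      exact (this.smul_const x).add ((this.const_sub 1).smul_const x₀)
    have h2 : (1 : ℝ)⁻¹ • x + (1 - (1 : ℝ)⁻¹) • x₀ = x := by simp
    rw [h2] at h1
    exact h1.eventually (hU.mem_nhds hx)
  set v : ℕ → E d → ℝ := fun n => mollify (ρ n) U u with hv
  have hvs : ∀ n, ContDiff ℝ ∞ (v n) := fun n => contDiff_mollify _ hU.measurableSet hu
  have hvlim : ∀ᵐ x ∂volume.restrict U, Tendsto (fun n => v n x) atTop (𝓝 (u x)) := by
    have hr0 : Tendsto (fun n => (ρ n).rOut) atTop (𝓝 0) := by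
      have := (hlim0.mul_const r).div_const 2
      simpa using this
    have := ContDiffBump.ae_convolution_tendsto_right_of_locallyIntegrable (K := 2) hr0
      (Eventually.of_forall fun n => by simp only [hρ]; linarith)
      (hu.integrable_indicator hU.measurableSet).locallyIntegrable
    filter_upwards [ae_restrict_of_ae this, ae_restrict_mem hU.measurableSet] with x hx hxU
    rw [indicator_of_mem hxU] at hx
    refine hx.congr fun n => ?_
    rw [hv]
    simp only [mollify]
    rw [convolution_flip]
  set C := ENNReal.ofReal (δ ^ 2) * (2 ^ d * volume U * ∑ i, ∫⁻ x in U, ‖G i x‖ₑ ^ 2) with hC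
  have hbound : ∀ n, ∫⁻ x in K n, ∫⁻ y in K n, ‖v n x - v n y‖ₑ ^ 2 ≤ C := fun n => by
    refine (lintegral_enorm_sub_sq_le (hKc n) (hKo n).measurableSet
      (fun x hx y hy => hδ x (hKU n hx) y (hKU n hy)) (hvs n)).trans ?_
    have h1 : ∫⁻ x in K n, ENNReal.ofReal (gradSq (v n) x) ≤ ∑ i, ∫⁻ x in U, ‖G i x‖ₑ ^ 2 := by
      have : ∀ x, ENNReal.ofReal (gradSq (v n) x)
          = ∑ i, ENNReal.ofReal (pderiv (v n) i x ^ 2) := fun x =>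
        ENNReal.ofReal_sum_of_nonneg fun i _ => sq_nonneg _
      simp only [this]
      have m1 : ∀ i, Measurable fun x => ENNReal.ofReal (pderiv (v n) i x ^ 2) := fun i =>
        ((continuous_pderiv (hvs n) i).measurable.pow_const 2).ennreal_ofReal
      rw [lintegral_finsetSum _ fun i _ => m1 i]
      exact Finset.sum_le_sum fun i _ => lintegral_pderiv_mollify_le (ρ n) hU.measurableSet
        (hKo n).measurableSet hu hG hGm (hKball n) i
    have h2 : volume (K n) ≤ volume U := measure_mono (hKU n)
    rw [hC]
    gcongr
  -- Extension by zero to the fixed set `U × U`, so that Fatou's lemma replaces any convergence of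
  -- gradients.
  set F : ℕ → E d → E d → ℝ≥0∞ := fun n x y =>
    (K n ×ˢ K n).indicator (fun q : E d × E d => ‖v n q.1 - v n q.2‖ₑ ^ 2) (x, y) with hF
  have hFm : ∀ n, Measurable (Function.uncurry (F n)) := fun n => by
    have h1 : Measurable fun q : E d × E d => ‖v n q.1 - v n q.2‖ₑ ^ 2 :=
      ((((hvs n).continuous.comp continuous_fst).sub
        ((hvs n).continuous.comp continuous_snd)).enorm.measurable).pow_const 2
    exact h1.indicator ((hKo n).measurableSet.prod (hKo n).measurableSet)
  have hFle : ∀ n, ∫⁻ x in U, ∫⁻ y in U, F n x y ≤ C := fun n => by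
    refine le_trans ?_ (hbound n)
    rw [← lintegral_indicator (hKo n).measurableSet]
    refine (setLIntegral_le_lintegral _ _).trans (lintegral_mono fun x => ?_)
    refine (setLIntegral_le_lintegral _ _).trans ?_
    by_cases hx : x ∈ K n
    · rw [indicator_of_mem hx, ← lintegral_indicator (hKo n).measurableSet]
      refine lintegral_mono fun y => le_of_eq ?_
      by_cases hy : y ∈ K n <;> simp [hF, hx, hy]
    · simp [hF, hx]
  have hpt : ∀ᵐ x ∂volume.restrict U, ∀ᵐ y ∂volume.restrict U,
      ‖u x - u y‖ₑ ^ 2 ≤ liminf (fun n => F n x y) atTop := by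
    filter_upwards [hvlim, ae_restrict_mem hU.measurableSet] with x hx hxU
    filter_upwards [hvlim, ae_restrict_mem hU.measurableSet] with y hy hyU
    have h1 : Tendsto (fun n => ‖v n x - v n y‖ₑ ^ 2) atTop (𝓝 (‖u x - u y‖ₑ ^ 2)) :=
      (ENNReal.continuous_pow 2).continuousAt.tendsto.comp (hx.sub hy).enorm
    have h2 : Tendsto (fun n => F n x y) atTop (𝓝 (‖u x - u y‖ₑ ^ 2)) := by
      refine h1.congr' ?_
      filter_upwards [hev x hxU, hev y hyU] with n hxn hyn
      simp [hF, hxn, hyn]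
    exact h2.liminf_eq.ge
  calc ∫⁻ x in U, ∫⁻ y in U, ‖u x - u y‖ₑ ^ 2
      ≤ ∫⁻ x in U, ∫⁻ y in U, liminf (fun n => F n x y) atTop :=
        lintegral_mono_ae (hpt.mono fun x hx => lintegral_mono_ae hx)
    _ ≤ ∫⁻ x in U, liminf (fun n => ∫⁻ y in U, F n x y) atTop :=
        lintegral_mono fun x => lintegral_liminf_le fun n => (hFm n).comp measurable_prodMk_left
    _ ≤ liminf (fun n => ∫⁻ x in U, ∫⁻ y in U, F n x y) atTop :=
        lintegral_liminf_le fun n => (hFm n).lintegral_prod_right'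
    _ ≤ C := liminf_le_of_frequently_le' (Frequently.of_forall hFle)

/-- A Poincaré inequality for functions with vanishing integral on a subset. -/
theorem HasWeakGradientOn.lintegral_sq_le {U B : Set (E d)} (hU : IsOpen U) (hUc : Convex ℝ U)
    (hBU : B ⊆ U) {δ : ℝ} (hδ : ∀ x ∈ U, ∀ y ∈ U, ‖x - y‖ ≤ δ) {u : E d → ℝ}
    {G : Fin d → E d → ℝ} (hG : HasWeakGradientOn U u G) (hu : IntegrableOn u U)
    (hGm : ∀ i, AEMeasurable (G i) (volume.restrict U)) (hB0 : volume B ≠ 0)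
    (hB1 : volume B ≠ ⊤) (huB : ∫ x in B, u x = 0) :
    ∫⁻ x in U, ‖u x‖ₑ ^ 2
      ≤ (volume U / volume B) * (ENNReal.ofReal (δ ^ 2) * 2 ^ d)
        * ∑ i, ∫⁻ x in U, ‖G i x‖ₑ ^ 2 := by
  have huB' : IntegrableOn u B := hu.mono_set hBU
  -- Since `u` has zero mean on `B`, averaging `u x - u y` over `y` in `B` returns `u x`; then
  -- Cauchy–Schwarz on `B`.
  have hpt : ∀ x, volume B * ‖u x‖ₑ ^ 2 ≤ ∫⁻ y in B, ‖u x - u y‖ₑ ^ 2 := fun x => by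
    have h1 : ∫ y in B, (u x - u y) = volume.real B * u x := by
      have hc : IntegrableOn (fun _ : E d => u x) B := integrableOn_const hB1
      rw [integral_sub hc huB', huB, sub_zero, setIntegral_const, smul_eq_mul]
    have h2 : (volume B * ‖u x‖ₑ) ^ 2 ≤ volume B * ∫⁻ y in B, ‖u x - u y‖ₑ ^ 2 := by
      have h3 : volume B * ‖u x‖ₑ = ‖∫ y in B, (u x - u y)‖ₑ := by
        rw [h1, enorm_mul, Real.enorm_eq_ofReal measureReal_nonneg, measureReal_def,
          ENNReal.ofReal_toReal hB1]
      rw [h3]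
      refine le_trans (pow_le_pow_left' (enorm_integral_le_lintegral_enorm _) 2) ?_
      have := sq_lintegral_le (volume.restrict B) (f := fun y => ‖u x - u y‖ₑ)
        (aemeasurable_const.sub huB'.aestronglyMeasurable.aemeasurable).enorm
      rwa [Measure.restrict_apply_univ] at this
    have h4 : volume B * (volume B * ‖u x‖ₑ ^ 2) ≤ volume B * ∫⁻ y in B, ‖u x - u y‖ₑ ^ 2 := by
      refine le_trans (le_of_eq ?_) h2
      ring
    exact (ENNReal.mul_le_mul_iff_right hB0 hB1).1 h4
  have hmain : volume B * ∫⁻ x in U, ‖u x‖ₑ ^ 2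
      ≤ ENNReal.ofReal (δ ^ 2) * (2 ^ d * volume U * ∑ i, ∫⁻ x in U, ‖G i x‖ₑ ^ 2) := by
    refine le_trans ?_ (hG.lintegral_sub_sq_le hU hUc hδ hu hGm)
    rw [← lintegral_const_mul' _ _ hB1]
    refine lintegral_mono fun x => (hpt x).trans ?_
    exact lintegral_mono_set hBU
  calc ∫⁻ x in U, ‖u x‖ₑ ^ 2 = (volume B)⁻¹ * (volume B * ∫⁻ x in U, ‖u x‖ₑ ^ 2) := by
        rw [← mul_assoc, ENNReal.inv_mul_cancel hB0 hB1, one_mul]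
    _ ≤ (volume B)⁻¹
        * (ENNReal.ofReal (δ ^ 2) * (2 ^ d * volume U * ∑ i, ∫⁻ x in U, ‖G i x‖ₑ ^ 2)) := by
        gcongr
    _ = _ := by
        rw [div_eq_mul_inv]
        ring

end Poincare

/-! ### Poincaré inequality with a constant of order M⁻² -/

section CellPoincare

variable {d : ℕ} {D : Domain d} {bc : BoundaryCondition}

open scoped ENNReal

theorem ofReal_norm_sq_eq (u : H D) :
    ENNReal.ofReal (‖u‖ ^ 2) = ∫⁻ x in D.region, ‖u x‖ₑ ^ 2 := by
  have h1 : ‖u‖ₑ = eLpNorm u 2 (volume.restrict D.region) := Lp.enorm_def u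
  have h2 : eLpNorm u 2 (volume.restrict D.region) ^ 2 = ∫⁻ x in D.region, ‖u x‖ₑ ^ 2 := by
    have := eLpNorm_nnreal_pow_eq_lintegral (f := u) (μ := volume.restrict D.region)
      (p := 2) (by norm_num)
    have e : ((2 : NNReal) : ℝ) = (2 : ℕ) := by norm_num
    simp only [e, ENNReal.rpow_natCast] at this
    exact_mod_cast this
  rw [ENNReal.ofReal_pow (norm_nonneg _), ofReal_norm, h1, h2]

theorem V.norm_grad_sq (v : V D bc) :
    ‖V.grad D bc v‖ ^ 2 = ∑ i, ‖V.grad D bc v i‖ ^ 2 :=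
  PiLp.norm_sq_eq_of_L2 _ _

theorem V.norm_grad_le (v : V D bc) : ‖V.grad D bc v‖ ≤ ‖v‖ := by
  have := V.norm_sq_eq v
  exact le_of_sq_le_sq (by nlinarith [sq_nonneg ‖V.toH D bc v‖]) (norm_nonneg _)

theorem V.hasWeakGradientOn (hD : D.Admissible bc) (v : V D bc) {U : Set (E d)}
    (hU : U ⊆ D.region) :
    HasWeakGradientOn U (V.toH D bc v) fun i => V.grad D bc v i := by
  intro φ h1 h2 h3 i
  have := V.isWeakGradient hD v h1 h2 (h3.trans hU) i
  have e1 : ∀ S : Set (E d), tsupport φ ⊆ S →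
      ∫ x in S, V.toH D bc v x * pderiv φ i x = ∫ x, V.toH D bc v x * pderiv φ i x := fun S hS =>
    setIntegral_eq_integral_of_forall_compl_eq_zero fun x hx => by
      rw [pderiv_eq_zero_of_notMem_tsupport (fun h => hx (hS h)), mul_zero]
  have e2 : ∀ S : Set (E d), tsupport φ ⊆ S →
      ∫ x in S, V.grad D bc v i x * φ x = ∫ x, V.grad D bc v i x * φ x := fun S hS =>
    setIntegral_eq_integral_of_forall_compl_eq_zero fun x hx => by
      rw [image_eq_zero_of_notMem_tsupport (fun h => hx (hS h)), mul_zero]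
  rw [e1 _ (h3.trans hU), e2 _ (h3.trans hU)] at this
  rw [e1 _ h3, e2 _ h3]
  exact this

/-- The integral over `Ω` is the sum of the integrals over the cells. -/
theorem Domain.lintegral_region_eq_sum (hD : D.Admissible bc) {M : ℕ} (hM : 0 < M)
    (f : E d → ℝ≥0∞) :
    ∫⁻ x in D.region, f x = ∑ k : D.Cell M, ∫⁻ x in D.cell M k, f x := by
  obtain ⟨m, hMm, hcard, hS⟩ := D.exists_ratio hD hM
  have hM0 : (0 : ℝ) < M := by exact_mod_cast hM
  have hm : 0 < m := by linarith
  have hmeas : ∀ k : D.Cell M, MeasurableSet (D.cell M k) := fun k =>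
    (D.continuous_unscale M k).measurable D.measurableSet_region
  have hdisj : Pairwise (Function.onFun Disjoint (D.cell M)) := fun k k' hkk' =>
    Set.disjoint_left.2 fun x hx hx' => hkk' (Domain.cell_index_eq hD hx hx')
  have hvol : ∀ k : D.Cell M,
      volume (D.cell M k) = ENNReal.ofReal (m ^ d)⁻¹ * volume D.region := fun k => by
    obtain ⟨r, b, hr, h⟩ := hS k
    have hr0 : r ≠ 0 := by
      rintro rfl
      simp at hr
      linarith
    rw [← hr, ← volume_preimage_affine hr0 b]
    simp only [Domain.cell, h]
  -- Counting volumes shows that the disjoint cells exhaust the domain up to a null set, with no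
  -- geometric covering argument.
  have htot : volume (⋃ k, D.cell M k) = volume D.region := by
    rw [measure_iUnion hdisj hmeas, tsum_fintype]
    simp only [hvol, Finset.sum_const, Finset.card_univ, nsmul_eq_mul]
    rw [← mul_assoc, ← ENNReal.ofReal_natCast, hcard, ← ENNReal.ofReal_mul (by positivity),
      mul_inv_cancel₀ (by positivity), ENNReal.ofReal_one, one_mul]
  have hsub : (⋃ k, D.cell M k) ⊆ D.region := iUnion_subset fun k => D.cell_subset hD k
  have hae : (⋃ k, D.cell M k : Set (E d)) =ᵐ[volume] D.region :=
    ae_eq_of_subset_of_measure_ge hsub htot.ge (MeasurableSet.iUnion hmeas).nullMeasurableSet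
      D.isBounded_region.measure_lt_top.ne
  rw [← setLIntegral_congr hae, lintegral_iUnion hmeas hdisj, tsum_fintype]

/-- The Poincaré inequality, with a constant of order `M⁻²`, for the elements of `V` that have
vanishing mean on a rescaled copy of `ω` in each cell. -/
theorem exists_poincare (hD : D.Admissible bc) {l : Fin d → ℝ} (hl : ∀ n, 0 < l n) {c : E d}
    (hc : {x | x - c ∈ omega l} ⊆ D.region) :
    ∃ C : ℝ, 0 ≤ C ∧ ∀ M : ℕ, 0 < M → ∀ v : V D bc,
      (∀ k, inner ℝ ((memLp_actuator D l c M k).toLp _) (V.toH D bc v) = 0) →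
      ‖V.toH D bc v‖ ^ 2 ≤ C / (M : ℝ) ^ 2 * ‖V.grad D bc v‖ ^ 2 := by
  obtain ⟨δ, hδ⟩ := Metric.isBounded_iff.1 D.isBounded_region
  set W : Set (E d) := {x | x - c ∈ omega l} with hW
  have hWo : IsOpen W := (isOpen_omega l).preimage (f := fun x : E d => x - c) (by fun_prop)
  have hWne : W.Nonempty := ⟨c, fun n => by simp [hl n]⟩
  have hW0 : volume W ≠ 0 := (hWo.measure_pos volume hWne).ne'
  have hWt : volume W ≠ ⊤ := ((measure_mono hc).trans_lt D.isBounded_region.measure_lt_top).ne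
  set Q : ℝ≥0∞ := volume D.region / volume W with hQ
  have hQt : Q ≠ ⊤ := ENNReal.div_ne_top D.isBounded_region.measure_lt_top.ne hW0
  refine ⟨Q.toReal * (δ ^ 2 * 2 ^ d), by positivity, fun M hM v hv => ?_⟩
  obtain ⟨m, hMm, hcard, hS⟩ := D.exists_ratio hD hM
  have hM0 : (0 : ℝ) < M := by exact_mod_cast hM
  have hm : 0 < m := by linarith
  set u := V.toH D bc v with hu
  set G := fun i => V.grad D bc v i with hG
  have hcell : ∀ k : D.Cell M, ∫⁻ x in D.cell M k, ‖u x‖ₑ ^ 2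
      ≤ Q * (ENNReal.ofReal ((δ / m) ^ 2) * 2 ^ d) * ∑ i, ∫⁻ x in D.cell M k, ‖G i x‖ₑ ^ 2 := by
    intro k
    obtain ⟨r, b, hr, h⟩ := hS k
    have hr0 : r ≠ 0 := by
      rintro rfl
      simp at hr
      linarith
    have hsub := D.cell_subset hD k
    have hcell : D.cell M k = {x | r • x + b ∈ D.region} := by simp only [Domain.cell, h]
    have hopen : IsOpen (D.cell M k) := D.isOpen_region.preimage (D.continuous_unscale M k)
    have hconv : Convex ℝ (D.cell M k) := by
      rw [hcell]
      intro x hx y hy p q hp hq hpq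
      have := D.convex_region hx hy hp hq hpq
      have e : p • (r • x + b) + q • (r • y + b) = r • (p • x + q • y) + b := by
        obtain rfl : q = 1 - p := by linarith
        module
      rw [e] at this
      exact this
    have hdiam : ∀ x ∈ D.cell M k, ∀ y ∈ D.cell M k, ‖x - y‖ ≤ δ / m := fun x hx y hy => by
      rw [hcell] at hx hy
      have := hδ hx hy
      rw [dist_eq_norm, add_sub_add_right_eq_sub, ← smul_sub, norm_smul, Real.norm_eq_abs, hr]
        at this
      rw [le_div_iff₀ hm]
      linarith
    set B : Set (E d) := {x | D.unscale M k x - c ∈ omega l} with hB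
    have hBW : B = {x | r • x + b ∈ W} := by simp only [hB, hW, h, mem_ofPred_eq]
    have hBU : B ⊆ D.cell M k := fun x hx => hc hx
    have hBm : MeasurableSet B :=
      ((D.continuous_unscale M k).measurable.sub_const c) (measurableSet_omega l)
    have hvB : volume B = ENNReal.ofReal (|r| ^ d)⁻¹ * volume W := by
      rw [hBW, volume_preimage_affine hr0]
    have hvU : volume (D.cell M k) = ENNReal.ofReal (|r| ^ d)⁻¹ * volume D.region := by
      rw [hcell, volume_preimage_affine hr0]
    have hf0 : ENNReal.ofReal (|r| ^ d)⁻¹ ≠ 0 := by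
      rw [hr]
      exact (ENNReal.ofReal_pos.2 (by positivity)).ne'
    -- Both volumes scale alike, so this ratio depends neither on the cell nor on `M`; the gain
    -- comes only from the diameter `δ / m`.
    have hratio : volume (D.cell M k) / volume B = Q := by
      rw [hvB, hvU, hQ, ENNReal.mul_div_mul_left _ _ hf0 ENNReal.ofReal_ne_top]
    have huB : ∫ x in B, u x = 0 := by
      have := hv k
      rw [inner_toLp_left] at this
      rw [← this, ← inter_eq_right.2 (hBU.trans hsub), ← setIntegral_indicator hBm]
      refine integral_congr_ae (Eventually.of_forall fun x => ?_)
      by_cases hx : D.unscale M k x - c ∈ omega l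
      · simp only [indicator_of_mem hx, indicator_of_mem (show x ∈ B from hx), mul_one]
      · simp only [indicator_of_notMem hx, indicator_of_notMem (show x ∉ B from hx), mul_zero]
    have hint : IntegrableOn u D.region := (Lp.memLp u).integrable (by norm_num)
    have := (V.hasWeakGradientOn hD v hsub).lintegral_sq_le hopen hconv hBU hdiam
      (hint.mono_set hsub) (fun i => (Lp.aestronglyMeasurable (G i)).aemeasurable.mono_measure
        (Measure.restrict_mono hsub le_rfl))
      (by rw [hvB]; exact mul_ne_zero hf0 hW0)
      (by rw [hvB]; exact ENNReal.mul_ne_top ENNReal.ofReal_ne_top hWt) huB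
    rw [hratio] at this
    exact this
  have hfin : ENNReal.ofReal (‖u‖ ^ 2)
      ≤ ENNReal.ofReal (Q.toReal * ((δ / m) ^ 2 * 2 ^ d) * ‖V.grad D bc v‖ ^ 2) := by
    rw [ofReal_norm_sq_eq, Domain.lintegral_region_eq_sum hD hM, V.norm_grad_sq,
      ENNReal.ofReal_mul (by positivity), ENNReal.ofReal_mul (by positivity),
      ENNReal.ofReal_mul (by positivity), ENNReal.ofReal_toReal hQt,
      ENNReal.ofReal_sum_of_nonneg fun i _ => sq_nonneg _]
    simp only [ofReal_norm_sq_eq, Domain.lintegral_region_eq_sum hD hM]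
    rw [Finset.sum_comm, Finset.mul_sum, ENNReal.ofReal_pow two_pos.le, ENNReal.ofReal_ofNat]
    exact Finset.sum_le_sum fun k _ => hcell k
  have hfin' := (ENNReal.ofReal_le_ofReal_iff (by positivity)).1 hfin
  refine hfin'.trans ?_
  gcongr ?_ * _
  rw [div_pow, mul_div_assoc, mul_div_right_comm]
  gcongr

end CellPoincare

/-! ### Oblique projections, dissipativity and coercivity -/

section Projections

variable {d : ℕ} {D : Domain d} {bc : BoundaryCondition}
variable {X : Type*} [NormedAddCommGroup X] [NormedSpace ℝ X] {ι : Type*} [Fintype ι]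

/-- The mixed Gram matrix is diagonal and invertible, so the projection is an explicit sum. -/
theorem exists_obliqueProj {e : X →L[ℝ] H D} {Φ Φ' : ι → H D} {γ : ι → ℝ} (hγ : ∀ i, γ i ≠ 0)
    (hbi : ∀ i, inner ℝ (Φ i) (Φ' i) = γ i) (hbi' : ∀ i j, i ≠ j → inner ℝ (Φ i) (Φ' j) = 0)
    {χ : ι → X} (hχ : ∀ i, e (χ i) = Φ' i) (w : H D) :
    ∃ p : X, e p ∈ Submodule.span ℝ (range Φ') ∧ w - e p ∈ (Submodule.span ℝ (range Φ))ᗮ := by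
  refine ⟨∑ i, (inner ℝ (Φ i) w / γ i) • χ i, ?_, ?_⟩
  · rw [map_sum]
    refine Submodule.sum_mem _ fun i _ => ?_
    rw [map_smul, hχ]
    exact Submodule.smul_mem _ _ (Submodule.subset_span ⟨i, rfl⟩)
  · rw [Submodule.mem_orthogonal]
    intro u hu
    induction hu using Submodule.span_induction with
    | mem u hu =>
      obtain ⟨j, rfl⟩ := hu
      rw [inner_sub_right, map_sum, inner_sum, Finset.sum_eq_single j]
      · rw [map_smul, hχ, real_inner_smul_right, hbi, div_mul_cancel₀ _ (hγ j), sub_self]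
      · intro i _ hij
        rw [map_smul, hχ, real_inner_smul_right, hbi' j i hij.symm, mul_zero]
      · simp
    | zero => simp
    | add u v _ _ hu hv => rw [inner_add_left, hu, hv, add_zero]
    | smul c u _ hu => rw [real_inner_smul_left, hu, mul_zero]

theorem exists_obliqueProjDual {e : X →L[ℝ] H D} (he : Function.Injective e) {Φ Φ' : ι → H D}
    {γ : ι → ℝ} (hγ : ∀ i, γ i ≠ 0)
    (hbi : ∀ i, inner ℝ (Φ i) (Φ' i) = γ i) (hbi' : ∀ i j, i ≠ j → inner ℝ (Φ i) (Φ' j) = 0)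
    {χ : ι → X} (hχ : ∀ i, e (χ i) = Φ' i) (ξ : StrongDual ℝ X) :
    ∃ u : H D, u ∈ Submodule.span ℝ (range Φ) ∧
      ∀ w : X, e w ∈ Submodule.span ℝ (range Φ') → inner ℝ u (e w) = ξ w := by
  refine ⟨∑ i, (ξ (χ i) / γ i) • Φ i, Submodule.sum_mem _ fun i _ =>
    Submodule.smul_mem _ _ (Submodule.subset_span ⟨i, rfl⟩), fun w hw => ?_⟩
  obtain ⟨α, hα⟩ := (Submodule.mem_span_range_iff_exists_fun ℝ).1 hw
  have hw' : w = ∑ j, α j • χ j := he (by rw [← hα, map_sum]; simp [hχ])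
  rw [← hα, hw', map_sum, sum_inner]
  refine Finset.sum_congr rfl fun i _ => ?_
  rw [real_inner_smul_left, inner_sum, Finset.sum_eq_single i, real_inner_smul_right, hbi, map_smul,
    smul_eq_mul]
  · have := hγ i
    field_simp
  · intro j _ hij
    rw [real_inner_smul_right, hbi' i j hij.symm, mul_zero]
  · simp

/-- The feedback input is dissipative. -/
theorem exists_inner_feedbackInput {e : X →L[ℝ] H D} (he : Function.Injective e) {Φ Φ' : ι → H D}
    {γ : ι → ℝ} (hγ : ∀ i, γ i ≠ 0)
    (hbi : ∀ i, inner ℝ (Φ i) (Φ' i) = γ i) (hbi' : ∀ i j, i ≠ j → inner ℝ (Φ i) (Φ' j) = 0)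
    {χ : ι → X} (hχ : ∀ i, e (χ i) = Φ' i) (B : X → StrongDual ℝ X) (lam : ℝ) (w : H D) :
    ∃ p : X, (∀ i, inner ℝ (Φ i) (w - e p) = 0) ∧
      inner ℝ (actuate Φ (feedbackInput e B Φ Φ' lam w)) w = -lam * B p p := by
  set F := Submodule.span ℝ (range Φ') with hF
  set G := Submodule.span ℝ (range Φ) with hG
  set p : X := obliqueProj e F Gᗮ w with hp
  have h1 : e p ∈ F ∧ w - e p ∈ Gᗮ :=
    Classical.epsilon_spec (exists_obliqueProj hγ hbi hbi' hχ w)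
  set u : H D := obliqueProjDual e G F (B p) with hu
  have h2 : u ∈ G ∧ ∀ z : X, e z ∈ F → inner ℝ u (e z) = B p z :=
    Classical.epsilon_spec (exists_obliqueProjDual he hγ hbi hbi' hχ (B p))
  have h3 : actuate Φ (feedbackInput e B Φ Φ' lam w) = (-lam) • u := by
    rw [feedbackInput, map_smul]
    congr 1
    refine Function.invFun_eq (f := actuate Φ) ?_
    have : u ∈ LinearMap.range (Fintype.linearCombination ℝ Φ) := by
      rw [Fintype.range_linearCombination]; exact h2.1
    exact this
  refine ⟨p, fun i => ?_, ?_⟩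
  · exact (Submodule.mem_orthogonal _ _).1 h1.2 _ (Submodule.subset_span ⟨i, rfl⟩)
  -- The feedback lies in the span of the actuators, to which `w - p` is orthogonal. It therefore
  -- sees only `p`, and on the auxiliary span it acts as `B p`.
  · have h4 : inner ℝ u (w - e p) = 0 := (Submodule.mem_orthogonal _ _).1 h1.2 _ h2.1
    rw [inner_sub_right, h2.2 p h1.1] at h4
    rw [h3, real_inner_smul_left]
    congr 1
    linarith

theorem bump_pos {l : Fin d → ℝ} {z : E d} (hz : z ∈ omega l) : 0 < bump l z := by
  rw [bump, indicator_of_mem hz]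
  exact sineProduct_pos hz

theorem bump_of_notMem {l : Fin d → ℝ} {z : E d} (hz : z ∉ omega l) : bump l z = 0 := by
  rw [bump, indicator_of_notMem hz]

theorem inner_actuator_bump_pow_eq_zero {l : Fin d → ℝ} {c c' : E d} {M : ℕ} {k k' : D.Cell M}
    {m : ℕ} (hm : m ≠ 0)
    (h : ∀ x, D.unscale M k x - c ∈ omega l → D.unscale M k' x - c' ∉ omega l) :
    inner ℝ ((memLp_actuator D l c M k).toLp _) ((memLp_bump_pow D l c' M k' m).toLp _) = 0 := by
  rw [inner_toLp_left]
  refine integral_eq_zero_of_ae ?_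
  filter_upwards [(memLp_bump_pow D l c' M k' m).coeFn_toLp] with x hx
  rw [hx]
  by_cases hx' : D.unscale M k x - c ∈ omega l
  · simp [bump_of_notMem (h x hx'), hm]
  · simp [hx']

theorem inner_actuator_bump_pow_pos (hD : D.Admissible bc) {l : Fin d → ℝ} (hl : ∀ n, 0 < l n)
    {c : E d} (hc : {x | x - c ∈ omega l} ⊆ D.region) {M : ℕ} (hM : 0 < M) (k : D.Cell M)
    (m : ℕ) :
    0 < inner ℝ ((memLp_actuator D l c M k).toLp _) ((memLp_bump_pow D l c M k m).toLp _) := by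
  rw [real_inner_comm, inner_toLp_left]
  have hae : ∫ x in D.region, ((memLp_actuator D l c M k).toLp _ : H D) x
        * bump l (D.unscale M k x - c) ^ m
      = ∫ x in D.region, (omega l).indicator (fun _ => (1 : ℝ)) (D.unscale M k x - c)
        * bump l (D.unscale M k x - c) ^ m := by
    refine integral_congr_ae ?_
    filter_upwards [(memLp_actuator D l c M k).coeFn_toLp] with x hx
    rw [hx]
  rw [hae]
  set B : Set (E d) := {x | D.unscale M k x - c ∈ omega l} with hB
  have hBo : IsOpen B :=
    (isOpen_omega l).preimage ((D.continuous_unscale M k).sub continuous_const)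
  have hBr : B ⊆ D.region := fun x hx => D.cell_subset hD k (hc hx)
  obtain ⟨_, hMm, -, hS⟩ := D.exists_ratio hD hM
  obtain ⟨r, b, hr, h⟩ := hS k
  have hM0 : (0 : ℝ) < M := by exact_mod_cast hM
  have hr0 : r ≠ 0 := by
    rintro rfl
    simp at hr
    linarith
  have hBne : B.Nonempty := by
    refine ⟨r⁻¹ • (c - b), fun n => ?_⟩
    rw [h, smul_smul, mul_inv_cancel₀ hr0, one_smul, sub_add_cancel, sub_self]
    simp [hl n]
  refine (integral_pos_iff_support_of_nonneg (fun x => ?_) ?_).2 ?_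
  · by_cases hx : D.unscale M k x - c ∈ omega l
    · simp only [indicator_of_mem hx, one_mul]
      exact pow_nonneg (bump_pos hx).le m
    · simp [hx]
  · exact (memLp_actuator D l c M k).integrable_mul (memLp_bump_pow D l c M k m)
  · refine lt_of_lt_of_le (hBo.measure_pos volume hBne) ?_
    rw [← Measure.restrict_eq_self volume hBr]
    refine measure_mono fun x hx => ?_
    have hx' : D.unscale M k x - c ∈ omega l := hx
    simp only [Function.mem_support, indicator_of_mem hx', one_mul]
    exact (pow_pos (bump_pos hx') m).ne'

theorem ActuatorData.exists_affine (a : ActuatorData D) (hD : D.Admissible bc) {M : ℕ} (hM : 0 < M)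
    {c : E d} (hc : {x | x - c ∈ omega a.l} ⊆ D.region) (k : D.Cell M) :
    ∃ (r : ℝ) (b : E d), (∀ x, D.unscale M k x - c = r • x + b) ∧
      {x | r • x + b ∈ omega a.l} ⊆ D.region := by
  obtain ⟨_, -, -, hS⟩ := D.exists_ratio hD hM
  obtain ⟨r, b, -, h⟩ := hS k
  have e : ∀ x, D.unscale M k x - c = r • x + (b - c) := fun x => by rw [h, add_sub_assoc]
  refine ⟨r, b - c, e, fun x hx => D.cell_subset hD k (hc ?_)⟩
  change D.unscale M k x - c ∈ omega a.l
  rw [e]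
  exact hx

theorem ActuatorData.exists_feedback₁ (a : ActuatorData D) (hD : D.Admissible bc) {M : ℕ}
    (hM : 0 < M) (lam : ℝ) (w : H D) :
    ∃ p : DA D bc, (∀ j, inner ℝ (a.Phi M j) (w - DA.toH D bc p) = 0) ∧
      inner ℝ (actuate (a.Phi M) (K₁ bc a M lam w)) w = -lam * ‖DA.A D bc p‖ ^ 2 := by
  have hχ : ∀ j, ∃ z : DA D bc, DA.toH D bc z = a.PhiAux M j := fun j => by
    obtain ⟨r, b, h1, h2⟩ := a.exists_affine hD hM (a.subset₁ j.2) j.1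
    exact exists_DA_bump a.l_pos h2 hD _ fun x => by rw [h1]
  have hoff : ∀ i j, i ≠ j → inner ℝ (a.Phi M i) (a.PhiAux M j) = 0 := fun i j hij => by
    refine inner_actuator_bump_pow_eq_zero two_ne_zero fun x hx hx' => ?_
    have h1 : i.1 = j.1 := Domain.cell_index_eq hD (a.subset₁ i.2 hx) (a.subset₁ j.2 hx')
    have h2 : i.2 ≠ j.2 := fun h => hij (Prod.ext h1 h)
    rw [← h1] at hx'
    exact Set.disjoint_left.1 (a.disjoint₁ _ _ h2) hx hx'
  choose χ hχ using hχ
  obtain ⟨p, hp, hp'⟩ := exists_inner_feedbackInput (e := DA.toH D bc) (DA.toH_injective hD)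
    (Φ := a.Phi M) (Φ' := a.PhiAux M) (fun j => (inner_actuator_bump_pow_pos hD a.l_pos
      (a.subset₁ j.2) hM j.1 2).ne') (fun _ => rfl) hoff hχ (DA.Asq D bc) lam w
  exact ⟨p, hp, hp'.trans (congrArg _ (real_inner_self_eq_norm_sq (DA.A D bc p)))⟩

theorem ActuatorData.exists_feedback₂ (a : ActuatorData D) (hD : D.Admissible bc) {M : ℕ}
    (hM : 0 < M) (lam : ℝ) (w : H D) :
    ∃ p : V D bc, (∀ k, inner ℝ (a.Psi M k) (w - V.toH D bc p) = 0) ∧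
      inner ℝ (actuate (a.Psi M) (K₂ bc a M lam w)) w = -lam * ‖p‖ ^ 2 := by
  have hχ : ∀ k, ∃ v : V D bc, V.toH D bc v = a.PsiAux M k := fun k => by
    obtain ⟨r, b, h1, h2⟩ := a.exists_affine hD hM a.subset₂ k
    exact exists_V_bump a.l_pos h2 bc _ fun x => by rw [h1]
  have hoff : ∀ i j, i ≠ j → inner ℝ (a.Psi M i) (a.PsiAux M j) = 0 := fun i j hij => by
    refine inner_actuator_bump_pow_eq_zero one_ne_zero fun x hx hx' => ?_
    exact hij (Domain.cell_index_eq hD (a.subset₂ hx) (a.subset₂ hx'))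
  choose χ hχ using hχ
  obtain ⟨p, hp, hp'⟩ := exists_inner_feedbackInput (e := V.toH D bc) (V.toH_injective hD)
    (Φ := a.Psi M) (Φ' := a.PsiAux M) (fun k => (inner_actuator_bump_pow_pos hD a.l_pos
      a.subset₂ hM k 1).ne') (fun _ => rfl) hoff hχ (V.A D bc) lam w
  exact ⟨p, hp, hp'.trans (congrArg _ (real_inner_self_eq_norm_sq p))⟩

/-- The remainder `θ = y - p` satisfies `‖θ‖² ≤ η‖∇θ‖² ≤ η‖Aθ‖‖θ‖`, hence `‖θ‖ ≤ η‖Aθ‖` with `η`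
small for large `M`. The factor of `‖Ap‖²` is independent of `M`, so the gain can be fixed without
reference to it. -/
theorem ActuatorData.exists_coercive₁ (a : ActuatorData D) (hD : D.Admissible bc) {Λ ν : ℝ}
    (hΛ : 0 ≤ Λ) (hν : 0 < ν) :
    ∃ N : ℕ, ∀ M, 0 < M → N ≤ M → ∀ y p : DA D bc,
      (∀ j, inner ℝ (a.Phi M j) (DA.toH D bc y - DA.toH D bc p) = 0) →
      Λ * ‖DA.toH D bc y‖ ^ 2
        ≤ ν * ‖DA.A D bc y‖ ^ 2 + (2 * Λ + ν) * ‖DA.A D bc p‖ ^ 2 := by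
  obtain ⟨C, hC, hP⟩ := exists_poincare hD (bc := bc) a.l_pos (a.subset₁ 0)
  -- Chosen so that `η ≤ 1` and `4Λη² ≤ ν`: two splittings `(a + b)² ≤ 2a² + 2b²` produce the factor
  -- 4.
  set η : ℝ := ν / (4 * Λ + ν + 4) with hη
  have hη0 : 0 < η := by positivity
  obtain ⟨N, hN⟩ := exists_nat_gt (C / η)
  refine ⟨N, fun M hM hNM y p h => ?_⟩
  have hM1 : (1 : ℝ) ≤ M := by exact_mod_cast hM
  have hCM : C / (M : ℝ) ^ 2 ≤ η := by
    have h1 : C / η < M := hN.trans_le (by exact_mod_cast hNM)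
    rw [div_lt_iff₀ hη0] at h1
    rw [div_le_iff₀ (by positivity)]
    nlinarith
  have hη1 : 4 * Λ * η ^ 2 ≤ ν := by
    have h1 : η * (4 * Λ + ν + 4) = ν := div_mul_cancel₀ _ (by positivity)
    have h2 : η ≤ 1 := by
      rw [hη, div_le_one (by positivity)]; linarith
    nlinarith [mul_nonneg hΛ hη0.le]
  set θ := y - p with hθ
  have hθH : DA.toH D bc θ = DA.toH D bc y - DA.toH D bc p := map_sub _ _ _
  have hθA : DA.A D bc θ = DA.A D bc y - DA.A D bc p := map_sub _ _ _
  have h1 := hP M hM (DA.toV D bc θ) fun k => by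
    rw [DA.toH_toV, hθH]; exact h (k, 0)
  rw [DA.toH_toV] at h1
  have h2 : ‖DA.toH D bc θ‖ ^ 2 ≤ η * (‖DA.A D bc θ‖ * ‖DA.toH D bc θ‖) := by
    have h3 := DA.norm_toV_sq_le θ
    have h4 := V.norm_grad_le (DA.toV D bc θ)
    have h5 : ‖V.grad D bc (DA.toV D bc θ)‖ ^ 2 ≤ ‖DA.toV D bc θ‖ ^ 2 := by gcongr
    calc _ ≤ _ := h1
      _ ≤ η * ‖V.grad D bc (DA.toV D bc θ)‖ ^ 2 := by gcongr
      _ ≤ _ := by gcongr; exact h5.trans h3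
  have h3 : ‖DA.toH D bc θ‖ ≤ η * ‖DA.A D bc θ‖ := by
    rcases (norm_nonneg (DA.toH D bc θ)).eq_or_lt with h0 | h0
    · rw [← h0]; positivity
    · by_contra! hc
      nlinarith
  have h4 : ‖DA.toH D bc θ‖ ^ 2 ≤ η ^ 2 * (2 * (‖DA.A D bc y‖ ^ 2 + ‖DA.A D bc p‖ ^ 2)) := by
    have h5 : ‖DA.A D bc θ‖ ≤ ‖DA.A D bc y‖ + ‖DA.A D bc p‖ := by
      rw [hθA]; exact norm_sub_le _ _
    have h6 : ‖DA.A D bc θ‖ ^ 2 ≤ 2 * (‖DA.A D bc y‖ ^ 2 + ‖DA.A D bc p‖ ^ 2) := by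
      nlinarith [norm_nonneg (DA.A D bc θ), sq_nonneg (‖DA.A D bc y‖ - ‖DA.A D bc p‖)]
    calc ‖DA.toH D bc θ‖ ^ 2 ≤ (η * ‖DA.A D bc θ‖) ^ 2 := by gcongr
      _ = η ^ 2 * ‖DA.A D bc θ‖ ^ 2 := by ring
      _ ≤ _ := by gcongr
  have h7 : ‖DA.toH D bc y‖ ≤ ‖DA.A D bc p‖ + ‖DA.toH D bc θ‖ := by
    have : DA.toH D bc y = DA.toH D bc p + DA.toH D bc θ := by rw [hθH]; abel
    rw [this]
    exact (norm_add_le _ _).trans (add_le_add_left (DA.norm_toH_le p) _)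
  have h8 : ‖DA.toH D bc y‖ ^ 2 ≤ 2 * ‖DA.A D bc p‖ ^ 2 + 2 * ‖DA.toH D bc θ‖ ^ 2 := by
    nlinarith [norm_nonneg (DA.toH D bc y), sq_nonneg (‖DA.A D bc p‖ - ‖DA.toH D bc θ‖)]
  have h9 := mul_le_mul_of_nonneg_left (h8.trans (add_le_add_right
    (mul_le_mul_of_nonneg_left h4 two_pos.le) _)) hΛ
  have h10 := mul_le_mul_of_nonneg_right hη1
    (add_nonneg (sq_nonneg ‖DA.A D bc y‖) (sq_nonneg ‖DA.A D bc p‖))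
  linarith

/-- The first-order analogue. Only half of `‖∇w‖²` is spent here; the other half pays for the
coupling with the first equation. -/
theorem ActuatorData.exists_coercive₂ (a : ActuatorData D) (hD : D.Admissible bc) {Λ : ℝ}
    (hΛ : 0 ≤ Λ) :
    ∃ N : ℕ, ∀ M, 0 < M → N ≤ M → ∀ w p : V D bc,
      (∀ k, inner ℝ (a.Psi M k) (V.toH D bc w - V.toH D bc p) = 0) →
      Λ * ‖V.toH D bc w‖ ^ 2
        ≤ 1 / 2 * ‖V.grad D bc w‖ ^ 2 + (2 * Λ + 1 / 2) * ‖p‖ ^ 2 := by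
  obtain ⟨C, hC, hP⟩ := exists_poincare hD (bc := bc) a.l_pos a.subset₂
  obtain ⟨N, hN⟩ := exists_nat_gt (8 * Λ * C)
  refine ⟨N, fun M hM hNM w p h => ?_⟩
  have hM1 : (1 : ℝ) ≤ M := by exact_mod_cast hM
  have hCM : 8 * Λ * (C / (M : ℝ) ^ 2) ≤ 1 := by
    have h1 : 8 * Λ * C < M := hN.trans_le (by exact_mod_cast hNM)
    rw [← mul_div_assoc, div_le_one (by positivity)]
    nlinarith
  have hθH : V.toH D bc (w - p) = V.toH D bc w - V.toH D bc p := map_sub _ _ _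
  have hθg : V.grad D bc (w - p) = V.grad D bc w - V.grad D bc p := map_sub _ _ _
  have h1 := hP M hM (w - p) fun k => by rw [hθH]; exact h k
  have h2 : ‖V.grad D bc (w - p)‖ ^ 2 ≤ 2 * (‖V.grad D bc w‖ ^ 2 + ‖p‖ ^ 2) := by
    have h5 : ‖V.grad D bc (w - p)‖ ≤ ‖V.grad D bc w‖ + ‖p‖ := by
      rw [hθg]; exact (norm_sub_le _ _).trans (add_le_add_right (V.norm_grad_le p) _)
    nlinarith [norm_nonneg (V.grad D bc (w - p)), sq_nonneg (‖V.grad D bc w‖ - ‖p‖)]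
  have h7 : ‖V.toH D bc w‖ ≤ ‖p‖ + ‖V.toH D bc (w - p)‖ := by
    have : V.toH D bc w = V.toH D bc p + V.toH D bc (w - p) := by rw [hθH]; abel
    rw [this]
    exact (norm_add_le _ _).trans (add_le_add_left (V.norm_toH_le p) _)
  have h8 : ‖V.toH D bc w‖ ^ 2 ≤ 2 * ‖p‖ ^ 2 + 2 * ‖V.toH D bc (w - p)‖ ^ 2 := by
    nlinarith [norm_nonneg (V.toH D bc w), sq_nonneg (‖p‖ - ‖V.toH D bc (w - p)‖)]
  have h3 : ‖V.toH D bc (w - p)‖ ^ 2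
      ≤ C / (M : ℝ) ^ 2 * (2 * (‖V.grad D bc w‖ ^ 2 + ‖p‖ ^ 2)) :=
    h1.trans (mul_le_mul_of_nonneg_left h2 (by positivity))
  have h9 := mul_le_mul_of_nonneg_left (h8.trans (add_le_add_right
    (mul_le_mul_of_nonneg_left h3 two_pos.le) _)) hΛ
  have h10 := mul_le_mul_of_nonneg_right hCM
    (add_nonneg (sq_nonneg ‖V.grad D bc w‖) (sq_nonneg ‖p‖))
  linarith

end Projections

/-! ### Young's inequality for the growth terms -/

section Growth

/-- The surplus power `ζ + η - 2` of `a` is bounded through `a ≤ ρ`. What is left has total degree 2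
and equals `(a²)^(1-θ) (b²)^θ` with `θ = η/2 < 1`, so weighted Young applies. -/
theorem exists_rpow_mul_rpow_le {ζ η ε ρ : ℝ} (hη : 0 ≤ η) (hη2 : η < 2)
    (hζη : 2 ≤ ζ + η) (hε : 0 < ε) :
    ∃ K, 0 ≤ K ∧ ∀ a b : ℝ, 0 ≤ a → a ≤ ρ → 0 ≤ b →
      a ^ ζ * b ^ η ≤ ε * b ^ 2 + K * a ^ 2 := by
  set R := (max ρ 1) ^ (ζ + η - 2) with hR
  have hR0 : 0 < R := Real.rpow_pos_of_pos (lt_max_of_lt_right one_pos) _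
  set θ := η / 2 with hθ
  have hθ0 : 0 ≤ θ := by positivity
  have hθ1 : 0 < 1 - θ := by rw [hθ]; linarith
  -- Determined by `s^(1-θ) ε^θ = R`, which makes the weighted geometric mean of `s a²` and `ε b²`
  -- exactly the quantity to bound.
  set s := (R * ε ^ (-θ)) ^ (1 / (1 - θ)) with hs
  have hs0 : 0 ≤ s := by positivity
  have hsθ : s ^ (1 - θ) = R * ε ^ (-θ) := by
    rw [hs, ← Real.rpow_mul (by positivity), one_div, inv_mul_cancel₀ hθ1.ne', Real.rpow_one]
  refine ⟨s, hs0, fun a b ha haρ hb => ?_⟩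
  rcases ha.eq_or_lt with rfl | ha
  · rw [Real.zero_rpow (by linarith), zero_mul]
    positivity
  have h1 : a ^ ζ ≤ R * a ^ (2 - η) := by
    have : a ^ ζ = a ^ (ζ + η - 2) * a ^ (2 - η) := by
      rw [← Real.rpow_add ha]; congr 1; ring
    rw [this]
    refine mul_le_mul_of_nonneg_right ?_ (Real.rpow_nonneg ha.le _)
    exact Real.rpow_le_rpow ha.le (haρ.trans (le_max_left _ _)) (by linarith)
  have h2 : (a ^ 2) ^ (1 - θ) = a ^ (2 - η) := by
    rw [← Real.rpow_natCast, ← Real.rpow_mul ha.le, hθ]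
    congr 1
    push_cast
    ring
  have h3 : (b ^ 2) ^ θ = b ^ η := by
    rw [← Real.rpow_natCast, ← Real.rpow_mul hb, hθ]
    congr 1
    push_cast
    ring
  have h4 := Real.geom_mean_le_arith_mean2_weighted hθ1.le hθ0
    (show 0 ≤ s * a ^ 2 by positivity) (show 0 ≤ ε * b ^ 2 by positivity) (by ring)
  rw [Real.mul_rpow hs0 (by positivity), Real.mul_rpow hε.le (by positivity), hsθ, h2, h3,
    Real.rpow_neg hε.le] at h4
  have h5 : R * (ε ^ θ)⁻¹ * a ^ (2 - η) * (ε ^ θ * b ^ η) = R * a ^ (2 - η) * b ^ η := by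
    have : ε ^ θ ≠ 0 := (Real.rpow_pos_of_pos hε θ).ne'
    field_simp
  rw [h5] at h4
  have h6 : a ^ ζ * b ^ η ≤ R * a ^ (2 - η) * b ^ η :=
    mul_le_mul_of_nonneg_right h1 (Real.rpow_nonneg hb _)
  have h7 : (1 - θ) * (s * a ^ 2) ≤ s * a ^ 2 :=
    mul_le_of_le_one_left (by positivity) (by linarith)
  have h8 : θ * (ε * b ^ 2) ≤ ε * b ^ 2 :=
    mul_le_of_le_one_left (by positivity) (by linarith)
  linarith

theorem exists_growth_le {n : ℕ} {ζ η : Fin n → ℝ}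
    (h : ∀ i, 0 ≤ ζ i ∧ 0 ≤ η i ∧ η i < 2 ∧ 2 ≤ ζ i + η i) {C : ℝ} (hC : 0 ≤ C) (ρ : ℝ) {ε : ℝ}
    (hε : 0 < ε) :
    ∃ K, 0 ≤ K ∧ ∀ a b : ℝ, 0 ≤ a → a ≤ ρ → 0 ≤ b →
      C * ∑ i, a ^ ζ i * b ^ η i ≤ ε * b ^ 2 + K * a ^ 2 := by
  -- The share of each of the `n` terms, all multiplied by `C`; the summand 1 keeps the quotient
  -- defined when `C n = 0`.
  have hε' : 0 < ε / (C * n + 1) := by positivity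
  choose K hK0 hK using fun i =>
    exists_rpow_mul_rpow_le (ρ := ρ) (h i).2.1 (h i).2.2.1 (h i).2.2.2 hε'
  refine ⟨C * ∑ i, K i, mul_nonneg hC (Finset.sum_nonneg fun i _ => hK0 i),
    fun a b ha haρ hb => ?_⟩
  have h1 : ∑ i, a ^ ζ i * b ^ η i ≤ ∑ i, (ε / (C * n + 1) * b ^ 2 + K i * a ^ 2) :=
    Finset.sum_le_sum fun i _ => hK i a b ha haρ hb
  rw [Finset.sum_add_distrib, Finset.sum_const, Finset.card_univ, Fintype.card_fin, nsmul_eq_mul,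
    ← Finset.sum_mul] at h1
  have h2 : C * n * (ε / (C * n + 1)) ≤ ε := by
    rw [mul_div_assoc', div_le_iff₀ (by positivity)]
    nlinarith
  have h3 := mul_le_mul_of_nonneg_right h2 (sq_nonneg b)
  have h4 := mul_le_mul_of_nonneg_left h1 hC
  nlinarith

end Growth

/-! ### Energy estimate for the difference of the trajectories -/

section Stabilization

variable {d : ℕ} {D : Domain d} {bc : BoundaryCondition}
variable {X : Type*} [NormedAddCommGroup X] [NormedSpace ℝ X]

theorem L2Loc.sub {Y : Type*} [NormedAddCommGroup Y] {F G : ℝ → Y} (hF : L2Loc F) (hG : L2Loc G) :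
    L2Loc fun t => F t - G t :=
  fun T hT => (hF T hT).sub (hG T hT)

theorem L2Loc.add {Y : Type*} [NormedAddCommGroup Y] {F G : ℝ → Y} (hF : L2Loc F) (hG : L2Loc G) :
    L2Loc fun t => F t + G t :=
  fun T hT => (hF T hT).add (hG T hT)

theorem L2Loc.clm_comp {Y : Type*} [NormedAddCommGroup Y] [NormedSpace ℝ Y] (L : X →L[ℝ] Y)
    {F : ℝ → X} (hF : L2Loc F) : L2Loc fun t => L (F t) :=
  fun T hT => L.comp_memLp' (hF T hT)

theorem L2Loc.integrableOn_apply {ξ : ℝ → StrongDual ℝ X} {Y : ℝ → X} (hξ : L2Loc ξ)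
    (hY : L2Loc Y) {T : ℝ} (hT : 0 < T) : IntegrableOn (fun τ => ξ τ (Y τ)) (Ioc 0 T) := by
  have := (ContinuousLinearMap.id ℝ (StrongDual ℝ X)).memLp_of_bilin 1 (hξ T hT) (hY T hT)
  exact memLp_one_iff_integrable.1 this

theorem L2Loc.intervalIntegrable_apply {ξ : ℝ → StrongDual ℝ X} {Y : ℝ → X} (hξ : L2Loc ξ)
    (hY : L2Loc Y) {s t : ℝ} (hs : 0 ≤ s) (hst : s ≤ t) :
    IntervalIntegrable (fun τ => ξ τ (Y τ)) volume s t := by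
  rw [intervalIntegrable_iff_integrableOn_Ioc_of_le hst]
  exact (hξ.integrableOn_apply hY (T := t + 1) (by linarith)).mono_set
    (Ioc_subset_Ioc hs (by linarith))

theorem IsTimeDeriv.sub {e : X →L[ℝ] H D} {y z : ℝ → H D} {ξ χ : ℝ → StrongDual ℝ X}
    (hy : IsTimeDeriv e y ξ) (hz : IsTimeDeriv e z χ) (hξ : L2Loc ξ) (hχ : L2Loc χ) :
    IsTimeDeriv e (fun t => y t - z t) fun t => ξ t - χ t := by
  intro φ s t hs hst
  have hc : L2Loc fun _ : ℝ => φ := fun T _ => memLp_const φ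
  have h1 := hy φ s t hs hst
  have h2 := hz φ s t hs hst
  simp only [sub_apply]
  rw [intervalIntegral.integral_sub (hξ.intervalIntegrable_apply hc hs hst)
    (hχ.intervalIntegrable_apply hc hs hst), ← h1, ← h2, inner_sub_left, inner_sub_left]
  ring

/-- Green's formula: `A₀` is `A` minus the identity, so the `L²` part of the inner product of `V`
cancels. The boundary conditions are encoded in the spaces. -/
theorem DA.inner_A₀ (z : DA D bc) (v : V D bc) :
    inner ℝ (V.toH D bc v) (DA.A₀ D bc z)
      = inner ℝ (V.grad D bc v) (V.grad D bc (DA.toV D bc z)) := by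
  have h1 := DA.inner_toV z v
  rw [V.inner_eq, DA.toH_toV] at h1
  have h2 : DA.A₀ D bc z = DA.A D bc z - DA.toH D bc z := rfl
  rw [h2, inner_sub_right, real_inner_comm (DA.A D bc z), ← h1,
    real_inner_comm (V.grad D bc v)]
  rw [real_inner_comm (DA.toH D bc z) (V.toH D bc v)]
  ring

theorem DA.norm_A_sq_le (z : DA D bc) :
    ‖DA.A D bc z‖ ^ 2 ≤ 2 * ‖DA.A₀ D bc z‖ ^ 2 + 2 * ‖DA.toH D bc z‖ ^ 2 := by
  have h1 : DA.A D bc z = DA.A₀ D bc z + DA.toH D bc z :=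
    (sub_add_cancel (DA.A D bc z) (DA.toH D bc z)).symm
  have h2 : ‖DA.A D bc z‖ ≤ ‖DA.A₀ D bc z‖ + ‖DA.toH D bc z‖ := by
    rw [h1]; exact norm_add_le _ _
  nlinarith [norm_nonneg (DA.A D bc z), sq_nonneg (‖DA.A₀ D bc z‖ - ‖DA.toH D bc z‖)]

theorem integral_mul_sub_eq {F G : E d → ℝ} (hF : MemLp F 2 (volume.restrict D.region))
    (hG : MemLp G 2 (volume.restrict D.region)) (c : ℝ) (u : H D) :
    (∫ x in D.region, (F x - c) * u x) - ∫ x in D.region, (G x - c) * u x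
      = ∫ x in D.region, (F x - G x) * u x := by
  have h1 : Integrable (fun x => (F x - c) * u x) (volume.restrict D.region) :=
    (hF.sub (memLp_const c)).integrable_mul (Lp.memLp u)
  have h2 : Integrable (fun x => (G x - c) * u x) (volume.restrict D.region) :=
    (hG.sub (memLp_const c)).integrable_mul (Lp.memLp u)
  rw [← integral_sub h1 h2]
  refine integral_congr_ae (Eventually.of_forall fun x => ?_)
  simp only
  ring

/-- The increment of the nonlinearity in the growth assumptions, at the difference of the two
trajectories. -/
theorem increment_ae_eq (f : ℝ → ℝ) {c r z : H D} (hz : z = c - r) :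
    (fun x => f (r x + z x) - f (r x)) =ᵐ[volume.restrict D.region] fun x => f (c x) - f (r x) := by
  filter_upwards [Lp.coeFn_sub c r] with x hx
  rw [hz, hx, Pi.sub_apply, add_sub_cancel]

/-- The two weak equations are subtracted and tested with the difference itself. The coupling is
moved onto gradients and expressed through the variable of the second equation, as the difference of
the second components is `w - ν₀ z`. -/
theorem weak_energy₁ {C₁ R₁ : DA D bc} {C₂ R₂ : V D bc} {c₁ r₁ c₂ r₂ q : H D}
    {ξ χ h : StrongDual ℝ (DA D bc)} {f g : ℝ → ℝ} {ν₀ ν₁ ν₂ : ℝ}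
    (hc₂ : V.toH D bc C₂ = c₂) (hr₂ : V.toH D bc R₂ = r₂)
    (hfc : MemLp (fun x => f (c₁ x)) 2 (volume.restrict D.region))
    (hfr : MemLp (fun x => f (r₁ x)) 2 (volume.restrict D.region))
    (hgc : MemLp (fun x => g (c₁ x)) 2 (volume.restrict D.region))
    (hgr : MemLp (fun x => g (r₁ x)) 2 (volume.restrict D.region))
    (hc : ∀ φ : DA D bc, ξ φ + ν₂ * inner ℝ (DA.A₀ D bc C₁) (DA.A₀ D bc φ)
      + (∫ x in D.region, (f (c₁ x) - f 0) * DA.A₀ D bc φ x) - ν₁ * inner ℝ c₂ (DA.A₀ D bc φ)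
      + (∫ x in D.region, g (c₁ x) * DA.toH D bc φ x) = h φ + inner ℝ q (DA.toH D bc φ))
    (hr : ∀ φ : DA D bc, χ φ + ν₂ * inner ℝ (DA.A₀ D bc R₁) (DA.A₀ D bc φ)
      + (∫ x in D.region, (f (r₁ x) - f 0) * DA.A₀ D bc φ x) - ν₁ * inner ℝ r₂ (DA.A₀ D bc φ)
      + (∫ x in D.region, g (r₁ x) * DA.toH D bc φ x) = h φ + inner ℝ (0 : H D) (DA.toH D bc φ)) :
    (ξ - χ) (C₁ - R₁) + ν₂ * ‖DA.A₀ D bc (C₁ - R₁)‖ ^ 2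
      + (∫ x in D.region, (f (c₁ x) - f (r₁ x)) * DA.A₀ D bc (C₁ - R₁) x)
      - ν₁ * (inner ℝ (V.grad D bc (DA.toV D bc (C₁ - R₁)))
            (V.grad D bc (C₂ - R₂ + ν₀ • DA.toV D bc (C₁ - R₁)))
          - ν₀ * ‖V.grad D bc (DA.toV D bc (C₁ - R₁))‖ ^ 2)
      + (∫ x in D.region, (g (c₁ x) - g (r₁ x)) * DA.toH D bc (C₁ - R₁) x)
      = inner ℝ q (DA.toH D bc (C₁ - R₁)) := by
  have h1 := hc (C₁ - R₁)
  have h2 := hr (C₁ - R₁)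
  set z := C₁ - R₁ with hz
  have a1 : inner ℝ (DA.A₀ D bc C₁) (DA.A₀ D bc z) - inner ℝ (DA.A₀ D bc R₁) (DA.A₀ D bc z)
      = ‖DA.A₀ D bc z‖ ^ 2 := by
    rw [← inner_sub_left, ← map_sub, ← hz, real_inner_self_eq_norm_sq]
  have a2 := integral_mul_sub_eq hfc hfr (f 0) (DA.A₀ D bc z)
  have a3 := integral_mul_sub_eq hgc hgr 0 (DA.toH D bc z)
  simp only [sub_zero] at a3
  have a4 : inner ℝ c₂ (DA.A₀ D bc z) - inner ℝ r₂ (DA.A₀ D bc z)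
      = inner ℝ (V.grad D bc (DA.toV D bc z))
          (V.grad D bc (C₂ - R₂ + ν₀ • DA.toV D bc z))
        - ν₀ * ‖V.grad D bc (DA.toV D bc z)‖ ^ 2 := by
    rw [← hc₂, ← hr₂, ← inner_sub_left, ← map_sub, DA.inner_A₀, map_add, map_smul, inner_add_right, inner_smul_right,
      real_inner_self_eq_norm_sq, real_inner_comm]
    ring
  rw [inner_zero_left] at h2
  rw [← a4, ← a1, ← a2, ← a3, sub_apply]
  linarith

theorem weak_energy₂ {v C R : V D bc} {q : H D} {ξ χ h : StrongDual ℝ (V D bc)} {ν : ℝ}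
    (hc : ∀ ψ : V D bc, ξ ψ + inner ℝ (V.grad D bc C) (V.grad D bc ψ)
      = h ψ + inner ℝ q (V.toH D bc ψ))
    (hr : ∀ ψ : V D bc, χ ψ + inner ℝ (V.grad D bc R) (V.grad D bc ψ)
      = h ψ + inner ℝ (0 : H D) (V.toH D bc ψ)) :
    (ξ - χ) (C - R + ν • v) + (‖V.grad D bc (C - R + ν • v)‖ ^ 2
        - ν * inner ℝ (V.grad D bc v) (V.grad D bc (C - R + ν • v)))
      = inner ℝ q (V.toH D bc (C - R + ν • v)) := by
  have h1 := hc (C - R + ν • v)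
  have h2 := hr (C - R + ν • v)
  set w := C - R + ν • v with hw
  have a1 : inner ℝ (V.grad D bc C) (V.grad D bc w) - inner ℝ (V.grad D bc R) (V.grad D bc w)
      = ‖V.grad D bc w‖ ^ 2 - ν * inner ℝ (V.grad D bc v) (V.grad D bc w) := by
    have e : V.grad D bc C - V.grad D bc R = V.grad D bc w - ν • V.grad D bc v := by
      rw [hw, map_add, map_sub, map_smul, add_sub_cancel_right]
    rw [← inner_sub_left, e, inner_sub_left, real_inner_self_eq_norm_sq, real_inner_smul_left]
  rw [inner_zero_left] at h2
  rw [← a1, sub_apply]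
  linarith

theorem neg_integral_increment_le {f : ℝ → ℝ} {c r : H D} {z : DA D bc} {B : ℝ}
    (hz : DA.toH D bc z = c - r)
    (hc : MemLp (fun x => f (c x)) 2 (volume.restrict D.region))
    (hr : MemLp (fun x => f (r x)) 2 (volume.restrict D.region)) {u : H D}
    (h : MemLp (fun x => f (r x + DA.toH D bc z x) - f (r x)) 2 (volume.restrict D.region) →
      -(∫ x in D.region, (f (r x + DA.toH D bc z x) - f (r x)) * u x) ≤ B) :
    -(∫ x in D.region, (f (c x) - f (r x)) * u x) ≤ B := by
  have e := increment_ae_eq f hz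
  refine le_of_eq_of_le (congrArg _ (integral_congr_ae ?_)) (h ((hc.sub hr).ae_eq e.symm))
  filter_upwards [e] with x hx
  rw [hx]

/-- The budget of the estimate. Replacing `‖A₀z‖²` by `‖Az‖²` leaves `ν₂/2` of dissipation at the
cost of `ν₂‖z‖²`. One half of this pays for three terms of size `ε = ν₂/12` (from `f`, `g` and the
coupling), the other half for the coercivity inequality. Likewise `‖∇w‖²` is shared equally between
the coupling and coercivity. `Λ` collects every multiple of `‖z‖²` produced on the way, plus the
desired rate. -/
theorem energy_arith {ν₀ ν₁ ν₂ ε Kf Kg Λ μ h A A₀ g q i If Ig Ap P w lam₁ lam₂ Ξ₁ Ξ₂ : ℝ}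
    (hε : ε = ν₂ / 12) (hν₂ : 0 < ν₂)
    (hΛ : Λ = Kf + Kg + ν₂ + ((ν₁ + ν₀) ^ 2 / 2 + |ν₁ * ν₀|) ^ 2 / (4 * ε) + μ)
    (hgA : g ^ 2 ≤ A * h) (hA : A ^ 2 ≤ 2 * A₀ ^ 2 + 2 * h ^ 2)
    (hi : |i| ≤ g * q)
    (hf : -If ≤ ε * A ^ 2 + Kf * h ^ 2) (hg : -Ig ≤ ε * A ^ 2 + Kg * h ^ 2)
    (e₁ : Ξ₁ + ν₂ * A₀ ^ 2 + If - ν₁ * (i - ν₀ * g ^ 2) + Ig = -lam₁ * Ap ^ 2)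
    (e₂ : Ξ₂ + (q ^ 2 - ν₀ * i) = -lam₂ * P ^ 2)
    (c₁ : Λ * h ^ 2 ≤ ν₂ / 4 * A ^ 2 + (2 * Λ + ν₂ / 4) * Ap ^ 2)
    (c₂ : μ * w ^ 2 ≤ 1 / 2 * q ^ 2 + (2 * μ + 1 / 2) * P ^ 2)
    (l₁ : 2 * Λ + ν₂ / 4 ≤ lam₁) (l₂ : 2 * μ + 1 / 2 ≤ lam₂) :
    Ξ₁ + Ξ₂ ≤ -μ * (h ^ 2 + w ^ 2) := by
  set β := (ν₁ + ν₀) ^ 2 / 2 + |ν₁ * ν₀| with hβ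
  have hβ0 : 0 ≤ β := by positivity
  have hε0 : 0 < ε := by rw [hε]; positivity
  have k1 : (ν₁ + ν₀) * i ≤ q ^ 2 / 2 + (ν₁ + ν₀) ^ 2 / 2 * g ^ 2 := by
    have : (ν₁ + ν₀) * i ≤ |ν₁ + ν₀| * (g * q) := by
      refine (le_abs_self _).trans ?_
      rw [abs_mul]
      exact mul_le_mul_of_nonneg_left hi (abs_nonneg _)
    have h2 := sq_nonneg (q - |ν₁ + ν₀| * g)
    have h3 := sq_abs (ν₁ + ν₀)
    nlinarith
  have k2 : -(ν₁ * ν₀) * g ^ 2 ≤ |ν₁ * ν₀| * g ^ 2 :=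
    mul_le_mul_of_nonneg_right (neg_le_abs _) (sq_nonneg _)
  -- Interpolation `g² ≤ A h` and Young's inequality, as a completed square.
  have k3 : β * g ^ 2 ≤ ε * A ^ 2 + β ^ 2 / (4 * ε) * h ^ 2 := by
    have h1 : β * g ^ 2 ≤ β * (A * h) := mul_le_mul_of_nonneg_left hgA hβ0
    have h2 : ε * A ^ 2 + β ^ 2 / (4 * ε) * h ^ 2 - β * (A * h)
        = ε * (A - β / (2 * ε) * h) ^ 2 := by
      field_simp
      ring
    have h3 : 0 ≤ ε * (A - β / (2 * ε) * h) ^ 2 := by positivity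
    linarith
  have k4 : lam₁ * Ap ^ 2 ≥ (2 * Λ + ν₂ / 4) * Ap ^ 2 :=
    mul_le_mul_of_nonneg_right l₁ (sq_nonneg _)
  have k5 : lam₂ * P ^ 2 ≥ (2 * μ + 1 / 2) * P ^ 2 :=
    mul_le_mul_of_nonneg_right l₂ (sq_nonneg _)
  have k6 : ν₂ * A ^ 2 ≤ ν₂ * (2 * A₀ ^ 2 + 2 * h ^ 2) := mul_le_mul_of_nonneg_left hA hν₂.le
  have k7 : Λ * h ^ 2 = Kf * h ^ 2 + Kg * h ^ 2 + ν₂ * h ^ 2 + β ^ 2 / (4 * ε) * h ^ 2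
      + μ * h ^ 2 := by rw [hΛ]; ring
  have k8 : ε * A ^ 2 = ν₂ / 12 * A ^ 2 := by rw [hε]
  have k9 : β * g ^ 2 = (ν₁ + ν₀) ^ 2 / 2 * g ^ 2 + |ν₁ * ν₀| * g ^ 2 := by rw [hβ]; ring
  linarith

theorem energy_deriv_le {C₁ R₁ p : DA D bc} {C₂ R₂ P : V D bc} {c₁ r₁ c₂ r₂ q₁ q₂ : H D}
    {ξ₁ χ₁ h₁ : StrongDual ℝ (DA D bc)} {ξ₂ χ₂ h₂ : StrongDual ℝ (V D bc)} {f g : ℝ → ℝ}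
    {ν₀ ν₁ ν₂ ε Kf Kg Λ μ lam₁ lam₂ Bf Bg : ℝ}
    (hε : ε = ν₂ / 12) (hν₂ : 0 < ν₂)
    (hΛ : Λ = Kf + Kg + ν₂ + ((ν₁ + ν₀) ^ 2 / 2 + |ν₁ * ν₀|) ^ 2 / (4 * ε) + μ)
    (hc₁ : DA.toH D bc C₁ = c₁) (hr₁ : DA.toH D bc R₁ = r₁)
    (hc₂ : V.toH D bc C₂ = c₂) (hr₂ : V.toH D bc R₂ = r₂)
    (hfc : MemLp (fun x => f (c₁ x)) 2 (volume.restrict D.region))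
    (hfr : MemLp (fun x => f (r₁ x)) 2 (volume.restrict D.region))
    (hgc : MemLp (fun x => g (c₁ x)) 2 (volume.restrict D.region))
    (hgr : MemLp (fun x => g (r₁ x)) 2 (volume.restrict D.region))
    (hwc₁ : ∀ φ : DA D bc, ξ₁ φ + ν₂ * inner ℝ (DA.A₀ D bc C₁) (DA.A₀ D bc φ)
      + (∫ x in D.region, (f (c₁ x) - f 0) * DA.A₀ D bc φ x) - ν₁ * inner ℝ c₂ (DA.A₀ D bc φ)
      + (∫ x in D.region, g (c₁ x) * DA.toH D bc φ x) = h₁ φ + inner ℝ q₁ (DA.toH D bc φ))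
    (hwr₁ : ∀ φ : DA D bc, χ₁ φ + ν₂ * inner ℝ (DA.A₀ D bc R₁) (DA.A₀ D bc φ)
      + (∫ x in D.region, (f (r₁ x) - f 0) * DA.A₀ D bc φ x) - ν₁ * inner ℝ r₂ (DA.A₀ D bc φ)
      + (∫ x in D.region, g (r₁ x) * DA.toH D bc φ x)
      = h₁ φ + inner ℝ (0 : H D) (DA.toH D bc φ))
    (hwc₂ : ∀ ψ : V D bc, ξ₂ ψ + inner ℝ (V.grad D bc C₂) (V.grad D bc ψ)
      = h₂ ψ + inner ℝ q₂ (V.toH D bc ψ))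
    (hwr₂ : ∀ ψ : V D bc, χ₂ ψ + inner ℝ (V.grad D bc R₂) (V.grad D bc ψ)
      = h₂ ψ + inner ℝ (0 : H D) (V.toH D bc ψ))
    (hF : MemLp (fun x => f (r₁ x + DA.toH D bc (C₁ - R₁) x) - f (r₁ x)) 2
        (volume.restrict D.region) →
      -(∫ x in D.region, (f (r₁ x + DA.toH D bc (C₁ - R₁) x) - f (r₁ x))
        * DA.A₀ D bc (C₁ - R₁) x) ≤ Bf)
    (hG : MemLp (fun x => g (r₁ x + DA.toH D bc (C₁ - R₁) x) - g (r₁ x)) 2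
        (volume.restrict D.region) →
      -(∫ x in D.region, (g (r₁ x + DA.toH D bc (C₁ - R₁) x) - g (r₁ x))
        * DA.toH D bc (C₁ - R₁) x) ≤ Bg)
    (hBf : Bf ≤ ε * ‖DA.A D bc (C₁ - R₁)‖ ^ 2 + Kf * ‖DA.toH D bc (C₁ - R₁)‖ ^ 2)
    (hBg : Bg ≤ ε * ‖DA.A D bc (C₁ - R₁)‖ ^ 2 + Kg * ‖DA.toH D bc (C₁ - R₁)‖ ^ 2)
    (hq₁ : inner ℝ q₁ (c₁ - r₁) = -lam₁ * ‖DA.A D bc p‖ ^ 2)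
    (hq₂ : inner ℝ q₂ (c₂ - r₂ + ν₀ • (c₁ - r₁)) = -lam₂ * ‖P‖ ^ 2)
    (hco₁ : Λ * ‖DA.toH D bc (C₁ - R₁)‖ ^ 2
      ≤ ν₂ / 4 * ‖DA.A D bc (C₁ - R₁)‖ ^ 2 + (2 * Λ + ν₂ / 4) * ‖DA.A D bc p‖ ^ 2)
    (hco₂ : μ * ‖V.toH D bc (C₂ - R₂ + ν₀ • DA.toV D bc (C₁ - R₁))‖ ^ 2
      ≤ 1 / 2 * ‖V.grad D bc (C₂ - R₂ + ν₀ • DA.toV D bc (C₁ - R₁))‖ ^ 2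
        + (2 * μ + 1 / 2) * ‖P‖ ^ 2)
    (hlam₁ : 2 * Λ + ν₂ / 4 ≤ lam₁) (hlam₂ : 2 * μ + 1 / 2 ≤ lam₂) :
    (ξ₁ - χ₁) (C₁ - R₁) + (ξ₂ - χ₂) (C₂ - R₂ + ν₀ • DA.toV D bc (C₁ - R₁))
      ≤ -μ * (‖c₁ - r₁‖ ^ 2 + ‖c₂ - r₂ + ν₀ • (c₁ - r₁)‖ ^ 2) := by
  have hz : DA.toH D bc (C₁ - R₁) = c₁ - r₁ := by rw [map_sub, hc₁, hr₁]
  have hw : V.toH D bc (C₂ - R₂ + ν₀ • DA.toV D bc (C₁ - R₁)) = c₂ - r₂ + ν₀ • (c₁ - r₁) := by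
    rw [map_add, map_sub, map_smul, DA.toH_toV, hz, hc₂, hr₂]
  have e₁ := weak_energy₁ (ν₀ := ν₀) hc₂ hr₂ hfc hfr hgc hgr hwc₁ hwr₁
  have e₂ := weak_energy₂ (v := DA.toV D bc (C₁ - R₁)) (ν := ν₀) hwc₂ hwr₂
  have b₁ := (neg_integral_increment_le hz hfc hfr hF).trans hBf
  have b₂ := (neg_integral_increment_le hz hgc hgr hG).trans hBg
  rw [hz, hq₁] at e₁
  rw [hw, hq₂] at e₂
  have hgA := (pow_le_pow_left₀ (norm_nonneg _) (V.norm_grad_le (DA.toV D bc (C₁ - R₁))) 2).trans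
    (DA.norm_toV_sq_le (C₁ - R₁))
  have hA := DA.norm_A_sq_le (C₁ - R₁)
  rw [hz] at hgA hA b₁ b₂ hco₁
  rw [hw] at hco₂
  exact energy_arith hε hν₂ hΛ hgA hA (abs_real_inner_le_norm _ _) b₁ b₂ e₁ e₂ hco₁ hco₂
    hlam₁ hlam₂

theorem normHH_sq (u v : H D) : normHH u v ^ 2 = ‖u‖ ^ 2 + ‖v‖ ^ 2 :=
  Real.sq_sqrt (by positivity)

theorem normHH_sq_add_smul_le (ν : ℝ) (u v : H D) :
    ‖u‖ ^ 2 + ‖v + ν • u‖ ^ 2 ≤ 2 * (1 + ν ^ 2) * normHH u v ^ 2 := by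
  rw [normHH_sq]
  have h1 : ‖v + ν • u‖ ≤ ‖v‖ + |ν| * ‖u‖ := by
    refine (norm_add_le _ _).trans (le_of_eq ?_)
    rw [norm_smul, Real.norm_eq_abs]
  have h2 := sq_abs ν
  have h3 : ‖v + ν • u‖ ^ 2 ≤ (‖v‖ + |ν| * ‖u‖) ^ 2 := by gcongr
  nlinarith [sq_nonneg (‖v‖ - |ν| * ‖u‖), sq_nonneg ‖u‖, mul_nonneg (sq_nonneg ν) (sq_nonneg ‖v‖)]

end Stabilization

end CahnHilliard

/-! ### Choice of the parameters and conclusion -/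

open CahnHilliard in
theorem corollary3p3 {d : ℕ} (D : CahnHilliard.Domain d) (bc : CahnHilliard.BoundaryCondition)
    (hD : D.Admissible bc) (a : CahnHilliard.ActuatorData D) (μ : ℝ) (hμ : 0 < μ) :
    ∃ lam₂bar : ℝ, 0 ≤ lam₂bar ∧
    ∀ (R : ℝ), 0 < R → ∀ (ν₀ ν₁ ν₂ : ℝ), 0 < ν₂ →
    ∀ (n : ℕ), 0 < n → ∀ (Cf Cg : ℝ), 0 ≤ Cf → 0 ≤ Cg →
    ∀ (ζf ηf ζg ηg : Fin n → ℝ),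
    (∀ i, 0 ≤ ζf i ∧ 0 ≤ ηf i ∧ ηf i < 2 ∧ 2 ≤ ζf i + ηf i) →
    (∀ i, 0 ≤ ζg i ∧ 0 ≤ ηg i ∧ ηg i < 2 ∧ 2 ≤ ζg i + ηg i) →
    ∃ Mbar : ℕ, 0 < Mbar ∧ ∃ lam₁bar : ℝ, 0 ≤ lam₁bar ∧
    ∀ (f g : ℝ → ℝ)
      (h₁ : ℝ → StrongDual ℝ (CahnHilliard.DA D bc)) (h₂ : ℝ → StrongDual ℝ (CahnHilliard.V D bc))
      (yr₁ yr₂ : ℝ → CahnHilliard.H D),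
    CahnHilliard.IsTrajectory D bc ν₀ ν₁ ν₂ f g h₁ h₂ yr₁ yr₂ →
    CahnHilliard.GrowthF D bc f yr₁ Cf ζf ηf →
    CahnHilliard.GrowthG D bc g yr₁ Cg ζg ηg →
    ∀ (M : ℕ) (lam₁ lam₂ : ℝ), Mbar ≤ M → lam₁bar ≤ lam₁ → lam₂bar ≤ lam₂ →
    ∀ (yc₁ yc₂ : ℝ → CahnHilliard.H D),
    CahnHilliard.IsControlledTrajectory D bc a M lam₁ lam₂ ν₀ ν₁ ν₂ f g h₁ h₂ yr₁ yr₂ yc₁ yc₂ →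
    CahnHilliard.normHH (yc₁ 0 - yr₁ 0) ((yc₂ 0 - yr₂ 0) + ν₀ • (yc₁ 0 - yr₁ 0)) ≤ R →
    ∀ s t : ℝ, 0 ≤ s → s ≤ t →
      CahnHilliard.normHH (yc₁ t - yr₁ t) (yc₂ t - yr₂ t) ^ 2
        ≤ 4 * (1 + ν₀ ^ 2) ^ 2 * Real.exp (-2 * μ * (t - s))
          * CahnHilliard.normHH (yc₁ s - yr₁ s) (yc₂ s - yr₂ s) ^ 2 := by
  obtain ⟨N₂, hN₂⟩ := a.exists_coercive₂ hD hμ.le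
  -- The factor of `‖p‖²` in the second coercivity inequality with `Λ = μ`; the nonlinearity and the
  -- coupling only enlarge the `Λ` of the first equation.
  refine ⟨2 * μ + 1 / 2, by positivity, ?_⟩
  intro R hR ν₀ ν₁ ν₂ hν₂ n _ Cf Cg hCf hCg ζf ηf ζg ηg hf hg
  set ε := ν₂ / 12 with hε
  have hε0 : 0 < ε := by positivity
  -- Below the threshold `R² + 1` for the energy, the first component has norm at most `R + 1`.
  obtain ⟨Kf, hKf0, hKf⟩ := exists_growth_le hf hCf (R + 1) hε0
  obtain ⟨Kg, hKg0, hKg⟩ := exists_growth_le hg hCg (R + 1) hε0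
  set Λ := Kf + Kg + ν₂ + ((ν₁ + ν₀) ^ 2 / 2 + |ν₁ * ν₀|) ^ 2 / (4 * ε) + μ with hΛ
  have hΛ0 : 0 ≤ Λ := by positivity
  obtain ⟨N₁, hN₁⟩ := a.exists_coercive₁ hD hΛ0 (show 0 < ν₂ / 4 by positivity)
  refine ⟨max 1 (max N₁ N₂), by simp, 2 * Λ + ν₂ / 4, by positivity, ?_⟩
  intro f g h₁ h₂ yr₁ yr₂ hr hGf hGg M lam₁ lam₂ hM hlam₁ hlam₂ yc₁ yc₂ hc hinit s t hs hst
  have hM0 : 0 < M := by have := (le_max_left _ _).trans hM; omega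
  have hM1 : N₁ ≤ M := ((le_max_left _ _).trans (le_max_right _ _)).trans hM
  have hM2 : N₂ ≤ M := ((le_max_right _ _).trans (le_max_right _ _)).trans hM
  obtain ⟨R₁, R₂, χ₁, χ₂, hR₁, hR₂, hχ₁, hχ₂, hdr₁, hdr₂, hre⟩ := hr.exists_weak
  obtain ⟨C₁, C₂, ξ₁, ξ₂, hC₁, hC₂, hξ₁, hξ₂, hdc₁, hdc₂, hce⟩ := hc.exists_weak
  have hyc : ContinuousOn (fun t => yc₁ t - yr₁ t) (Ici 0) :=
    hc.continuousOn₁.sub hr.continuousOn₁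
  have hwc : ContinuousOn (fun t => yc₂ t - yr₂ t + ν₀ • (yc₁ t - yr₁ t)) (Ici 0) :=
    (hc.continuousOn₂.sub hr.continuousOn₂).add (hyc.const_smul ν₀)
  have hZL : L2Loc fun t => C₁ t - R₁ t := hC₁.sub hR₁
  have hWL : L2Loc fun t => C₂ t - R₂ t + ν₀ • DA.toV D bc (C₁ t - R₁ t) :=
    (hC₂.sub hR₂).add (hZL.clm_comp (ν₀ • DA.toV D bc))
  have hd₁ : IsTimeDeriv (DA.toH D bc) (fun t => yc₁ t - yr₁ t) fun t => ξ₁ t - χ₁ t :=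
    hdc₁.sub hdr₁ hξ₁ hχ₁
  have hd₂ : IsTimeDeriv (V.toH D bc) (fun t => yc₂ t - yr₂ t + ν₀ • (yc₁ t - yr₁ t))
      fun t => ξ₂ t - χ₂ t := by
    have h1 := hdc₂.sub hdr₂ hξ₂ hχ₂
    have h2 : (fun t => yc₂ t - yr₂ t + ν₀ • (yc₁ t - yr₁ t))
        = fun t => yc₂ t + ν₀ • yc₁ t - (yr₂ t + ν₀ • yr₁ t) := by
      funext t
      rw [smul_sub]
      abel
    rw [h2]
    exact h1
  have hZy : ∀ᵐ t ∂volume.restrict (Ioi (0 : ℝ)),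
      DA.toH D bc (C₁ t - R₁ t) = yc₁ t - yr₁ t := by
    filter_upwards [hre, hce] with t k1 k2
    rw [map_sub, k1.1, k2.1]
  have hWw : ∀ᵐ t ∂volume.restrict (Ioi (0 : ℝ)),
      V.toH D bc (C₂ t - R₂ t + ν₀ • DA.toV D bc (C₁ t - R₁ t))
        = yc₂ t - yr₂ t + ν₀ • (yc₁ t - yr₁ t) := by
    filter_upwards [hre, hce, hZy] with t k1 k2 k3
    rw [map_add, map_sub, k1.2.1, k2.2.1, map_smul, DA.toH_toV, k3]
  have hξχ₁ := hξ₁.sub hχ₁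
  have hξχ₂ := hξ₂.sub hχ₂
  have hbE : ∀ᵐ τ ∂volume.restrict (Ioi (0 : ℝ)),
      ‖yc₁ τ - yr₁ τ‖ ^ 2 + ‖yc₂ τ - yr₂ τ + ν₀ • (yc₁ τ - yr₁ τ)‖ ^ 2 ≤ R ^ 2 + 1 →
      2 * ((ξ₁ τ - χ₁ τ) (C₁ τ - R₁ τ)
          + (ξ₂ τ - χ₂ τ) (C₂ τ - R₂ τ + ν₀ • DA.toV D bc (C₁ τ - R₁ τ)))
        ≤ -(2 * μ) * (‖yc₁ τ - yr₁ τ‖ ^ 2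
          + ‖yc₂ τ - yr₂ τ + ν₀ • (yc₁ τ - yr₁ τ)‖ ^ 2) := by
    filter_upwards [hre, hce, hZy, hWw, hGf, hGg] with τ k1 k2 k3 k4 k5 k6 hτ
    obtain ⟨r1, r2, rf, rg, req₁, req₂⟩ := k1
    obtain ⟨c1, c2, cf, cg, ceq₁, ceq₂⟩ := k2
    have hyR : ‖DA.toH D bc (C₁ τ - R₁ τ)‖ ≤ R + 1 := by
      rw [k3]
      refine le_of_sq_le_sq ?_ (by positivity)
      nlinarith [sq_nonneg ‖yc₂ τ - yr₂ τ + ν₀ • (yc₁ τ - yr₁ τ)‖]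
    obtain ⟨p, hp, hp'⟩ := a.exists_feedback₁ (bc := bc) hD hM0 lam₁ (yc₁ τ - yr₁ τ)
    obtain ⟨P, hP, hP'⟩ :=
      a.exists_feedback₂ (bc := bc) hD hM0 lam₂ (yc₂ τ - yr₂ τ + ν₀ • (yc₁ τ - yr₁ τ))
    have e := energy_deriv_le hε hν₂ hΛ c1 r1 c2 r2 cf rf cg rg ceq₁ req₁ ceq₂ req₂
      (k5 (C₁ τ - R₁ τ)) (k6 (C₁ τ - R₁ τ))
      (hKf _ _ (norm_nonneg _) hyR (norm_nonneg _)) (hKg _ _ (norm_nonneg _) hyR (norm_nonneg _))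
      hp' hP' (hN₁ M hM0 hM1 (C₁ τ - R₁ τ) p (by rw [k3]; exact hp))
      (hN₂ M hM0 hM2 (C₂ τ - R₂ τ + ν₀ • DA.toV D bc (C₁ τ - R₁ τ)) P (by rw [k4]; exact hP))
      hlam₁ hlam₂
    linarith
  -- The rate doubles because the derivative of the squared norms is twice the duality pairing.
  have hmain := exponential_decay (μ := 2 * μ) (r := R ^ 2) (ρ := R ^ 2 + 1)
    (E := fun t => ‖yc₁ t - yr₁ t‖ ^ 2 + ‖yc₂ t - yr₂ t + ν₀ • (yc₁ t - yr₁ t)‖ ^ 2)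
    (b := fun t => 2 * ((ξ₁ t - χ₁ t) (C₁ t - R₁ t)
      + (ξ₂ t - χ₂ t) (C₂ t - R₂ t + ν₀ • DA.toV D bc (C₁ t - R₁ t))))
    (by positivity) ((hyc.norm.pow 2).add (hwc.norm.pow 2)) (fun t _ => by positivity)
    (by
      rw [← normHH_sq]
      exact pow_le_pow_left₀ (Real.sqrt_nonneg _) hinit 2)
    (by linarith)
    (fun T hT => ((hξχ₁.integrableOn_apply hZL hT).add (hξχ₂.integrableOn_apply hWL hT)).const_mul 2)
    (fun s t hs hst => by
      have i1 := norm_sq_sub_le_of_isTimeDeriv hyc hZL hξχ₁ hd₁ hZy hs hst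
      have i2 := norm_sq_sub_le_of_isTimeDeriv hwc hWL hξχ₂ hd₂ hWw hs hst
      rw [intervalIntegral.integral_const_mul, intervalIntegral.integral_add
        (hξχ₁.intervalIntegrable_apply hZL hs hst) (hξχ₂.intervalIntegrable_apply hWL hs hst)]
      linarith)
    hbE hs hst
  -- With `-ν₀` the comparison undoes the change of variables at time `t`; with `ν₀` it performs it
  -- at time `s`.
  have j1 := normHH_sq_add_smul_le (-ν₀) (yc₁ t - yr₁ t)
    (yc₂ t - yr₂ t + ν₀ • (yc₁ t - yr₁ t))
  rw [normHH_sq, neg_smul, add_neg_cancel_right, neg_sq, ← normHH_sq] at j1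
  have j2 := normHH_sq_add_smul_le ν₀ (yc₁ s - yr₁ s) (yc₂ s - yr₂ s)
  have hν : 0 ≤ 2 * (1 + ν₀ ^ 2) := by positivity
  refine (j1.trans (mul_le_mul_of_nonneg_left
    (hmain.trans (mul_le_mul_of_nonneg_left j2 (Real.exp_pos _).le)) hν)).trans_eq ?_
  rw [show -(2 * μ) * (t - s) = -2 * μ * (t - s) by ring]
  ring
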